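/- Let $\mathsf k$ be an ordered field. A *prop* is a symmetric strict monoidal category whose objects are the natural numbers, with tensor $\oplus$ given by addition on objects; $;$ denotes composition in diagrammatic order, $1$ the identity on one wire and $\sigma$ the symmetry of two wires. Let $\overrightarrow{\mathsf{Circ}}$ (the *matrix circuits*) be the prop freely generated by $$c\colon 1\to 2,\quad d\colon 1\to 0,\quad s_r\colon 1\to 1\ (r\in\mathsf k),\quad a\colon 2\to 1,\quad z\colon 0\to 1$$ (copy, delete, scalar, add, zero), and let $\mathsf{Circ}^{\ge}$ be the prop freely generated by these generators, mirror images $c^{*}\colon 2\to1$, $d^{*}\colon 0\to1$, $s_r^{*}\colon1\to1$, $a^{*}\colon1\to2$, $z^{*}\colon1\to0$ of them, and a generator ${\ge}\colon 1\to 1$. A circuit $n\to m$ denotes a relation $[\![\cdot]\!]\subseteq\mathsf k^n\times\mathsf k^m$, where composition is relational composition, $\oplus$ is cartesian product, and the generators denote $\{(x,(x,x))\}$, $\{(x,\bullet)\}$, $\{(x,rx)\}$, $\{((x,y),x+y)\}$, $\{(\bullet,0)\}$, the converses of these, and $\{(x,y)\mid x\ge y\}$. Let $\cup = d^{*};c$,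 let $\cap = c^{*};d$, and let ${\le}\colon 1\to 1$ be $(\cup\oplus 1);(1\oplus{\ge}\oplus 1);(1\oplus\cap)$. Let $\subseteq_{\mathbb{IHP}}$ be the smallest precongruence (with respect to $;$ and $\oplus$) on $\mathsf{Circ}^{\ge}$ containing the axioms below, each equation being read as two inequalities, and write $c_1=_{\mathbb{IHP}}c_2$ if $c_1\subseteq_{\mathbb{IHP}}c_2$ and $c_2\subseteq_{\mathbb{IHP}}c_1$. *Axioms of Interacting Hopf Algebras, together with their mirror images:* - $(a,z)$ is a commutative monoid and $(c,d)$ is a cocommutative comonoid; - $a;c=(c\oplus c);(1\oplus\sigma\oplus1);(a\oplus a)$, $\ z;c=z\oplus z$, $\ a;d=d\oplus d$, $\ z;d=id_0$; - $a;s_r=(s_r\oplus s_r);a$, $\ z;s_r=z$, $\ s_r;c=c;(s_r\oplus s_r)$, $\ s_r;d=d$, $\ s_r;s_t=s_{rt}$, $\ c;(s_r\oplus s_t);a=s_{r+t}$, $\ s_0=d;z$; - $s_r;s_r^{*}=1=s_r^{*};s_r$ for $r\neq0$; - $(c\oplus1);(1\oplus c^{*})=c^{*};c=(1\oplus c);(c^{*}\oplus1)$,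 $\ c;c^{*}=1$, $\ d^{*};d=id_0$; - $(a^{*}\oplus1);(1\oplus a)=a;a^{*}=(1\oplus a^{*});(a\oplus1)$, $\ a^{*};a=1$, $\ z;z^{*}=id_0$; - $a;z^{*}=(s_{-1}\oplus1);\cap$, $\ z;a^{*}=\cup;(s_{-1}\oplus1)$, $\ z^{*}\subseteq d$. *Axioms for the order:* - ${\ge};c\subseteq c;({\ge}\oplus{\ge})$, $\ a;{\ge}=({\ge}\oplus{\ge});a$, $\ {\ge};d=d$, $\ z^{*}\subseteq{\ge};z^{*}$; - $s_r;{\ge}={\ge};s_r$ for $r>0$, $\ s_r;{\ge}={\le};s_r$ for $r<0$; - $c;({\ge}\oplus{\le});c^{*}\subseteq1$, $\ {\le};{\ge}=d;d^{*}$; - $({\ge}\oplus{\ge});c^{*};c;({\ge}\oplus{\ge})=(c\oplus c);({\ge}\oplus{\ge}\oplus{\ge}\oplus{\ge});(1\oplus\sigma\oplus1);(c^{*}\oplus c^{*})$. For a matrix circuit $A\colon n+m\to p$ let $P(A)\colon n\to m$ be the circuit $$\bigl(id_n\oplus(d^{*}_m;c_m)\bigr);\bigl((A;{\ge}_p;z^{*}_p)\oplus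 id_m\bigr),$$ where $d^{*}_m,c_m,{\ge}_p,z^{*}_p$ are the versions of the generators for $m$ or $p$ wires. A circuit is in *polyhedral normal form* if it equals $P(A)$ for some $p\in\mathbb N$ and some matrix circuit $A\colon n+m\to p$. **Theorem (First Normal Form).** For each circuit $c\colon n\to m$ of $\mathsf{Circ}^{\ge}$ there is a circuit $d\colon n\to m$ of $\mathsf{Circ}^{\ge}$ in polyhedral normal form such that $c=_{\mathbb{IHP}}d$. Moreover, every matrix circuit $A\colon n+m\to p$ denotes the graph $\{(v,w)\mid w=Mv\}$ of some $p\times(n+m)$ matrix $M$ over $\mathsf k$ for which $$[\![P(A)]\!]=\Bigl\{(x,y)\in\mathsf k^n\times\mathsf k^m\;\Big|\;M\begin{pmatrix}x\\y\end{pmatrix}\ge0\Bigr\}.$$ -/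

import Mathlib

universe u

/-! ## Free props

The prop freely generated by a monoidal signature `S`, where `S n m` is the type of generators
with arity `n` and coarity `m`. -/

/-- `S`-terms `n → m`. -/
inductive PTerm (S : ℕ → ℕ → Type u) : ℕ → ℕ → Type u
  | gen {n m : ℕ} (g : S n m) : PTerm S n m
  | id (n : ℕ) : PTerm S n n
  | swap (n m : ℕ) : PTerm S (n + m) (m + n)
  | comp {n m o : ℕ} (f : PTerm S n m) (g : PTerm S m o) : PTerm S n o
  | tensor {n m n' m' : ℕ} (f : PTerm S n m) (g : PTerm S n' m') : PTerm S (n + n') (m + m')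

namespace PTerm

variable {S T : ℕ → ℕ → Type u}

/-- Transport of a term along equalities of its arity and coarity. -/
def cast {n n' m m' : ℕ} (hn : n = n') (hm : m = m') (t : PTerm S n m) : PTerm S n' m' :=
  hm ▸ hn ▸ t

/-- The smallest congruence on terms containing the laws of symmetric strict monoidal
categories. -/
inductive SSM : ∀ {n m : ℕ}, PTerm S n m → PTerm S n m → Prop
  | refl {n m} (f : PTerm S n m) : SSM f f
  | symm {n m} {f g : PTerm S n m} : SSM f g → SSM g f
  | trans {n m} {f g h : PTerm S n m} : SSM f g → SSM g h → SSM f h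
  | comp_congr {n m o} {f f' : PTerm S n m} {g g' : PTerm S m o} :
      SSM f f' → SSM g g' → SSM (comp f g) (comp f' g')
  | tensor_congr {n m n' m'} {f f' : PTerm S n m} {g g' : PTerm S n' m'} :
      SSM f f' → SSM g g' → SSM (tensor f g) (tensor f' g')
  | id_comp {n m} (f : PTerm S n m) : SSM (comp (id n) f) f
  | comp_id {n m} (f : PTerm S n m) : SSM (comp f (id m)) f
  | comp_assoc {n m o p} (f : PTerm S n m) (g : PTerm S m o) (h : PTerm S o p) :
      SSM (comp (comp f g) h) (comp f (comp g h))
  | id_tensor_id (n m : ℕ) : SSM (tensor (id n) (id m)) (id (n + m))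
  | interchange {n m o n' m' o'} (f : PTerm S n m) (g : PTerm S m o)
      (f' : PTerm S n' m') (g' : PTerm S m' o') :
      SSM (tensor (comp f g) (comp f' g')) (comp (tensor f f') (tensor g g'))
  | id_zero_tensor {n m} (f : PTerm S n m) :
      SSM (cast (Nat.zero_add n) (Nat.zero_add m) (tensor (id 0) f)) f
  | tensor_id_zero {n m} (f : PTerm S n m) :
      SSM (cast (Nat.add_zero n) (Nat.add_zero m) (tensor f (id 0))) f
  | tensor_assoc {n m n' m' n'' m''} (f : PTerm S n m) (g : PTerm S n' m') (h : PTerm S n'' m'') :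
      SSM (cast (Nat.add_assoc n n' n'') (Nat.add_assoc m m' m'') (tensor (tensor f g) h))
        (tensor f (tensor g h))
  | swap_natural {n m n' m'} (f : PTerm S n m) (g : PTerm S n' m') :
      SSM (comp (tensor f g) (swap m m')) (comp (swap n n') (tensor g f))
  | swap_swap (n m : ℕ) : SSM (comp (swap n m) (swap m n)) (id (n + m))
  | swap_zero (n : ℕ) :
      SSM (cast (Nat.add_zero n) (Nat.zero_add n) (swap n 0)) (id n)
  | hexagon (n m o : ℕ) :
      SSM (cast (Nat.add_assoc n m o).symm (Nat.add_assoc m o n) (swap n (m + o)))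
        (comp (cast rfl (Nat.add_assoc m n o) (tensor (swap n m) (id o)))
          (tensor (id m) (swap n o)))

/-- The setoid of the congruence `SSM`. -/
def setoid (S : ℕ → ℕ → Type u) (n m : ℕ) : Setoid (PTerm S n m) :=
  ⟨SSM, SSM.refl, SSM.symm, SSM.trans⟩

/-- Renaming of generators. -/
def map (φ : ∀ {n m : ℕ}, S n m → T n m) : ∀ {n m : ℕ}, PTerm S n m → PTerm T n m
  | _, _, gen g => gen (φ g)
  | _, _, id n => id n
  | _, _, swap n m => swap n m
  | _, _, comp f g => comp (map φ f) (map φ g)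
  | _, _, tensor f g => tensor (map φ f) (map φ g)

theorem map_cast (φ : ∀ {n m : ℕ}, S n m → T n m) {n n' m m' : ℕ} (hn : n = n') (hm : m = m')
    (t : PTerm S n m) : map φ (cast hn hm t) = cast hn hm (map φ t) := by
  subst hn hm; rfl

theorem SSM.map (φ : ∀ {n m : ℕ}, S n m → T n m) {n m : ℕ} {f g : PTerm S n m} (h : SSM f g) :
    SSM (PTerm.map φ f) (PTerm.map φ g) := by
  induction h with
  | refl f => exact SSM.refl _
  | symm _ ih => exact ih.symm
  | trans _ _ ih₁ ih₂ => exact ih₁.trans ih₂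
  | comp_congr _ _ ih₁ ih₂ => exact SSM.comp_congr ih₁ ih₂
  | tensor_congr _ _ ih₁ ih₂ => exact SSM.tensor_congr ih₁ ih₂
  | id_comp f => exact SSM.id_comp _
  | comp_id f => exact SSM.comp_id _
  | comp_assoc f g h => exact SSM.comp_assoc _ _ _
  | id_tensor_id n m => exact SSM.id_tensor_id _ _
  | interchange f g f' g' => exact SSM.interchange _ _ _ _
  | id_zero_tensor f => rw [map_cast]; exact SSM.id_zero_tensor _
  | tensor_id_zero f => rw [map_cast]; exact SSM.tensor_id_zero _
  | tensor_assoc f g h => rw [map_cast]; exact SSM.tensor_assoc _ _ _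
  | swap_natural f g => exact SSM.swap_natural _ _
  | swap_swap n m => exact SSM.swap_swap _ _
  | swap_zero n => rw [map_cast]; exact SSM.swap_zero _
  | hexagon n m o =>
    simp only [PTerm.map, map_cast]
    exact SSM.hexagon _ _ _

end PTerm

/-- Arrows `n → m` of the prop freely generated by the signature `S`: terms modulo the laws of
symmetric strict monoidal categories. -/
def FreeProp (S : ℕ → ℕ → Type u) (n m : ℕ) : Type u :=
  Quotient (PTerm.setoid S n m)

namespace FreeProp

variable {S T : ℕ → ℕ → Type u}

def gen {n m : ℕ} (g : S n m) : FreeProp S n m := Quotient.mk _ (PTerm.gen g)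

def id (n : ℕ) : FreeProp S n n := Quotient.mk _ (PTerm.id n)

def swap (n m : ℕ) : FreeProp S (n + m) (m + n) := Quotient.mk _ (PTerm.swap n m)

/-- Sequential composition, in diagrammatic order. -/
def comp {n m o : ℕ} (f : FreeProp S n m) (g : FreeProp S m o) : FreeProp S n o :=
  Quotient.map₂ PTerm.comp (fun _ _ h₁ _ _ h₂ => PTerm.SSM.comp_congr h₁ h₂) f g

/-- Parallel composition. -/
def tensor {n m n' m' : ℕ} (f : FreeProp S n m) (g : FreeProp S n' m') :
    FreeProp S (n + n') (m + m') :=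
  Quotient.map₂ PTerm.tensor (fun _ _ h₁ _ _ h₂ => PTerm.SSM.tensor_congr h₁ h₂) f g

/-- Transport of an arrow along equalities of its arity and coarity. -/
def cast {n n' m m' : ℕ} (hn : n = n') (hm : m = m') (f : FreeProp S n m) : FreeProp S n' m' :=
  hm ▸ hn ▸ f

/-- The morphism of free props induced by a map of signatures. -/
def map (φ : ∀ {n m : ℕ}, S n m → T n m) {n m : ℕ} (f : FreeProp S n m) : FreeProp T n m :=
  Quotient.map (PTerm.map φ) (fun _ _ h => PTerm.SSM.map φ h) f

end FreeProp

notation:70 f:70 " ⨾ " g:71 => FreeProp.comp f g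
notation:75 f:75 " ⊗ₚ " g:76 => FreeProp.tensor f g

/-! ## The prop of relations -/

/-- Relations between `k^n` and `k^m`. -/
abbrev VRel (k : Type u) (n m : ℕ) : Type u := Set ((Fin n → k) × (Fin m → k))

namespace VRel

variable {k : Type u}

def id (n : ℕ) : VRel k n n := {p | p.2 = p.1}

def swap (n m : ℕ) : VRel k (n + m) (m + n) :=
  {p | ∃ (x : Fin n → k) (y : Fin m → k), p = (Fin.append x y, Fin.append y x)}

def comp {n m o : ℕ} (R : VRel k n m) (R' : VRel k m o) : VRel k n o :=
  {p | ∃ w : Fin m → k, (p.1, w) ∈ R ∧ (w, p.2) ∈ R'}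

def tensor {n m n' m' : ℕ} (R : VRel k n m) (R' : VRel k n' m') : VRel k (n + n') (m + m') :=
  {p | ∃ (x : Fin n → k) (x' : Fin n' → k) (y : Fin m → k) (y' : Fin m' → k),
    p = (Fin.append x x', Fin.append y y') ∧ (x, y) ∈ R ∧ (x', y') ∈ R'}

end VRel

/-- The relation denoted by a term, given the relations denoted by the generators. -/
def PTerm.sem {S : ℕ → ℕ → Type u} {k : Type u} (I : ∀ {n m : ℕ}, S n m → VRel k n m) :
    ∀ {n m : ℕ}, PTerm S n m → VRel k n m
  | _, _, gen g => I g
  | _, _, id n => VRel.id n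
  | _, _, swap n m => VRel.swap n m
  | _, _, comp f g => VRel.comp (sem I f) (sem I g)
  | _, _, tensor f g => VRel.tensor (sem I f) (sem I g)

namespace VRel

variable {k : Type u}

/-- Transport of a relation along equalities of its arity and coarity. -/
def cast {n n' m m' : ℕ} (hn : n = n') (hm : m = m') (R : VRel k n m) : VRel k n' m' :=
  {p | (fun i => p.1 (Fin.cast hn i), fun i => p.2 (Fin.cast hm i)) ∈ R}

theorem mem_tensor {n m n' m' : ℕ} (R : VRel k n m) (R' : VRel k n' m')
    (p : (Fin (n + n') → k) × (Fin (m + m') → k)) :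
    p ∈ tensor R R' ↔
      (fun i => p.1 (Fin.castAdd n' i), fun i => p.2 (Fin.castAdd m' i)) ∈ R ∧
      (fun i => p.1 (Fin.natAdd n i), fun i => p.2 (Fin.natAdd m i)) ∈ R' := by
  obtain ⟨x, y⟩ := p
  constructor
  · rintro ⟨x₁, x₂, y₁, y₂, h, h₁, h₂⟩
    obtain ⟨rfl, rfl⟩ := Prod.mk.inj h
    simpa using ⟨h₁, h₂⟩
  · rintro ⟨h₁, h₂⟩
    exact ⟨_, _, _, _, Prod.ext (Fin.append_castAdd_natAdd).symm (Fin.append_castAdd_natAdd).symm,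
      h₁, h₂⟩

theorem mem_swap {n m : ℕ} (p : (Fin (n + m) → k) × (Fin (m + n) → k)) :
    p ∈ swap (k := k) n m ↔
      (∀ i, p.1 (Fin.castAdd m i) = p.2 (Fin.natAdd m i)) ∧
      (∀ i, p.1 (Fin.natAdd n i) = p.2 (Fin.castAdd n i)) := by
  obtain ⟨x, y⟩ := p
  constructor
  · rintro ⟨x₁, x₂, h⟩
    obtain ⟨rfl, rfl⟩ := Prod.mk.inj h
    simp
  · rintro ⟨h₁, h₂⟩
    refine ⟨fun i => x (Fin.castAdd m i), fun i => x (Fin.natAdd n i), Prod.ext ?_ ?_⟩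
    · exact (Fin.append_castAdd_natAdd).symm
    · simp only at h₁ h₂
      simp only [h₁, h₂]
      exact (Fin.append_castAdd_natAdd).symm

end VRel

theorem PTerm.sem_cast {S : ℕ → ℕ → Type u} {k : Type u} (I : ∀ {n m : ℕ}, S n m → VRel k n m)
    {n n' m m' : ℕ} (hn : n = n') (hm : m = m') (t : PTerm S n m) :
    sem I (cast hn hm t) = VRel.cast hn hm (sem I t) := by
  subst hn hm; rfl

theorem PTerm.SSM.sem {S : ℕ → ℕ → Type u} {k : Type u} (I : ∀ {n m : ℕ}, S n m → VRel k n m)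
    {n m : ℕ} {f g : PTerm S n m} (h : SSM f g) : PTerm.sem I f = PTerm.sem I g := by
  induction h with
  | refl f => rfl
  | symm _ ih => exact ih.symm
  | trans _ _ ih₁ ih₂ => exact ih₁.trans ih₂
  | comp_congr _ _ ih₁ ih₂ => simp only [PTerm.sem, ih₁, ih₂]
  | tensor_congr _ _ ih₁ ih₂ => simp only [PTerm.sem, ih₁, ih₂]
  | id_comp f => ext p; simp [PTerm.sem, VRel.comp, VRel.id]
  | comp_id f => ext p; simp [PTerm.sem, VRel.comp, VRel.id]
  | comp_assoc f g h =>
    ext p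
    simp only [PTerm.sem, VRel.comp, Set.mem_ofPred_eq]
    constructor
    · rintro ⟨w, ⟨v, h₁, h₂⟩, h₃⟩
      exact ⟨v, h₁, w, h₂, h₃⟩
    · rintro ⟨v, h₁, w, h₂, h₃⟩
      exact ⟨w, ⟨v, h₁, h₂⟩, h₃⟩
  | id_tensor_id n m =>
    ext p
    simp only [PTerm.sem, VRel.mem_tensor, VRel.id, Set.mem_ofPred_eq]
    constructor
    · rintro ⟨h₁, h₂⟩
      funext i
      induction i using Fin.addCases with
      | left i => exact congrFun h₁ i
      | right i => exact congrFun h₂ i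
    · intro h; simp [h]
  | interchange f g f' g' =>
    ext p
    simp only [PTerm.sem, VRel.comp, VRel.mem_tensor, Set.mem_ofPred_eq]
    constructor
    · rintro ⟨⟨w, h₁, h₂⟩, ⟨w', h₃, h₄⟩⟩
      exact ⟨Fin.append w w', by simpa using ⟨h₁, h₃⟩, by simpa using ⟨h₂, h₄⟩⟩
    · rintro ⟨w, ⟨h₁, h₃⟩, h₂, h₄⟩
      exact ⟨⟨_, h₁, h₂⟩, ⟨_, h₃, h₄⟩⟩
  | id_zero_tensor f =>
    ext p
    rw [sem_cast]
    simp only [PTerm.sem, VRel.cast, VRel.mem_tensor, VRel.id, Set.mem_ofPred_eq]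
    refine (and_iff_right (funext fun i => i.elim0)).trans ?_
    have e : ∀ {a : ℕ} (i : Fin a), Fin.cast (Nat.zero_add a) (Fin.natAdd 0 i) = i :=
      fun i => by ext; simp
    simp only [e]
  | tensor_id_zero f =>
    ext p
    rw [sem_cast]
    simp only [PTerm.sem, VRel.cast, VRel.mem_tensor, VRel.id, Set.mem_ofPred_eq]
    exact and_iff_left (funext fun i => i.elim0)
  | tensor_assoc f g h =>
    ext p
    rw [sem_cast]
    simp only [PTerm.sem, VRel.cast, VRel.mem_tensor, Set.mem_ofPred_eq, and_assoc]
    have e₁ : ∀ {a b c : ℕ} (i : Fin a),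
        Fin.cast (Nat.add_assoc a b c) (Fin.castAdd c (Fin.castAdd b i)) =
          Fin.castAdd (b + c) i := fun i => by ext; simp
    have e₂ : ∀ {a b c : ℕ} (i : Fin b),
        Fin.cast (Nat.add_assoc a b c) (Fin.castAdd c (Fin.natAdd a i)) =
          Fin.natAdd a (Fin.castAdd c i) := fun i => by ext; simp
    have e₃ : ∀ {a b c : ℕ} (i : Fin c),
        Fin.cast (Nat.add_assoc a b c) (Fin.natAdd (a + b) i) =
          Fin.natAdd a (Fin.natAdd b i) := fun i => by ext; simp [Nat.add_assoc]
    simp only [e₁, e₂, e₃]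
  | swap_natural f g =>
    ext p
    simp only [PTerm.sem, VRel.comp, Set.mem_ofPred_eq]
    constructor
    · rintro ⟨w, h, h'⟩
      rw [VRel.mem_tensor] at h
      rw [VRel.mem_swap] at h'
      refine ⟨Fin.append (fun i => p.1 (Fin.natAdd _ i)) (fun i => p.1 (Fin.castAdd _ i)), ?_, ?_⟩
      · rw [VRel.mem_swap]; simp
      · rw [VRel.mem_tensor]
        rw [funext h'.1, funext h'.2] at h
        simpa using h.symm
    · rintro ⟨w, h', h⟩
      rw [VRel.mem_tensor] at h
      rw [VRel.mem_swap] at h'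
      refine ⟨Fin.append (fun i => p.2 (Fin.natAdd _ i)) (fun i => p.2 (Fin.castAdd _ i)), ?_, ?_⟩
      · rw [VRel.mem_tensor]
        rw [← funext h'.1, ← funext h'.2] at h
        simpa using h.symm
      · rw [VRel.mem_swap]; simp
  | swap_swap n m =>
    ext p
    simp only [PTerm.sem, VRel.comp, VRel.id, Set.mem_ofPred_eq]
    constructor
    · rintro ⟨w, h, h'⟩
      rw [VRel.mem_swap] at h h'
      funext i
      induction i using Fin.addCases with
      | left i => exact (h'.2 i).symm.trans (h.1 i).symm
      | right i => exact (h'.1 i).symm.trans (h.2 i).symm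
    · intro h
      refine ⟨Fin.append (fun i => p.1 (Fin.natAdd _ i)) (fun i => p.1 (Fin.castAdd _ i)), ?_, ?_⟩
      · rw [VRel.mem_swap]; simp
      · rw [VRel.mem_swap]; simp [h]
  | swap_zero n =>
    ext p
    rw [sem_cast]
    simp only [PTerm.sem, VRel.cast, VRel.mem_swap, VRel.id, Set.mem_ofPred_eq]
    refine (and_iff_left (fun i => i.elim0)).trans ?_
    have e : ∀ (i : Fin n), Fin.cast (Nat.zero_add n) (Fin.natAdd 0 i) = i :=
      fun i => by ext; simp
    simp only [e]
    exact ⟨fun h => (funext h).symm, fun h i => (congrFun h i).symm⟩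
  | hexagon n m o =>
    ext p
    rw [sem_cast]
    simp only [PTerm.sem, sem_cast, VRel.comp, VRel.cast, VRel.mem_tensor, VRel.mem_swap, VRel.id,
      Set.mem_ofPred_eq]
    have a₁ : ∀ i : Fin n, Fin.cast (Nat.add_assoc n m o).symm (Fin.castAdd (m + o) i) =
        Fin.castAdd o (Fin.castAdd m i) := fun i => by ext; simp
    have a₂ : ∀ i : Fin m,
        Fin.cast (Nat.add_assoc n m o).symm (Fin.natAdd n (Fin.castAdd o i)) =
        Fin.castAdd o (Fin.natAdd n i) := fun i => by ext; simp
    have a₃ : ∀ i : Fin o,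
        Fin.cast (Nat.add_assoc n m o).symm (Fin.natAdd n (Fin.natAdd m i)) =
        Fin.natAdd (n + m) i := fun i => by ext; simp [Nat.add_assoc]
    have b₁ : ∀ i : Fin m, Fin.cast (Nat.add_assoc m o n) (Fin.castAdd n (Fin.castAdd o i)) =
        Fin.castAdd (o + n) i := fun i => by ext; simp
    have b₂ : ∀ i : Fin o, Fin.cast (Nat.add_assoc m o n) (Fin.castAdd n (Fin.natAdd m i)) =
        Fin.natAdd m (Fin.castAdd n i) := fun i => by ext; simp
    have b₃ : ∀ i : Fin n, Fin.cast (Nat.add_assoc m o n) (Fin.natAdd (m + o) i) =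
        Fin.natAdd m (Fin.natAdd o i) := fun i => by ext; simp [Nat.add_assoc]
    have c₁ : ∀ i : Fin m, Fin.cast (Nat.add_assoc m n o) (Fin.castAdd o (Fin.castAdd n i)) =
        Fin.castAdd (n + o) i := fun i => by ext; simp
    have c₂ : ∀ i : Fin n, Fin.cast (Nat.add_assoc m n o) (Fin.castAdd o (Fin.natAdd m i)) =
        Fin.natAdd m (Fin.castAdd o i) := fun i => by ext; simp
    have c₃ : ∀ i : Fin o, Fin.cast (Nat.add_assoc m n o) (Fin.natAdd (m + n) i) =
        Fin.natAdd m (Fin.natAdd n i) := fun i => by ext; simp [Nat.add_assoc]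
    simp only [a₁, b₃, c₁, c₂, c₃, Fin.cast_refl, id_eq]
    constructor
    · rintro ⟨h₁, h₂⟩
      have h₃ := fun i : Fin m => h₂ (Fin.castAdd o i)
      have h₄ := fun i : Fin o => h₂ (Fin.natAdd m i)
      simp only [a₂, b₁] at h₃
      simp only [a₃, b₂] at h₄
      refine ⟨Fin.append (fun i => p.2 (Fin.castAdd _ i))
        (Fin.append (fun i => p.1 (Fin.castAdd _ (Fin.castAdd _ i)))
          (fun i => p.1 (Fin.natAdd _ i))), ⟨⟨?_, ?_⟩, ?_⟩, ?_, ?_, ?_⟩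
      · simp
      · simpa using h₃
      · simp
      · simp
      · simpa using h₁
      · simpa using h₄
    · rintro ⟨w, ⟨⟨g₁, g₂⟩, g₃⟩, g₄, g₅, g₆⟩
      refine ⟨fun i => (g₁ i).trans (g₅ i), fun i => ?_⟩
      induction i using Fin.addCases with
      | left i =>
        simp only [a₂, b₁]
        exact (g₂ i).trans (congrFun g₄ i).symm
      | right i =>
        simp only [a₃, b₂]
        exact (congrFun g₃ i).symm.trans (g₆ i)

namespace FreeProp

variable {S : ℕ → ℕ → Type u} {k : Type u}

/-- The relation denoted by an arrow, given the relations denoted by the generators. -/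
def sem (I : ∀ {n m : ℕ}, S n m → VRel k n m) {n m : ℕ} (f : FreeProp S n m) : VRel k n m :=
  Quotient.lift (PTerm.sem I) (fun _ _ h => PTerm.SSM.sem I h) f

end FreeProp

/-! ## Circuits -/

/-- The generators copy, delete, scalar, add, zero. -/
inductive FwdGen (k : Type u) : ℕ → ℕ → Type u
  | copy : FwdGen k 1 2
  | delete : FwdGen k 1 0
  | scalar (r : k) : FwdGen k 1 1
  | add : FwdGen k 2 1
  | zero : FwdGen k 0 1

/-- The generators of polyhedral circuits: the generators in `FwdGen`, their mirror images, and
the order generator. -/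
inductive PolyGen (k : Type u) : ℕ → ℕ → Type u
  | fwd {n m : ℕ} (g : FwdGen k n m) : PolyGen k n m
  | bwd {n m : ℕ} (g : FwdGen k n m) : PolyGen k m n
  | geq : PolyGen k 1 1

/-- Matrix circuits: the free prop on copy, delete, scalar, add, zero only. -/
abbrev FwdCirc (k : Type u) (n m : ℕ) : Type u := FreeProp (FwdGen k) n m

/-- The free prop on all generators. -/
abbrev PolyCirc (k : Type u) (n m : ℕ) : Type u := FreeProp (PolyGen k) n m

/-- The inclusion of matrix circuits into all circuits. -/
def FwdCirc.incl {k : Type u} {n m : ℕ} (A : FwdCirc k n m) : PolyCirc k n m :=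
  FreeProp.map PolyGen.fwd A

/-- The relation denoted by a generator in `FwdGen`. -/
def FwdGen.sem {k : Type u} [Field k] : ∀ {n m : ℕ}, FwdGen k n m → VRel k n m
  | _, _, copy => {p | ∃ x : k, p = (![x], ![x, x])}
  | _, _, delete => {p | ∃ x : k, p = (![x], ![])}
  | _, _, scalar r => {p | ∃ x : k, p = (![x], ![r * x])}
  | _, _, add => {p | ∃ x y : k, p = (![x, y], ![x + y])}
  | _, _, zero => {(![], ![0])}

/-- The relation denoted by a generator of polyhedral circuits. -/
def PolyGen.sem {k : Type u} [Field k] [LinearOrder k] :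
    ∀ {n m : ℕ}, PolyGen k n m → VRel k n m
  | _, _, fwd g => g.sem
  | _, _, bwd g => {p | (p.2, p.1) ∈ g.sem}
  | _, _, geq => {p | ∃ x y : k, x ≥ y ∧ p = (![x], ![y])}

/-- The relation denoted by a matrix circuit. -/
def FwdCirc.sem {k : Type u} [Field k] {n m : ℕ} (A : FwdCirc k n m) : VRel k n m :=
  FreeProp.sem FwdGen.sem A

/-- The relation denoted by a circuit. -/
def PolyCirc.sem {k : Type u} [Field k] [LinearOrder k] {n m : ℕ} (c : PolyCirc k n m) :
    VRel k n m :=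
  FreeProp.sem PolyGen.sem c

namespace PolyCirc

section Gens

variable {k : Type u}

def copy : PolyCirc k 1 2 := FreeProp.gen (.fwd .copy)
def delete : PolyCirc k 1 0 := FreeProp.gen (.fwd .delete)
def scalar (r : k) : PolyCirc k 1 1 := FreeProp.gen (.fwd (.scalar r))
def add : PolyCirc k 2 1 := FreeProp.gen (.fwd .add)
def zero : PolyCirc k 0 1 := FreeProp.gen (.fwd .zero)
def cocopy : PolyCirc k 2 1 := FreeProp.gen (.bwd .copy)
def codelete : PolyCirc k 0 1 := FreeProp.gen (.bwd .delete)
def coscalar (r : k) : PolyCirc k 1 1 := FreeProp.gen (.bwd (.scalar r))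
def coadd : PolyCirc k 1 2 := FreeProp.gen (.bwd .add)
def cozero : PolyCirc k 1 0 := FreeProp.gen (.bwd .zero)
def geq : PolyCirc k 1 1 := FreeProp.gen .geq

/-- One wire. -/
def wire : PolyCirc k 1 1 := FreeProp.id 1

/-- Crossing of two wires. -/
def cross : PolyCirc k 2 2 := FreeProp.swap 1 1

def cup : PolyCirc k 0 2 := codelete ⨾ copy
def cap : PolyCirc k 2 0 := cocopy ⨾ delete

/-- The opposite of `geq`, obtained by bending its wires. -/
def leq : PolyCirc k 1 1 := (cup ⊗ₚ wire) ⨾ (wire ⊗ₚ geq ⊗ₚ wire) ⨾ (wire ⊗ₚ cap)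

/-- Exchange of the two middle wires out of four. -/
def middle : PolyCirc k 4 4 := wire ⊗ₚ cross ⊗ₚ wire

/-! The `n`-wire versions of some generators. -/

def geqN : ∀ n : ℕ, PolyCirc k n n
  | 0 => FreeProp.id 0
  | n + 1 => geqN n ⊗ₚ geq

def cozeroN : ∀ n : ℕ, PolyCirc k n 0
  | 0 => FreeProp.id 0
  | n + 1 => cozeroN n ⊗ₚ cozero

def codeleteN : ∀ n : ℕ, PolyCirc k 0 n
  | 0 => FreeProp.id 0
  | n + 1 => codeleteN n ⊗ₚ codelete

def copyN : ∀ n : ℕ, PolyCirc k n (n + n)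
  | 0 => FreeProp.id 0
  | n + 1 =>
    (copyN n ⊗ₚ copy) ⨾
      FreeProp.cast (by omega) (by omega) (FreeProp.id n ⊗ₚ FreeProp.swap n 1 ⊗ₚ wire)

/-- The circuit `n → m` in which the `n` input wires and one copy of the `m` output wires are fed
into the matrix circuit `A`, each of whose `p` outputs is passed through `geq` into `cozero`. -/
def polyhedral {n m p : ℕ} (A : FwdCirc k (n + m) p) : PolyCirc k n m :=
  FreeProp.cast (Nat.add_zero n) (Nat.zero_add m)
    ((FreeProp.id n ⊗ₚ (codeleteN m ⨾ copyN m)) ⨾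
      FreeProp.cast (Nat.add_assoc n m m) rfl
        ((A.incl ⨾ geqN p ⨾ cozeroN p) ⊗ₚ FreeProp.id m))

/-- Polyhedral normal form. -/
def IsPolyhedralNF {n m : ℕ} (c : PolyCirc k n m) : Prop :=
  ∃ (p : ℕ) (A : FwdCirc k (n + m) p), c = polyhedral A

end Gens

/-! ## The theory of interacting Hopf algebras

Every axiom is listed together with its mirror image, unless the latter is again in the list. -/

/-- Equational axioms of interacting Hopf algebras. -/
inductive IHEqAx {k : Type u} [Field k] : ∀ {n m : ℕ}, PolyCirc k n m → PolyCirc k n m → Prop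
  -- the commutative monoid of `add` and `zero`
  | add_assoc : IHEqAx ((add ⊗ₚ wire :) ⨾ add) ((wire ⊗ₚ add :) ⨾ add)
  | add_comm : IHEqAx (cross ⨾ add) add
  | add_unit : IHEqAx ((zero ⊗ₚ wire :) ⨾ add) wire
  | coadd_coassoc : IHEqAx (coadd ⨾ (coadd ⊗ₚ wire :)) (coadd ⨾ (wire ⊗ₚ coadd :))
  | coadd_cocomm : IHEqAx (coadd ⨾ cross) coadd
  | coadd_counit : IHEqAx (coadd ⨾ (cozero ⊗ₚ wire :)) wire
  -- the cocommutative comonoid of `copy` and `delete`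
  | copy_coassoc : IHEqAx (copy ⨾ (copy ⊗ₚ wire :)) (copy ⨾ (wire ⊗ₚ copy :))
  | copy_cocomm : IHEqAx (copy ⨾ cross) copy
  | copy_counit : IHEqAx (copy ⨾ (delete ⊗ₚ wire :)) wire
  | cocopy_assoc : IHEqAx ((cocopy ⊗ₚ wire :) ⨾ cocopy) ((wire ⊗ₚ cocopy :) ⨾ cocopy)
  | cocopy_comm : IHEqAx (cross ⨾ cocopy) cocopy
  | cocopy_unit : IHEqAx ((codelete ⊗ₚ wire :) ⨾ cocopy) wire
  -- the bimonoid laws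
  | add_copy : IHEqAx (add ⨾ copy) ((copy ⊗ₚ copy :) ⨾ middle ⨾ (add ⊗ₚ add :))
  | zero_copy : IHEqAx (zero ⨾ copy) (zero ⊗ₚ zero)
  | add_delete : IHEqAx (add ⨾ delete) (delete ⊗ₚ delete)
  | zero_delete : IHEqAx (zero ⨾ delete) (FreeProp.id 0)
  | cocopy_coadd : IHEqAx (cocopy ⨾ coadd) ((coadd ⊗ₚ coadd :) ⨾ middle ⨾ (cocopy ⊗ₚ cocopy :))
  | cocopy_cozero : IHEqAx (cocopy ⨾ cozero) (cozero ⊗ₚ cozero)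
  | codelete_coadd : IHEqAx (codelete ⨾ coadd) (codelete ⊗ₚ codelete)
  | codelete_cozero : IHEqAx (codelete ⨾ cozero) (FreeProp.id 0)
  -- scalars
  | add_scalar (r : k) : IHEqAx (add ⨾ scalar r) ((scalar r ⊗ₚ scalar r :) ⨾ add)
  | zero_scalar (r : k) : IHEqAx (zero ⨾ scalar r) zero
  | scalar_copy (r : k) : IHEqAx (scalar r ⨾ copy) (copy ⨾ (scalar r ⊗ₚ scalar r :))
  | scalar_delete (r : k) : IHEqAx (scalar r ⨾ delete) delete
  | scalar_mul (r s : k) : IHEqAx (scalar r ⨾ scalar s) (scalar (r * s))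
  | scalar_add (r s : k) : IHEqAx (copy ⨾ (scalar r ⊗ₚ scalar s :) ⨾ add) (scalar (r + s))
  | scalar_zero : IHEqAx (scalar 0) (delete ⨾ zero)
  | coscalar_coadd (r : k) : IHEqAx (coscalar r ⨾ coadd) (coadd ⨾ (coscalar r ⊗ₚ coscalar r :))
  | coscalar_cozero (r : k) : IHEqAx (coscalar r ⨾ cozero) cozero
  | cocopy_coscalar (r : k) :
      IHEqAx (cocopy ⨾ coscalar r) ((coscalar r ⊗ₚ coscalar r :) ⨾ cocopy)
  | codelete_coscalar (r : k) : IHEqAx (codelete ⨾ coscalar r) codelete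
  | coscalar_mul (r s : k) : IHEqAx (coscalar s ⨾ coscalar r) (coscalar (r * s))
  | coscalar_add (r s : k) :
      IHEqAx (coadd ⨾ (coscalar r ⊗ₚ coscalar s :) ⨾ cocopy) (coscalar (r + s))
  | coscalar_zero : IHEqAx (coscalar 0) (cozero ⨾ codelete)
  | scalar_inv (r : k) (hr : r ≠ 0) : IHEqAx (scalar r ⨾ coscalar r) wire
  | scalar_coinv (r : k) (hr : r ≠ 0) : IHEqAx wire (coscalar r ⨾ scalar r)
  -- the special Frobenius algebra of `copy` and `cocopy`
  | copy_frob_left : IHEqAx ((copy ⊗ₚ wire :) ⨾ (wire ⊗ₚ cocopy :)) (cocopy ⨾ copy)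
  | copy_frob_right : IHEqAx (cocopy ⨾ copy) ((wire ⊗ₚ copy :) ⨾ (cocopy ⊗ₚ wire :))
  | copy_special : IHEqAx (copy ⨾ cocopy) wire
  | codelete_delete : IHEqAx (codelete ⨾ delete) (FreeProp.id 0)
  -- the special Frobenius algebra of `coadd` and `add`
  | add_frob_left : IHEqAx ((coadd ⊗ₚ wire :) ⨾ (wire ⊗ₚ add :)) (add ⨾ coadd)
  | add_frob_right : IHEqAx (add ⨾ coadd) ((wire ⊗ₚ coadd :) ⨾ (add ⊗ₚ wire :))
  | add_special : IHEqAx (coadd ⨾ add) wire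
  | zero_cozero : IHEqAx (zero ⨾ cozero) (FreeProp.id 0)
  -- the two compact structures agree up to a sign
  | cap_white : IHEqAx (add ⨾ cozero) ((scalar (-1 : k) ⊗ₚ wire :) ⨾ cap)
  | cup_white : IHEqAx (zero ⨾ coadd) (cup ⨾ (scalar (-1 : k) ⊗ₚ wire :))

/-- Inequational axioms of interacting Hopf algebras. -/
inductive IHLeAx {k : Type u} : ∀ {n m : ℕ}, PolyCirc k n m → PolyCirc k n m → Prop
  | cozero_le_delete : IHLeAx cozero delete
  | zero_le_codelete : IHLeAx zero codelete

/-! ## The theory of polyhedral cones -/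

/-- Equational axioms for `geq`. -/
inductive GeqEqAx {k : Type u} [Field k] [LinearOrder k] :
    ∀ {n m : ℕ}, PolyCirc k n m → PolyCirc k n m → Prop
  | add_geq : GeqEqAx (add ⨾ geq) ((geq ⊗ₚ geq) ⨾ add)
  | geq_delete : GeqEqAx (geq ⨾ delete) delete
  | scalar_pos (r : k) (hr : 0 < r) : GeqEqAx (scalar r ⨾ geq) (geq ⨾ scalar r)
  | scalar_neg (r : k) (hr : r < 0) : GeqEqAx (scalar r ⨾ geq) (leq ⨾ scalar r)
  | spider :
      GeqEqAx ((geq ⊗ₚ geq) ⨾ cocopy ⨾ copy ⨾ (geq ⊗ₚ geq))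
        ((copy ⊗ₚ copy) ⨾ (geq ⊗ₚ geq ⊗ₚ geq ⊗ₚ geq :) ⨾ middle ⨾ (cocopy ⊗ₚ cocopy))
  | direction : GeqEqAx (leq ⨾ geq) (delete ⨾ codelete)

/-- Inequational axioms for `geq`. -/
inductive GeqLeAx {k : Type u} : ∀ {n m : ℕ}, PolyCirc k n m → PolyCirc k n m → Prop
  | geq_copy : GeqLeAx (geq ⨾ copy) (copy ⨾ (geq ⊗ₚ geq))
  | cozero_le : GeqLeAx cozero (geq ⨾ cozero)
  | antisymm : GeqLeAx (copy ⨾ (geq ⊗ₚ leq) ⨾ cocopy) wire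

/-- The smallest precongruence containing the axioms of interacting Hopf algebras and the axioms
for `geq`. -/
inductive IHPLe {k : Type u} [Field k] [LinearOrder k] :
    ∀ {n m : ℕ}, PolyCirc k n m → PolyCirc k n m → Prop
  | refl {n m} (f : PolyCirc k n m) : IHPLe f f
  | trans {n m} {f g h : PolyCirc k n m} : IHPLe f g → IHPLe g h → IHPLe f h
  | comp {n m o} {f f' : PolyCirc k n m} {g g' : PolyCirc k m o} :
      IHPLe f f' → IHPLe g g' → IHPLe (f ⨾ g) (f' ⨾ g')
  | tensor {n m n' m'} {f f' : PolyCirc k n m} {g g' : PolyCirc k n' m'} :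
      IHPLe f f' → IHPLe g g' → IHPLe (f ⊗ₚ g) (f' ⊗ₚ g')
  | ih_eq {n m} {f g : PolyCirc k n m} : IHEqAx f g → IHPLe f g
  | ih_eq_symm {n m} {f g : PolyCirc k n m} : IHEqAx f g → IHPLe g f
  | ih_le {n m} {f g : PolyCirc k n m} : IHLeAx f g → IHPLe f g
  | geq_eq {n m} {f g : PolyCirc k n m} : GeqEqAx f g → IHPLe f g
  | geq_eq_symm {n m} {f g : PolyCirc k n m} : GeqEqAx f g → IHPLe g f
  | geq_le {n m} {f g : PolyCirc k n m} : GeqLeAx f g → IHPLe f g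

/-- Equality of circuits in the theory of polyhedral cones. -/
def IHPEq {k : Type u} [Field k] [LinearOrder k] {n m : ℕ} (c d : PolyCirc k n m) : Prop :=
  IHPLe c d ∧ IHPLe d c

end PolyCirc

/-! ## Circuits modulo the theory of polyhedral cones -/

namespace IHP

open CategoryTheory MonoidalCategory

variable {k : Type u} [Field k] [LinearOrder k]

/-! Modulo provable equality, an effect `e : n → 0` behaves like a formula in `n` variables. Copying
the inputs and running two effects side by side is conjunction (`guard`, `*`); precomposing with the
circuit of a linear map is substitution (`sub`); feeding `codelete` into the last wire is
existential quantification (`ex`). Quantification commutes with substitution (`sub_ex`, a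
Beck–Chevalley law) and with conjunction by a formula not containing the bound variable (`ex_guard`,
a Frobenius law). Let `Cone` be the submonoid generated by the homogeneous inequalities `nonneg u`.

The heart of the argument is that precomposition with any circuit, with arbitrary parameter wires
running alongside, maps `Cone` into `Cone` (`Preserves`). This property is stable under composition
and tensor, so only generators matter. Matrix generators act by substitution. The reversed
generators and the order generator are expressible by equations, inequalities and `ex`. Everything
thus reduces to closure of `Cone` under `ex`, which is Fourier–Motzkin elimination carried out
inside the theory (`ex_mem_cone`): scaling sorts inequalities into upper bounds, lower bounds and
conditions free of the bound variable, and the interpolation law `gm_spider` eliminates the variable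
in favour of the pairwise comparisons.

Two results make this calculus available. First, matrix circuits denoting the same linear map are
provably equal (`inc_eq_of_fn_eq`): they are homomorphisms for addition, hence determined by their
columns, and the columns are computed from the axioms (`col_inc`). This yields the functor `F` from
linear maps to circuits. Second, the one-point rule `ex_guard_eqv` eliminates a variable constrained
by an equation; it is obtained from the case `y = 0` by translating the bound variable.

Finally, output wires are bent into inputs. The identity on `m` wires is `relN` of the effect "the
two blocks agree", and `comp_relN` moves a circuit `c` inside, so `c = relN ((c ⊕ id) ; equality)`.
That effect lies in `Cone`, every element of `Cone` has the form matrix, then `≥`, then `cozero`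
(`exists_matrix`), and `relN` of such an effect is a polyhedral normal form (`cls_polyhedral`). The
semantic statement is independent of the theory: terms denote graphs of linear maps (`sem_eq_fn`),
and the relation of the normal form is computed directly (`sem_polyhedral`). -/

/-- The setoid of provable equality. -/
def setoid (k : Type u) [Field k] [LinearOrder k] (n m : ℕ) : Setoid (PolyCirc k n m) :=
  ⟨PolyCirc.IHPEq, fun f => ⟨.refl f, .refl f⟩, fun h => ⟨h.2, h.1⟩,
    fun h h' => ⟨h.1.trans h'.1, h'.2.trans h.2⟩⟩

/-- Circuits up to provable equality. -/
def Q (k : Type u) [Field k] [LinearOrder k] (n m : ℕ) : Type u := Quotient (setoid k n m)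

/-- The class of a circuit. -/
def cls {n m : ℕ} (c : PolyCirc k n m) : Q k n m := Quotient.mk _ c

theorem cls_eq_iff {n m : ℕ} {c d : PolyCirc k n m} : cls c = cls d ↔ PolyCirc.IHPEq c d :=
  ⟨fun h => Quotient.exact h, fun h => Quotient.sound h⟩

theorem cls_surj {n m : ℕ} (f : Q k n m) : ∃ c, cls c = f := Quotient.exists_rep f

def idq (n : ℕ) : Q k n n := cls (FreeProp.id n)

def swapq (n m : ℕ) : Q k (n + m) (m + n) := cls (FreeProp.swap n m)

def compq {n m o : ℕ} (f : Q k n m) (g : Q k m o) : Q k n o :=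
  Quotient.map₂ FreeProp.comp (fun _ _ (h₁ : PolyCirc.IHPEq _ _) _ _ (h₂ : PolyCirc.IHPEq _ _) =>
    ⟨h₁.1.comp h₂.1, h₁.2.comp h₂.2⟩) f g

def tensorq {n m n' m' : ℕ} (f : Q k n m) (g : Q k n' m') : Q k (n + n') (m + m') :=
  Quotient.map₂ FreeProp.tensor (fun _ _ (h₁ : PolyCirc.IHPEq _ _) _ _
    (h₂ : PolyCirc.IHPEq _ _) => ⟨h₁.1.tensor h₂.1, h₁.2.tensor h₂.2⟩) f g

infixl:70 " ⨟ " => compq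
infixl:75 " ⊠ " => tensorq

/-- The identity wires along an equality of objects. -/
def cst {n m : ℕ} (h : n = m) : Q k n m := h ▸ idq n

theorem cls_comp {n m o : ℕ} (f : PolyCirc k n m) (g : PolyCirc k m o) :
    cls (f ⨾ g) = cls f ⨟ cls g := rfl

theorem cls_tensor {n m n' m' : ℕ} (f : PolyCirc k n m) (g : PolyCirc k n' m') :
    cls (f ⊗ₚ g) = cls f ⊠ cls g := rfl

/-- Replaces dependent transport by composition with identity wires, so that strictness laws can be
used as ordinary rewriting rules. -/
theorem cls_cast {n n' m m' : ℕ} (hn : n = n') (hm : m = m') (f : PolyCirc k n m) :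
    cls (FreeProp.cast hn hm f) = cst hn.symm ⨟ cls f ⨟ cst hm := by
  subst hn hm
  refine (Quotient.inductionOn f fun t => ?_)
  refine congrArg cls (Quotient.sound (.symm (.trans (.comp_id _) (.id_comp _))))

/-- The class of a term. -/
def tcls {n m : ℕ} (t : PTerm (PolyGen k) n m) : Q k n m :=
  cls (Quotient.mk (PTerm.setoid _ n m) t : PolyCirc k n m)

theorem tcls_surj {n m : ℕ} (f : Q k n m) : ∃ t, tcls t = f := by
  obtain ⟨c, rfl⟩ := cls_surj f
  obtain ⟨t, rfl⟩ := Quotient.exists_rep c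
  exact ⟨t, rfl⟩

theorem tcls_eq {n m : ℕ} {t t' : PTerm (PolyGen k) n m} (h : PTerm.SSM t t') :
    tcls t = tcls t' := congrArg cls (Quotient.sound h)

theorem tcls_cast {n n' m m' : ℕ} (hn : n = n') (hm : m = m') (t : PTerm (PolyGen k) n m) :
    tcls (PTerm.cast hn hm t) = cst hn.symm ⨟ tcls t ⨟ cst hm := by
  subst hn hm
  exact tcls_eq (.symm (.trans (.comp_id _) (.id_comp _)))

@[simp] theorem idq_comp {n m : ℕ} (f : Q k n m) : idq n ⨟ f = f := by
  obtain ⟨t, rfl⟩ := tcls_surj f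
  exact tcls_eq (.id_comp _)

@[simp] theorem comp_idq {n m : ℕ} (f : Q k n m) : f ⨟ idq m = f := by
  obtain ⟨t, rfl⟩ := tcls_surj f
  exact tcls_eq (.comp_id _)

theorem compq_assoc {n m o p : ℕ} (f : Q k n m) (g : Q k m o) (h : Q k o p) :
    f ⨟ g ⨟ h = f ⨟ (g ⨟ h) := by
  obtain ⟨f, rfl⟩ := tcls_surj f
  obtain ⟨g, rfl⟩ := tcls_surj g
  obtain ⟨h, rfl⟩ := tcls_surj h
  exact tcls_eq (.comp_assoc _ _ _)

@[simp] theorem idq_tensor_idq (n m : ℕ) : (idq n ⊠ idq m : Q k _ _) = idq (n + m) :=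
  tcls_eq (.id_tensor_id _ _)

theorem interchange {n m o n' m' o' : ℕ} (f : Q k n m) (g : Q k m o)
    (f' : Q k n' m') (g' : Q k m' o') :
    (f ⨟ g) ⊠ (f' ⨟ g') = (f ⊠ f') ⨟ (g ⊠ g') := by
  obtain ⟨f, rfl⟩ := tcls_surj f
  obtain ⟨g, rfl⟩ := tcls_surj g
  obtain ⟨f', rfl⟩ := tcls_surj f'
  obtain ⟨g', rfl⟩ := tcls_surj g'
  exact tcls_eq (.interchange _ _ _ _)

@[simp] theorem cst_rfl {n : ℕ} (h : n = n) : (cst h : Q k n n) = idq n := rfl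

@[simp] theorem cst_cst {n m o : ℕ} (h : n = m) (h' : m = o) :
    (cst h ⨟ cst h' : Q k n o) = cst (h.trans h') := by
  subst h h'; simp

theorem cst_tensor_cst {n m n' m' : ℕ} (h : n = m) (h' : n' = m') :
    (cst h ⊠ cst h' : Q k _ _) = cst (by rw [h, h']) := by
  subst h h'; simp

/-- No transport is needed here because `n + 0` reduces to `n`; `0 + n` does not, whence the `cst`
in the left-handed version. -/
theorem tensor_id_zero {n m : ℕ} (f : Q k n m) : (f ⊠ idq 0 : Q k n m) = f := by
  obtain ⟨t, rfl⟩ := tcls_surj f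
  exact tcls_eq (.tensor_id_zero _)

theorem id_zero_tensor {n m : ℕ} (f : Q k n m) :
    idq 0 ⊠ f = cst (Nat.zero_add n) ⨟ f ⨟ cst (Nat.zero_add m).symm := by
  obtain ⟨t, rfl⟩ := tcls_surj f
  have h := tcls_eq (PTerm.SSM.id_zero_tensor t)
  rw [tcls_cast] at h
  change cst _ ⨟ (idq 0 ⊠ tcls t) ⨟ cst _ = _ at h
  conv_rhs => rw [← h]
  simp only [compq_assoc, cst_cst, cst_rfl, comp_idq]
  rw [← compq_assoc, cst_cst, cst_rfl, idq_comp]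

theorem tensor_assoc {n m n' m' n'' m'' : ℕ} (f : Q k n m) (g : Q k n' m') (h : Q k n'' m'') :
    (f ⊠ g) ⊠ h = cst (Nat.add_assoc _ _ _) ⨟ (f ⊠ (g ⊠ h)) ⨟ cst (Nat.add_assoc _ _ _).symm := by
  obtain ⟨f, rfl⟩ := tcls_surj f
  obtain ⟨g, rfl⟩ := tcls_surj g
  obtain ⟨h, rfl⟩ := tcls_surj h
  have e := tcls_eq (PTerm.SSM.tensor_assoc f g h)
  rw [tcls_cast] at e
  change cst _ ⨟ (tcls f ⊠ tcls g ⊠ tcls h) ⨟ cst _ = (tcls f ⊠ (tcls g ⊠ tcls h)) at e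
  rw [← e]
  simp only [compq_assoc, cst_cst, cst_rfl, comp_idq]
  rw [← compq_assoc, cst_cst, cst_rfl, idq_comp]

theorem swap_natural {n m n' m' : ℕ} (f : Q k n m) (g : Q k n' m') :
    (f ⊠ g) ⨟ swapq m m' = swapq n n' ⨟ (g ⊠ f) := by
  obtain ⟨f, rfl⟩ := tcls_surj f
  obtain ⟨g, rfl⟩ := tcls_surj g
  exact tcls_eq (.swap_natural _ _)

@[simp] theorem swap_swap (n m : ℕ) : (swapq n m ⨟ swapq m n : Q k _ _) = idq (n + m) :=
  tcls_eq (.swap_swap _ _)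

theorem swap_zero (n : ℕ) : (swapq n 0 : Q k _ _) = cst (Nat.zero_add n).symm := by
  have h := tcls_eq (PTerm.SSM.swap_zero (S := PolyGen k) n)
  rw [tcls_cast] at h
  change _ ⨟ swapq n 0 ⨟ _ = idq n at h
  have h' := congrArg (fun x => x ⨟ cst (Nat.zero_add n).symm) h
  simpa [compq_assoc] using h'

theorem hexagon (n m o : ℕ) :
    (swapq n (m + o) : Q k _ _) = cst (Nat.add_assoc n m o).symm ⨟ (swapq n m ⊠ idq o) ⨟
      cst (Nat.add_assoc m n o) ⨟ (idq m ⊠ swapq n o) ⨟ cst (Nat.add_assoc m o n).symm := by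
  have h := tcls_eq (PTerm.SSM.hexagon (S := PolyGen k) n m o)
  rw [tcls_cast] at h
  change _ ⨟ swapq n (m + o) ⨟ _ =
    tcls (PTerm.cast rfl _ (PTerm.tensor (PTerm.swap n m) (PTerm.id o))) ⨟ (idq m ⊠ swapq n o) at h
  rw [tcls_cast] at h
  change _ = _ ⨟ (swapq n m ⊠ idq o) ⨟ _ ⨟ _ at h
  have h' := congrArg (fun x => cst (Nat.add_assoc n m o).symm ⨟ x ⨟ cst (Nat.add_assoc m o n).symm) h
  simp only [compq_assoc, cst_cst, cst_rfl, comp_idq, idq_comp] at h'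
  rw [← compq_assoc, cst_cst, cst_rfl, idq_comp] at h'
  simpa only [compq_assoc] using h'

/-! ### The order on circuits -/

instance (n m : ℕ) : PartialOrder (Q k n m) where
  le := Quotient.lift₂ PolyCirc.IHPLe fun _ _ _ _ h h' =>
    propext ⟨fun e => (h.2.trans e).trans h'.1, fun e => (h.1.trans e).trans h'.2⟩
  le_refl f := Quotient.inductionOn f fun c => PolyCirc.IHPLe.refl c
  le_trans f g h := Quotient.inductionOn₃ f g h fun _ _ _ => PolyCirc.IHPLe.trans
  le_antisymm f g := Quotient.inductionOn₂ f g fun _ _ h h' => Quotient.sound ⟨h, h'⟩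

theorem comp_mono {n m o : ℕ} {f f' : Q k n m} {g g' : Q k m o} :
    f ≤ f' → g ≤ g' → f ⨟ g ≤ f' ⨟ g' := by
  obtain ⟨f, rfl⟩ := cls_surj f
  obtain ⟨g, rfl⟩ := cls_surj g
  obtain ⟨f', rfl⟩ := cls_surj f'
  obtain ⟨g', rfl⟩ := cls_surj g'
  exact PolyCirc.IHPLe.comp

theorem tensor_mono {n m n' m' : ℕ} {f f' : Q k n m} {g g' : Q k n' m'} :
    f ≤ f' → g ≤ g' → f ⊠ g ≤ f' ⊠ g' := by
  obtain ⟨f, rfl⟩ := cls_surj f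
  obtain ⟨g, rfl⟩ := cls_surj g
  obtain ⟨f', rfl⟩ := cls_surj f'
  obtain ⟨g', rfl⟩ := cls_surj g'
  exact PolyCirc.IHPLe.tensor

/-! ### The symmetric monoidal category -/

theorem associator_natural {n m n' m' n'' m'' : ℕ} (f : Q k n m) (g : Q k n' m')
    (h : Q k n'' m'') :
    (f ⊠ g ⊠ h) ⨟ cst (Nat.add_assoc _ _ _) = cst (Nat.add_assoc _ _ _) ⨟ (f ⊠ (g ⊠ h)) := by
  rw [tensor_assoc, compq_assoc, cst_cst, cst_rfl, comp_idq]

theorem leftUnitor_natural {n m : ℕ} (f : Q k n m) :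
    (idq 0 ⊠ f) ⨟ cst (Nat.zero_add _) = cst (Nat.zero_add _) ⨟ f := by
  rw [id_zero_tensor, compq_assoc, cst_cst, cst_rfl, comp_idq]

theorem rightUnitor_natural {n m : ℕ} (f : Q k n m) :
    (f ⊠ idq 0 : Q k n m) ⨟ cst (Nat.add_zero _) = cst (Nat.add_zero _) ⨟ f := by
  rw [tensor_id_zero]; exact (comp_idq f).trans (idq_comp f).symm

theorem cst_pentagon (a b c d : ℕ) :
    (cst (Nat.add_assoc a b c) ⊠ idq d : Q k _ _) ⨟
        (cst (Nat.add_assoc a (b + c) d) ⨟ (idq a ⊠ cst (Nat.add_assoc b c d))) =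
      cst (Nat.add_assoc (a + b) c d) ⨟ cst (Nat.add_assoc a b (c + d)) := by
  rw [← cst_rfl rfl, ← cst_rfl rfl]
  simp only [cst_tensor_cst, cst_cst]

theorem cst_triangle (a b : ℕ) :
    (cst (Nat.add_assoc a 0 b) : Q k _ _) ⨟ (idq a ⊠ cst (Nat.zero_add b)) =
      cst (Nat.add_zero a) ⊠ idq b := by
  rw [← cst_rfl rfl, ← cst_rfl rfl]
  simp only [cst_tensor_cst, cst_cst]

theorem hexagon_forward (n m o : ℕ) :
    (cst (Nat.add_assoc n m o) : Q k _ _) ⨟ (swapq n (m + o) ⨟ cst (Nat.add_assoc m o n)) =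
      (swapq n m ⊠ idq o) ⨟ (cst (Nat.add_assoc m n o) ⨟ (idq m ⊠ swapq n o)) := by
  rw [hexagon]
  simp only [compq_assoc, cst_cst, cst_rfl, comp_idq]
  rw [← compq_assoc, cst_cst, cst_rfl, idq_comp]

/-- The objects of the prop `Q k`: numbers of wires. -/
def Wires (_ : Type u) : Type := ℕ

/-- The point of this packaging is to inherit tensor products of monoid objects and the closure
properties of their homomorphisms. -/
instance : Category.{u} (Wires k) where
  Hom n m := Q k n m
  id n := idq n
  comp f g := f ⨟ g
  id_comp f := idq_comp f
  comp_id f := comp_idq f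
  assoc f g h := compq_assoc f g h

/-- `cst` as an isomorphism. -/
def cstIso {n m : Wires k} (h : n = m) : n ≅ m where
  hom := (cst h : Q k n m)
  inv := (cst h.symm : Q k m n)
  hom_inv_id := cst_cst h h.symm
  inv_hom_id := cst_cst h.symm h

instance : MonoidalCategoryStruct (Wires k) where
  tensorObj n m := Nat.add n m
  tensorUnit := (0 : ℕ)
  tensorHom f g := tensorq f g
  whiskerLeft n _ _ f := tensorq (idq n) f
  whiskerRight f m := tensorq f (idq m)
  associator n m o := cstIso (Nat.add_assoc n m o)
  leftUnitor n := cstIso (Nat.zero_add n)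
  rightUnitor n := cstIso (Nat.add_zero n)

instance : MonoidalCategory (Wires k) :=
  MonoidalCategory.ofTensorHom
    (id_tensorHom_id := fun n m => idq_tensor_idq n m)
    (id_tensorHom := fun _ _ _ _ => rfl)
    (tensorHom_id := fun _ _ => rfl)
    (tensorHom_comp_tensorHom := fun f₁ f₂ g₁ g₂ => (interchange f₁ g₁ f₂ g₂).symm)
    (associator_naturality := fun f g h => associator_natural f g h)
    (leftUnitor_naturality := fun f => leftUnitor_natural f)
    (rightUnitor_naturality := fun f => rightUnitor_natural f)
    (pentagon := cst_pentagon)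
    (triangle := cst_triangle)

/-- The symmetry as an isomorphism. -/
def swapIso (n m : Wires k) : n ⊗ m ≅ m ⊗ n where
  hom := (swapq n m : Q k _ _)
  inv := (swapq m n : Q k _ _)
  hom_inv_id := swap_swap n m
  inv_hom_id := swap_swap m n

theorem swapIso_hexagon (X Y Z : Wires k) :
    (α_ X Y Z).hom ≫ (swapIso X (Y ⊗ Z)).hom ≫ (α_ Y Z X).hom =
      (swapIso X Y).hom ▷ Z ≫ (α_ Y X Z).hom ≫ Y ◁ (swapIso X Z).hom :=
  hexagon_forward X Y Z

instance : SymmetricCategory (Wires k) where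
  braiding n m := swapIso n m
  braiding_naturality_right n _ _ f := swap_natural (idq n) f
  braiding_naturality_left f n := swap_natural f (idq n)
  hexagon_forward := swapIso_hexagon
  hexagon_reverse X Y Z := by
    -- The symmetry is its own inverse, so the second hexagon is the inverse of the first one for
    -- `Z, X, Y`.
    have h : (α_ Z X Y ≪≫ swapIso Z (X ⊗ Y) ≪≫ α_ X Y Z) =
        whiskerRightIso (swapIso Z X) Y ≪≫ α_ X Z Y ≪≫ whiskerLeftIso X (swapIso Z Y) :=
      Iso.ext (swapIso_hexagon Z X Y)
    have h' := congrArg Iso.inv h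
    simp only [Iso.trans_inv, whiskerRightIso_inv, whiskerLeftIso_inv, Category.assoc] at h'
    exact h'
  symmetry n m := swap_swap n m

end IHP

namespace IHP

open CategoryTheory MonoidalCategory

variable {k : Type u} [Field k] [LinearOrder k]

/-! ### Generators and axioms -/

def copy : Q k 1 2 := cls PolyCirc.copy
def del : Q k 1 0 := cls PolyCirc.delete
def sc (r : k) : Q k 1 1 := cls (PolyCirc.scalar r)
def add : Q k 2 1 := cls PolyCirc.add
def zero : Q k 0 1 := cls PolyCirc.zero
def cocopy : Q k 2 1 := cls PolyCirc.cocopy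
def codel : Q k 0 1 := cls PolyCirc.codelete
def cosc (r : k) : Q k 1 1 := cls (PolyCirc.coscalar r)
def coadd : Q k 1 2 := cls PolyCirc.coadd
def cozero : Q k 1 0 := cls PolyCirc.cozero
def geq : Q k 1 1 := cls PolyCirc.geq
def leq : Q k 1 1 := cls PolyCirc.leq
def cap : Q k 2 0 := cls PolyCirc.cap
def cup : Q k 0 2 := cls PolyCirc.cup

theorem cls_eq_of_ax {n m : ℕ} {c d : PolyCirc k n m} (h : PolyCirc.IHEqAx c d) :
    cls c = cls d := cls_eq_iff.2 ⟨.ih_eq h, .ih_eq_symm h⟩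

theorem cls_eq_of_geq {n m : ℕ} {c d : PolyCirc k n m} (h : PolyCirc.GeqEqAx c d) :
    cls c = cls d := cls_eq_iff.2 ⟨.geq_eq h, .geq_eq_symm h⟩

theorem ax_add_assoc : (add ⊠ idq 1) ⨟ add = (idq 1 ⊠ add) ⨟ (add : Q k 2 1) :=
  cls_eq_of_ax .add_assoc

theorem ax_add_comm : swapq 1 1 ⨟ add = (add : Q k 2 1) := cls_eq_of_ax .add_comm

theorem ax_add_unit : (zero ⊠ idq 1) ⨟ add = (idq 1 : Q k 1 1) := cls_eq_of_ax .add_unit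

theorem ax_coadd_counit : coadd ⨟ (cozero ⊠ idq 1) = (idq 1 : Q k 1 1) :=
  cls_eq_of_ax .coadd_counit

theorem ax_coadd_cocomm : coadd ⨟ swapq 1 1 = (coadd : Q k 1 2) := cls_eq_of_ax .coadd_cocomm

theorem ax_copy_coassoc : copy ⨟ (copy ⊠ idq 1) = (copy : Q k 1 2) ⨟ (idq 1 ⊠ copy) :=
  cls_eq_of_ax .copy_coassoc

theorem ax_copy_cocomm : copy ⨟ swapq 1 1 = (copy : Q k 1 2) := cls_eq_of_ax .copy_cocomm

theorem ax_copy_counit : copy ⨟ (del ⊠ idq 1) = (idq 1 : Q k 1 1) := cls_eq_of_ax .copy_counit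

theorem ax_cocopy_comm : swapq 1 1 ⨟ cocopy = (cocopy : Q k 2 1) := cls_eq_of_ax .cocopy_comm

theorem ax_cocopy_unit : (codel ⊠ idq 1) ⨟ cocopy = (idq 1 : Q k 1 1) :=
  cls_eq_of_ax .cocopy_unit

theorem ax_add_copy : (add : Q k 2 1) ⨟ copy =
    (copy ⊠ copy : Q k (1 + 1) (2 + 2)) ⨟ (idq 1 ⊠ swapq 1 1 ⊠ idq 1 : Q k (1 + 2 + 1) (1 + 2 + 1)) ⨟ (add ⊠ add : Q k (2 + 2) (1 + 1)) :=
  cls_eq_of_ax .add_copy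

theorem ax_zero_copy : zero ⨟ copy = (zero ⊠ zero : Q k 0 2) := cls_eq_of_ax .zero_copy

theorem ax_add_delete : add ⨟ del = (del ⊠ del : Q k 2 0) := cls_eq_of_ax .add_delete

theorem ax_zero_delete : zero ⨟ del = (idq 0 : Q k 0 0) := cls_eq_of_ax .zero_delete

theorem ax_cocopy_cozero : cocopy ⨟ cozero = (cozero ⊠ cozero : Q k 2 0) :=
  cls_eq_of_ax .cocopy_cozero

theorem ax_codelete_coadd : codel ⨟ coadd = (codel ⊠ codel : Q k 0 2) :=
  cls_eq_of_ax .codelete_coadd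

theorem ax_codelete_cozero : codel ⨟ cozero = (idq 0 : Q k 0 0) :=
  cls_eq_of_ax .codelete_cozero

theorem ax_add_scalar (r : k) : add ⨟ sc r = (sc r ⊠ sc r) ⨟ add := cls_eq_of_ax (.add_scalar r)

theorem ax_zero_scalar (r : k) : zero ⨟ sc r = zero := cls_eq_of_ax (.zero_scalar r)

theorem ax_scalar_copy (r : k) : sc r ⨟ copy = copy ⨟ (sc r ⊠ sc r) :=
  cls_eq_of_ax (.scalar_copy r)

theorem ax_scalar_delete (r : k) : sc r ⨟ del = del := cls_eq_of_ax (.scalar_delete r)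

theorem ax_scalar_mul (r s : k) : sc r ⨟ sc s = sc (r * s) := cls_eq_of_ax (.scalar_mul r s)

theorem ax_scalar_add (r s : k) : copy ⨟ (sc r ⊠ sc s) ⨟ add = sc (r + s) :=
  cls_eq_of_ax (.scalar_add r s)

theorem ax_scalar_zero : sc (0 : k) = del ⨟ zero := cls_eq_of_ax .scalar_zero

theorem ax_coscalar_zero : cosc (0 : k) = cozero ⨟ codel := cls_eq_of_ax .coscalar_zero

theorem ax_coscalar_cozero (r : k) : cosc r ⨟ cozero = cozero := cls_eq_of_ax (.coscalar_cozero r)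

theorem ax_codelete_coscalar (r : k) : codel ⨟ cosc r = codel :=
  cls_eq_of_ax (.codelete_coscalar r)

theorem ax_scalar_inv (r : k) (hr : r ≠ 0) : sc r ⨟ cosc r = idq 1 :=
  cls_eq_of_ax (.scalar_inv r hr)

theorem ax_copy_frob_left : (copy ⊠ idq 1 : Q k (1 + 1) (2 + 1)) ⨟ (idq 1 ⊠ cocopy : Q k (1 + 2) (1 + 1)) = (cocopy : Q k 2 1) ⨟ copy :=
  cls_eq_of_ax .copy_frob_left

theorem ax_codelete_delete : codel ⨟ del = (idq 0 : Q k 0 0) := cls_eq_of_ax .codelete_delete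

theorem ax_add_frob_right : (add : Q k 2 1) ⨟ coadd = (idq 1 ⊠ coadd : Q k (1 + 1) (1 + 2)) ⨟ (add ⊠ idq 1 : Q k (2 + 1) (1 + 1)) :=
  cls_eq_of_ax .add_frob_right

theorem ax_cap_white : add ⨟ cozero = (sc (-1 : k) ⊠ idq 1) ⨟ cap := cls_eq_of_ax .cap_white

theorem ax_cup_white : zero ⨟ coadd = cup ⨟ (sc (-1 : k) ⊠ idq 1) := cls_eq_of_ax .cup_white

/-! ### The monoids of wires -/

theorem zero_swap (n : ℕ) : (swapq 0 n : Q k _ _) = cst (Nat.zero_add n) := by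
  have h := swap_swap (k := k) 0 n
  rw [swap_zero] at h
  have h' := congrArg (fun x => x ⨟ cst (Nat.zero_add n)) h
  simp only [compq_assoc, cst_cst, cst_rfl, idq_comp] at h'
  exact (comp_idq _).symm.trans h'

theorem add_unit_right : (idq 1 ⊠ zero) ⨟ add = (idq 1 : Q k 1 1) := by
  rw [← ax_add_comm, ← compq_assoc, swap_natural, swap_zero, cst_rfl, compq_assoc]
  exact (idq_comp _).trans ax_add_unit

theorem copy_counit_right : copy ⨟ (idq 1 ⊠ del) = (idq 1 : Q k 1 1) := by
  rw [← ax_copy_cocomm, compq_assoc, ← swap_natural, zero_swap, ← compq_assoc, ax_copy_counit]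
  exact idq_comp _

/-- The object of `n` wires. -/
abbrev ob (k : Type u) (n : ℕ) : Wires k := n

/-- The monoid on one wire. -/
abbrev monOne : MonObj (ob k 1) where
  one := (zero : Q k 0 1)
  mul := (add : Q k 2 1)
  one_mul := ax_add_unit
  mul_one := add_unit_right
  mul_assoc := ax_add_assoc.trans (idq_comp _).symm

/-- The monoid on `n` wires. -/
abbrev mon : ∀ n : ℕ, MonObj (ob k n)
  | 0 => MonObj.instTensorUnit
  | n + 1 =>
    @MonObj.tensorObj.instTensorObj (Wires k) _ _ _ (ob k n) (ob k 1) (mon n) monOne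

/-! ### Homomorphisms of monoid objects in a symmetric monoidal category -/

section MonHom

variable {C : Type*} [Category* C] [MonoidalCategory C] {X Y Z W : C} (A : MonObj X) (B : MonObj Y)
  (D : MonObj Z) (E : MonObj W)

/-- Used with coherence isomorphisms that are definitionally identities in the prop: that they are
homomorphisms then identifies two monoid structures. -/
theorem mon_eq_of_isMonHom_id (A B : MonObj X) (h : @IsMonHom C _ _ X X A B (𝟙 X)) : A = B := by
  refine MonObj.ext _ _ ?_
  have := h.mul_hom
  rwa [Category.comp_id, id_tensorHom_id, Category.id_comp] at this

theorem isMonHom_id : IsMonHom (𝟙 X) := inferInstance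

theorem isMonHom_comp {f : X ⟶ Y} {g : Y ⟶ Z} (hf : IsMonHom f) (hg : IsMonHom g) :
    IsMonHom (f ≫ g) := inferInstance

variable [SymmetricCategory C]

theorem isMonHom_leftUnitor : IsMonHom (λ_ X).hom := inferInstance

theorem isMonHom_rightUnitor : IsMonHom (ρ_ X).hom := inferInstance

theorem isMonHom_associator : IsMonHom (α_ X Y Z).hom := inferInstance

theorem isMonHom_braiding : IsMonHom (β_ X Y).hom := inferInstance

theorem isMonHom_tensor {f : X ⟶ Y} {g : Z ⟶ W} (hf : IsMonHom f) (hg : IsMonHom g) :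
    IsMonHom (f ⊗ₘ g) := inferInstance

/-- The easy half of Eckmann–Hilton: commutativity makes multiplication a homomorphism. -/
theorem isMonHom_mul (h : (β_ X X).hom ≫ A.mul = A.mul) :
    @IsMonHom C _ _ (X ⊗ X) X MonObj.tensorObj.instTensorObj A A.mul := by
  let _ : IsCommMonObj X := ⟨h⟩
  refine ⟨?_, ?_⟩
  · change ((λ_ (𝟙_ C)).inv ≫ (A.one ⊗ₘ A.one)) ≫ A.mul = A.one
    rw [MonoidalCategory.tensorHom_def, Category.assoc, Category.assoc, A.mul_one, rightUnitor_naturality]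
    rw [← unitors_equal, Iso.inv_hom_id_assoc]
  · exact (Category.assoc _ _ _).trans (MonObj.mul_mul_mul_comm X)

/-- The decomposition `(x, y) = (x, 0) + (0, y)` in a product monoid. -/
theorem unit_unit_mul : ((𝟙 X ⊗ₘ B.one) ⊗ₘ (A.one ⊗ₘ 𝟙 Y)) ≫
    (@MonObj.tensorObj.instTensorObj C _ _ _ X Y A B).mul = (ρ_ X).hom ⊗ₘ (λ_ Y).hom := by
  change _ ≫ tensorμ X Y X Y ≫ (A.mul ⊗ₘ B.mul) = _
  rw [tensorμ_natural_assoc, tensorHom_comp_tensorHom, id_tensorHom, tensorHom_id, A.mul_one,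
    B.one_mul]
  dsimp only [tensorμ]
  rw [braiding_tensorUnit_right]
  monoidal

end MonHom

theorem mon_one : mon (k := k) 1 = monOne :=
  mon_eq_of_isMonHom_id (X := ob k 1) _ _ (isMonHom_leftUnitor (X := ob k 1) monOne)

/-- The structure is built one wire at a time; independence of the bracketing is what allows
additivity to be proved for arbitrary tensor products. -/
theorem mon_add (n m : ℕ) : mon (k := k) (n + m) =
    @MonObj.tensorObj.instTensorObj (Wires k) _ _ _ (ob k n) (ob k m) (mon n) (mon m) := by
  induction m with
  | zero =>
    exact (mon_eq_of_isMonHom_id (X := ob k n) _ _ (isMonHom_rightUnitor (X := ob k n) (mon n))).symm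
  | succ m ih =>
    refine Eq.trans ?_ (mon_eq_of_isMonHom_id (X := ob k (n + m + 1)) _ _
      (isMonHom_associator (X := ob k n) (Y := ob k m) (Z := ob k 1) (mon n) (mon m) monOne))
    exact congrArg
      (fun A => @MonObj.tensorObj.instTensorObj (Wires k) _ _ _ (ob k (n + m)) (ob k 1) A monOne) ih

/-- Homomorphisms of the monoids of wires. -/
def Additive {n m : ℕ} (f : Q k n m) : Prop :=
  @IsMonHom (Wires k) _ _ (ob k n) (ob k m) (mon n) (mon m) f

theorem additive_idq (n : ℕ) : Additive (idq n : Q k n n) := isMonHom_id (X := ob k n) (mon n)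

theorem Additive.comp {n m o : ℕ} {f : Q k n m} {g : Q k m o} (hf : Additive f)
    (hg : Additive g) : Additive (f ⨟ g) :=
  isMonHom_comp (X := ob k n) (Y := ob k m) (Z := ob k o) (mon n) (mon m) (mon o) hf hg

theorem Additive.tensor {n m n' m' : ℕ} {f : Q k n m} {g : Q k n' m'} (hf : Additive f)
    (hg : Additive g) : Additive (f ⊠ g) := by
  unfold Additive
  rw [mon_add, mon_add]
  exact isMonHom_tensor (X := ob k n) (Y := ob k m) (Z := ob k n') (W := ob k m')
    (mon n) (mon m) (mon n') (mon m') hf hg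

theorem additive_swapq (n m : ℕ) : Additive (swapq n m : Q k _ _) := by
  unfold Additive
  rw [mon_add, mon_add]
  exact isMonHom_braiding (X := ob k n) (Y := ob k m) (mon n) (mon m)

theorem zero_tensor_zero : (zero ⊠ zero : Q k 0 2) = zero ⨟ (zero ⊠ idq 1) := by
  have h := interchange (k := k) (idq 0) zero zero (idq 1)
  rw [idq_comp, comp_idq, id_zero_tensor] at h
  refine h.trans ?_
  exact congrArg (fun x => x ⨟ (zero ⊠ idq 1)) ((comp_idq _).trans (idq_comp _))

/-- For this and the following generators, the bialgebra and scalar axioms are precisely the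
homomorphism conditions. -/
theorem additive_zero : Additive (zero : Q k 0 1) := by
  unfold Additive
  rw [mon_one]
  refine @IsMonHom.mk _ _ _ (ob k 0) (ob k 1) (mon 0) monOne _ (Category.id_comp _) ?_
  change (idq 0 : Q k 0 0) ⨟ zero = (zero ⊠ zero) ⨟ add
  rw [zero_tensor_zero, compq_assoc, ax_add_unit, comp_idq]
  exact idq_comp _

theorem additive_del : Additive (del : Q k 1 0) := by
  unfold Additive
  rw [mon_one]
  exact @IsMonHom.mk _ _ _ (ob k 1) (ob k 0) monOne (mon 0) _ ax_zero_delete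
    (ax_add_delete.trans (comp_idq _).symm)

theorem additive_sc (r : k) : Additive (sc r) := by
  unfold Additive
  rw [mon_one]
  exact @IsMonHom.mk _ _ _ (ob k 1) (ob k 1) monOne monOne _ (ax_zero_scalar r) (ax_add_scalar r)

/-- Brings the tensor product multiplication to the shape occurring in `ax_add_copy`. -/
theorem mul_two : (mon (k := k) 2).mul =
    ((idq 1 ⊠ swapq 1 1 ⊠ idq 1 : Q k (1 + 2 + 1) (1 + 2 + 1)) ⨟ (add ⊠ add : Q k (2 + 2) (1 + 1)) :
      Q k (2 + 2) 2) := by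
  have h := mon_add (k := k) 1 1
  rw [mon_one] at h
  rw [h]
  change (idq 4 ⨟ ((idq 1 ⊠ idq 3 : Q k (1 + 3) (1 + 3)) ⨟
    ((idq 1 ⊠ (swapq 1 1 ⊠ idq 1 : Q k (2 + 1) (2 + 1)) : Q k (1 + 3) (1 + 3)) ⨟
    ((idq 1 ⊠ idq 3 : Q k (1 + 3) (1 + 3)) ⨟ idq 4)))) ⨟ (add ⊠ add : Q k (2 + 2) (1 + 1)) = _
  rw [tensor_assoc]
  simp

theorem additive_copy : Additive (copy : Q k 1 2) := by
  unfold Additive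
  rw [mon_one]
  refine @IsMonHom.mk _ _ _ (ob k 1) (ob k 2) monOne (mon 2) _ ?_ ?_
  · refine ax_zero_copy.trans ?_
    change _ = (mon (1 + 1)).one
    rw [mon_add, mon_one]
    exact (idq_comp _).symm
  · rw [mul_two]
    exact ax_add_copy.trans (compq_assoc _ _ _)

theorem additive_add : Additive (add : Q k 2 1) := by
  unfold Additive
  have h := mon_add (k := k) 1 1
  rw [mon_one] at h
  rw [h, mon_one]
  exact isMonHom_mul (X := ob k 1) monOne ax_add_comm

end IHP

namespace IHP

variable {k : Type u} [Field k]

/-! ### Linear maps and terms -/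

/-- Linear maps between spaces of tuples. -/
abbrev Lin (k : Type u) [Field k] (n m : ℕ) := (Fin n → k) →ₗ[k] (Fin m → k)

/-- Block diagonal sum of linear maps. -/
def blk {n m n' m' : ℕ} (A : Lin k n m) (B : Lin k n' m') : Lin k (n + n') (m + m') where
  toFun v := Fin.append (A fun i => v (Fin.castAdd n' i)) (B fun i => v (Fin.natAdd n i))
  map_add' v w := by
    have h₁ : (fun i => (v + w) (Fin.castAdd n' i)) =
      (fun i => v (Fin.castAdd n' i)) + fun i => w (Fin.castAdd n' i) := rfl
    have h₂ : (fun i => (v + w) (Fin.natAdd n i)) =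
      (fun i => v (Fin.natAdd n i)) + fun i => w (Fin.natAdd n i) := rfl
    rw [h₁, h₂, map_add, map_add]
    funext i
    induction i using Fin.addCases <;> simp
  map_smul' r v := by
    have h₁ : (fun i => (r • v) (Fin.castAdd n' i)) = r • (fun i => v (Fin.castAdd n' i)) := rfl
    have h₂ : (fun i => (r • v) (Fin.natAdd n i)) = r • (fun i => v (Fin.natAdd n i)) := rfl
    rw [h₁, h₂, map_smul, map_smul]
    funext i
    induction i using Fin.addCases <;> simp

@[simp] theorem blk_append {n m n' m' : ℕ} (A : Lin k n m) (B : Lin k n' m') (v : Fin n → k)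
    (w : Fin n' → k) : blk A B (Fin.append v w) = Fin.append (A v) (B w) := by
  simp [blk]

/-- The linear map exchanging two blocks. -/
def swapL (n m : ℕ) : Lin k (n + m) (m + n) where
  toFun v := Fin.append (fun i => v (Fin.natAdd n i)) (fun i => v (Fin.castAdd m i))
  map_add' v w := by
    funext i
    induction i using Fin.addCases <;> simp
  map_smul' r v := by
    funext i
    induction i using Fin.addCases <;> simp

@[simp] theorem swapL_append {n m : ℕ} (v : Fin n → k) (w : Fin m → k) :
    swapL n m (Fin.append v w) = Fin.append w v := by
  simp [swapL]

/-- Terms over the generators of matrix circuits. -/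
abbrev FT (k : Type u) (n m : ℕ) := PTerm (FwdGen k) n m

/-- The linear map denoted by a generator. -/
def genFn : ∀ {n m : ℕ}, FwdGen k n m → Lin k n m
  | _, _, .copy => LinearMap.funLeft k k ![0, 0]
  | _, _, .delete => 0
  | _, _, .scalar r => r • LinearMap.id
  | _, _, .add => LinearMap.funLeft k k ![0] + LinearMap.funLeft k k ![1]
  | _, _, .zero => 0

/-- The linear map denoted by a term. -/
def fn : ∀ {n m : ℕ}, FT k n m → Lin k n m
  | _, _, .gen g => genFn g
  | _, _, .id _ => LinearMap.id
  | _, _, .swap n m => swapL n m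
  | _, _, .comp f g => fn g ∘ₗ fn f
  | _, _, .tensor f g => blk (fn f) (fn g)

theorem genFn_sem {n m : ℕ} (g : FwdGen k n m) : g.sem = {q | q.2 = genFn g q.1} := by
  ext ⟨x, y⟩
  cases g
  · simp only [FwdGen.sem, genFn, Set.mem_ofPred_eq, Prod.mk.injEq]
    constructor
    · rintro ⟨a, rfl, rfl⟩
      funext i; fin_cases i <;> rfl
    · rintro rfl
      exact ⟨x 0, by funext i; fin_cases i; rfl, by funext i; fin_cases i <;> rfl⟩
  · simp only [FwdGen.sem, genFn, Set.mem_ofPred_eq, Prod.mk.injEq]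
    exact ⟨fun _ => funext fun i => i.elim0, fun _ =>
      ⟨x 0, by funext i; fin_cases i; rfl, funext fun i => i.elim0⟩⟩
  · simp only [FwdGen.sem, genFn, Set.mem_ofPred_eq, Prod.mk.injEq]
    constructor
    · rintro ⟨a, rfl, rfl⟩
      funext i; fin_cases i; rfl
    · rintro rfl
      exact ⟨x 0, by funext i; fin_cases i; rfl, by funext i; fin_cases i; rfl⟩
  · simp only [FwdGen.sem, genFn, Set.mem_ofPred_eq, Prod.mk.injEq]
    constructor
    · rintro ⟨a, b, rfl, rfl⟩
      funext i; fin_cases i; rfl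
    · rintro rfl
      exact ⟨x 0, x 1, by funext i; fin_cases i <;> rfl, by funext i; fin_cases i; rfl⟩
  · simp only [FwdGen.sem, genFn, Set.mem_ofPred_eq, Set.mem_singleton_iff, Prod.mk.injEq]
    constructor
    · rintro ⟨rfl, rfl⟩
      funext i; fin_cases i; rfl
    · rintro rfl
      exact ⟨funext fun i => i.elim0, by funext i; fin_cases i; rfl⟩

theorem sem_eq_fn {n m : ℕ} (t : FT k n m) : PTerm.sem FwdGen.sem t = {q | q.2 = fn t q.1} := by
  induction t with
  | gen g => exact genFn_sem g
  | id n => rfl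
  | swap n m =>
    ext ⟨x, y⟩
    simp only [PTerm.sem, VRel.mem_swap, fn, Set.mem_ofPred_eq]
    constructor
    · rintro ⟨h₁, h₂⟩
      funext i
      induction i using Fin.addCases with
      | left i => simp [swapL, h₂]
      | right i => simp [swapL, h₁]
    · rintro rfl
      simp [swapL]
  | comp f g hf hg =>
    ext ⟨x, y⟩
    simp [PTerm.sem, hf, hg, VRel.comp, fn]
  | tensor f g hf hg =>
    ext ⟨x, y⟩
    simp only [PTerm.sem, VRel.mem_tensor, hf, hg, fn, Set.mem_ofPred_eq]
    constructor
    · rintro ⟨h₁, h₂⟩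
      funext i
      induction i using Fin.addCases with
      | left i => simpa [blk] using congrFun h₁ i
      | right i => simpa [blk] using congrFun h₂ i
    · rintro rfl
      simp [blk]

variable [LinearOrder k]

/-! ### Columns -/

/-- The circuit of a term. -/
def inc {n m : ℕ} (t : FT k n m) : Q k n m := tcls (t.map PolyGen.fwd)

theorem additive_inc {n m : ℕ} (t : FT k n m) : Additive (inc t) := by
  induction t with
  | gen g =>
    cases g
    · exact additive_copy
    · exact additive_del
    · exact additive_sc _
    · exact additive_add
    · exact additive_zero
  | id n => exact additive_idq n
  | swap n m => exact additive_swapq n m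
  | comp f g hf hg => exact hf.comp hg
  | tensor f g hf hg => exact hf.tensor hg

/-- The circuit scaling its input by the entries of a vector. -/
def col : ∀ {n : ℕ}, (Fin n → k) → Q k 1 n
  | 0, _ => del
  | _ + 1, v => copy ⨟ (col (fun i => v i.castSucc) ⊠ sc (v (Fin.last _)))

theorem tensor_comp_left {n m o n' m' : ℕ} (f : Q k n m) (g : Q k m o) (h : Q k n' m') :
    (f ⨟ g) ⊠ h = (f ⊠ idq n') ⨟ (g ⊠ h) := by
  rw [← interchange, idq_comp]

theorem tensor_comp_right {n m o n' m' : ℕ} (f : Q k n m) (g : Q k m o) (h : Q k n' m') :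
    h ⊠ (f ⨟ g) = (idq n' ⊠ f) ⨟ (h ⊠ g) := by
  rw [← interchange, idq_comp]

theorem tensor_right_effect {n m p : ℕ} (f : Q k n m) (e : Q k p 0) :
    (f ⊠ e : Q k (n + p) m) = (idq n ⊠ e) ⨟ f := by
  have h := interchange (idq n) f e (idq 0)
  rwa [idq_comp, comp_idq, tensor_id_zero] at h

theorem sc_one : sc (1 : k) = idq 1 := by
  have h := ax_scalar_inv (k := k) 1 one_ne_zero
  have h₂ := ax_scalar_mul (k := k) 1 1
  rw [one_mul] at h₂
  have h₃ := congrArg (fun x => x ⨟ cosc 1) h₂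
  simp only [compq_assoc, h, comp_idq] at h₃
  exact h₃

/-- Coassociativity and the counit law of copying: a column may be split at any point, not only
before its last entry. -/
theorem col_append {n m : ℕ} (v : Fin n → k) (w : Fin m → k) :
    col (Fin.append v w) = copy ⨟ (col v ⊠ col w) := by
  induction m with
  | zero =>
    have h : (Fin.append v w : Fin n → k) = v := by
      funext i
      exact Fin.append_left v w i
    change col (Fin.append v w : Fin n → k) = _
    rw [h]
    change _ = copy ⨟ (col v ⊠ del)
    refine .symm ((congrArg _ (tensor_right_effect (col v) del)).trans ?_)
    rw [← compq_assoc, copy_counit_right, idq_comp]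
  | succ m ih =>
    have h : (fun i => Fin.append v w (Fin.castSucc i) : Fin (n + m) → k) =
        Fin.append v fun i => w i.castSucc := by
      funext i
      induction i using Fin.addCases with
      | left i =>
        rw [Fin.append_left]
        exact Fin.append_left v w i
      | right i =>
        rw [Fin.append_right]
        exact Fin.append_right v w i.castSucc
    have h' : Fin.append v w (Fin.last (n + m)) = w (Fin.last m) :=
      Fin.append_right v w (Fin.last m)
    refine (congrArg₂ (fun a b => copy ⨟ (col a ⊠ sc b)) h h').trans ?_
    rw [ih, tensor_comp_left, ← compq_assoc, ax_copy_coassoc]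
    change _ = copy ⨟ (col v ⊠ (copy ⨟ (col (fun i => w i.castSucc) ⊠ sc (w (Fin.last m)))))
    rw [tensor_comp_right, compq_assoc, tensor_assoc]
    congr 2
    exact (comp_idq _).trans (idq_comp _)

theorem col_one (v : Fin 1 → k) : col v = sc (v 0) := by
  change copy ⨟ (del ⊠ sc (v 0)) = _
  have h : (del ⊠ sc (v 0) : Q k 2 1) = (del ⊠ idq 1) ⨟ sc (v 0) := by
    have h := interchange (k := k) del (idq 0) (idq 1) (sc (v 0))
    rw [comp_idq, idq_comp, id_zero_tensor] at h
    rw [h]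
    exact congrArg _ ((comp_idq _).trans (idq_comp _))
  rw [h, ← compq_assoc, ax_copy_counit, idq_comp]

/-- Matrix-vector multiplication performed by the axioms. In the case of `add` this is the axiom for
sums of scalars, in the case of `zero` the one for the scalar `0`. -/
theorem col_inc {n m : ℕ} (t : FT k n m) (v : Fin n → k) : col v ⨟ inc t = col (fn t v) := by
  induction t with
  | gen g =>
    cases g
    · change col v ⨟ copy = copy ⨟ (col _ ⊠ sc _)
      rw [col_one, col_one, ax_scalar_copy]; rfl
    · change col v ⨟ del = del
      rw [col_one, ax_scalar_delete]
    · rename_i r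
      change col v ⨟ sc r = _
      rw [col_one, col_one, ax_scalar_mul, mul_comm]; rfl
    · change (copy ⨟ (col _ ⊠ sc _)) ⨟ add = _
      rw [col_one, col_one, ax_scalar_add]; rfl
    · change del ⨟ zero = _
      rw [col_one, ← ax_scalar_zero]; rfl
  | id n => exact comp_idq _
  | swap n m =>
    obtain ⟨x, y, rfl⟩ : ∃ x y, v = Fin.append x y := ⟨_, _, Fin.append_castAdd_natAdd.symm⟩
    change _ ⨟ swapq n m = col (swapL n m _)
    rw [swapL_append, col_append, col_append, compq_assoc, swap_natural, ← compq_assoc,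
      ax_copy_cocomm]
  | comp f g hf hg =>
    change _ ⨟ (inc f ⨟ inc g) = _
    rw [← compq_assoc, hf, hg]; rfl
  | tensor f g hf hg =>
    obtain ⟨x, y, rfl⟩ : ∃ x y, v = Fin.append x y := ⟨_, _, Fin.append_castAdd_natAdd.symm⟩
    change _ ⨟ (inc f ⊠ inc g) = col (blk _ _ _)
    rw [blk_append, col_append, col_append, compq_assoc, ← interchange, hf, hg]

/-! ### Additive circuits are determined by their columns -/

/-- Addition of pairs of tuples. -/
def addN (n : ℕ) : Q k (n + n) n := (mon n).mul

/-- The zero tuple. -/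
def zeroN (n : ℕ) : Q k 0 n := (mon n).one

theorem Additive.add_comp {n m : ℕ} {f : Q k n m} (hf : Additive f) :
    addN n ⨟ f = (f ⊠ f) ⨟ addN m := hf.mul_hom

theorem Additive.zero_comp {n m : ℕ} {f : Q k n m} (hf : Additive f) :
    zeroN n ⨟ f = zeroN m := hf.one_hom

theorem addN_unit (n : ℕ) : ((idq n ⊠ zero : Q k (n + 0) (n + 1)) ⊠
    (zeroN n ⊠ idq 1 : Q k (0 + 1) (n + 1))) ⨟ addN (n + 1) = (idq (n + 1) : Q k (n + 1) (n + 1)) :=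
  (unit_unit_mul (X := ob k n) (Y := ob k 1) (mon n) monOne).trans (idq_tensor_idq n 1)

theorem Additive.eq_add {n m : ℕ} {f : Q k (n + 1) m} (hf : Additive f) :
    f = (((idq n ⊠ zero : Q k (n + 0) (n + 1)) ⨟ f) ⊠
      ((zeroN n ⊠ idq 1 : Q k (0 + 1) (n + 1)) ⨟ f)) ⨟ addN m := by
  rw [interchange, compq_assoc, ← hf.add_comp, ← compq_assoc, addN_unit, idq_comp]

theorem col_zero (n : ℕ) : col (0 : Fin n → k) = del ⨟ zeroN n := by
  induction n with
  | zero => exact (comp_idq _).symm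
  | succ n ih =>
    change copy ⨟ (col (0 : Fin n → k) ⊠ sc 0) = del ⨟ (idq 0 ⨟ (zeroN n ⊠ zero))
    rw [ih, ax_scalar_zero, interchange, ← compq_assoc, idq_comp]
    have h : (copy ⨟ (del ⊠ del) : Q k 1 0) = del := by
      refine (congrArg _ (tensor_right_effect del del)).trans ?_
      rw [← compq_assoc, copy_counit_right, idq_comp]
    rw [h]

/-- An additive circuit is the sum of its restrictions to the first `n` inputs and to the last one.
The former is settled by induction; the latter is itself precomposition with a column. With no
inputs, preservation of zero leaves only one circuit. -/
theorem additive_ext {n m : ℕ} {f g : Q k n m} (hf : Additive f) (hg : Additive g)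
    (h : ∀ v, col v ⨟ f = col v ⨟ g) : f = g := by
  induction n with
  | zero =>
    have hf' := hf.zero_comp
    have hg' := hg.zero_comp
    exact (idq_comp f).symm.trans ((hf'.trans hg'.symm).trans (idq_comp g))
  | succ n ih =>
    have e : (idq n ⊠ zero : Q k (n + 0) (n + 1)) ⨟ f = (idq n ⊠ zero : Q k (n + 0) (n + 1)) ⨟ g := by
      have hz : Additive (idq n ⊠ zero : Q k (n + 0) (n + 1)) :=
        (additive_idq n).tensor additive_zero
      refine ih (hz.comp hf) (hz.comp hg) fun v => ?_
      have hv : (col v : Q k 1 n) ⨟ (idq n ⊠ zero : Q k (n + 0) (n + 1)) =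
          col (Fin.snoc v 0 : Fin (n + 1) → k) := by
        change _ = copy ⨟ (col (fun i => Fin.snoc (α := fun _ => k) v 0 i.castSucc) ⊠
          sc (Fin.snoc (α := fun _ => k) v 0 (Fin.last n)))
        simp only [Fin.snoc_castSucc, Fin.snoc_last]
        have h₂ : (col v ⊠ sc 0 : Q k 2 (n + 1)) = (idq 1 ⊠ del) ⨟ (col v ⊠ zero) := by
          rw [← interchange, idq_comp, ax_scalar_zero]
        rw [h₂, ← compq_assoc, copy_counit_right, idq_comp]
        conv_lhs => rw [← tensor_id_zero (col v)]
        rw [← interchange, comp_idq, idq_comp]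
      rw [← compq_assoc, ← compq_assoc, hv, h]
    have e' : (zeroN n ⊠ idq 1 : Q k (0 + 1) (n + 1)) ⨟ f = (zeroN n ⊠ idq 1 : Q k (0 + 1) (n + 1)) ⨟ g := by
      -- Embedding the last wire is the column of the last basis vector.
      have hv : (zeroN n ⊠ idq 1 : Q k (0 + 1) (n + 1)) =
          col (Fin.snoc (0 : Fin n → k) 1 : Fin (n + 1) → k) := by
        change _ = copy ⨟ (col (fun i => Fin.snoc (α := fun _ => k) (0 : Fin n → k) 1 i.castSucc) ⊠
          sc (Fin.snoc (α := fun _ => k) (0 : Fin n → k) 1 (Fin.last n)))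
        simp only [Fin.snoc_castSucc, Fin.snoc_last]
        have h₂ : (fun i => (0 : Fin n → k) i) = 0 := rfl
        rw [h₂, col_zero, sc_one, tensor_comp_left, ← compq_assoc, ax_copy_counit]
        exact (idq_comp _).symm
      rw [hv]
      exact h _
    rw [hf.eq_add, hg.eq_add, e, e']

/-- Completeness of the axioms for matrix circuits. -/
theorem inc_eq_of_fn_eq {n m : ℕ} {t t' : FT k n m} (h : fn t = fn t') : inc t = inc t' :=
  additive_ext (additive_inc t) (additive_inc t') fun v => by rw [col_inc, col_inc, h]

end IHP

namespace IHP

variable {k : Type u} [Field k]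

/-! ### Pairs of linear maps -/

/-- The first block. -/
def fst (n m : ℕ) : Lin k (n + m) n := LinearMap.funLeft k k (Fin.castAdd m)

/-- The second block. -/
def snd (n m : ℕ) : Lin k (n + m) m := LinearMap.funLeft k k (Fin.natAdd n)

/-- The linear map with given blocks. -/
def pair {n m m' : ℕ} (A : Lin k n m) (B : Lin k n m') : Lin k n (m + m') where
  toFun v := Fin.append (A v) (B v)
  map_add' v w := by
    rw [map_add, map_add]
    funext i
    induction i using Fin.addCases <;> simp
  map_smul' r v := by
    rw [map_smul, map_smul]
    funext i
    induction i using Fin.addCases <;> simp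

@[simp] theorem fst_append {n m : ℕ} (v : Fin n → k) (w : Fin m → k) :
    fst n m (Fin.append v w) = v := by
  funext i; simp [fst, LinearMap.funLeft]

@[simp] theorem snd_append {n m : ℕ} (v : Fin n → k) (w : Fin m → k) :
    snd n m (Fin.append v w) = w := by
  funext i; simp [snd, LinearMap.funLeft]

theorem append_fst_snd {n m : ℕ} (v : Fin (n + m) → k) :
    Fin.append (fst n m v) (snd n m v) = v := Fin.append_castAdd_natAdd

theorem pair_apply {n m m' : ℕ} (A : Lin k n m) (B : Lin k n m') (v : Fin n → k) :
    pair A B v = Fin.append (A v) (B v) := rfl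

@[simp] theorem fst_pair {n m m' : ℕ} (A : Lin k n m) (B : Lin k n m') :
    fst m m' ∘ₗ pair A B = A :=
  LinearMap.ext fun v => by simp [pair_apply]

@[simp] theorem snd_pair {n m m' : ℕ} (A : Lin k n m) (B : Lin k n m') :
    snd m m' ∘ₗ pair A B = B :=
  LinearMap.ext fun v => by simp [pair_apply]

@[simp] theorem fst_pair_comp {p n m m' : ℕ} (A : Lin k n m) (B : Lin k n m') (D : Lin k p n) :
    fst m m' ∘ₗ (pair A B ∘ₗ D) = A ∘ₗ D := by
  rw [← LinearMap.comp_assoc, fst_pair]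

@[simp] theorem snd_pair_comp {p n m m' : ℕ} (A : Lin k n m) (B : Lin k n m') (D : Lin k p n) :
    snd m m' ∘ₗ (pair A B ∘ₗ D) = B ∘ₗ D := by
  rw [← LinearMap.comp_assoc, snd_pair]

@[simp] theorem pair_comp {p n m m' : ℕ} (A : Lin k n m) (B : Lin k n m') (D : Lin k p n) :
    pair A B ∘ₗ D = pair (A ∘ₗ D) (B ∘ₗ D) := rfl

theorem pair_ext {n m m' : ℕ} {A B : Lin k n (m + m')} (h₁ : fst m m' ∘ₗ A = fst m m' ∘ₗ B)
    (h₂ : snd m m' ∘ₗ A = snd m m' ∘ₗ B) : A = B :=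
  LinearMap.ext fun v => by
    rw [← append_fst_snd (A v), ← append_fst_snd (B v)]
    exact congrArg₂ Fin.append (LinearMap.congr_fun h₁ v) (LinearMap.congr_fun h₂ v)

@[simp] theorem pair_fst_snd (n m : ℕ) : pair (fst n m) (snd n m) = (LinearMap.id : Lin k _ _) :=
  pair_ext (by simp) (by simp)

@[simp] theorem pair_fst_snd_comp {n m p : ℕ} (A : Lin k p (n + m)) :
    pair (fst n m ∘ₗ A) (snd n m ∘ₗ A) = A := pair_ext (by simp) (by simp)

theorem blk_eq {n m n' m' : ℕ} (A : Lin k n m) (B : Lin k n' m') :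
    blk A B = pair (A ∘ₗ fst n n') (B ∘ₗ snd n n') := rfl

theorem swapL_eq (n m : ℕ) : (swapL n m : Lin k _ _) = pair (snd n m) (fst n m) := rfl

theorem lin_zero_ext {n : ℕ} (A B : Lin k n 0) : A = B :=
  LinearMap.ext fun _ => funext fun i => i.elim0

theorem lin_from_zero_ext {n : ℕ} (A B : Lin k 0 n) : A = B :=
  LinearMap.ext fun v => by rw [Subsingleton.elim v 0, map_zero, map_zero]

/-- Relabelling along an equality of dimensions. -/
def castL {n m : ℕ} (h : n = m) : Lin k n m := LinearMap.funLeft k k (Fin.cast h.symm)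

@[simp] theorem castL_rfl {n : ℕ} (h : n = n) : (castL h : Lin k n n) = LinearMap.id := rfl

theorem castL_assoc (n m o : ℕ) : (castL (Nat.add_assoc n m o) : Lin k _ _) =
    pair (fst n m ∘ₗ fst (n + m) o) (pair (snd n m ∘ₗ fst (n + m) o) (snd (n + m) o)) := by
  refine pair_ext ?_ (pair_ext ?_ ?_)
  · rw [fst_pair]; rfl
  · rw [snd_pair, fst_pair]; rfl
  · rw [snd_pair, snd_pair]
    refine LinearMap.ext fun v => funext fun i => congrArg v (Fin.ext ?_)
    simp [Nat.add_assoc]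

theorem castL_assoc_symm (n m o : ℕ) : (castL (Nat.add_assoc n m o).symm : Lin k _ _) =
    pair (pair (fst n (m + o)) (fst m o ∘ₗ snd n (m + o))) (snd m o ∘ₗ snd n (m + o)) := by
  refine pair_ext (pair_ext ?_ ?_) ?_
  · rw [fst_pair, fst_pair]; rfl
  · rw [fst_pair, snd_pair]; rfl
  · rw [snd_pair]
    refine LinearMap.ext fun v => funext fun i => congrArg v (Fin.ext ?_)
    simp [Nat.add_assoc]

/-- The linear map duplicating its input. -/
def dup (n : ℕ) : Lin k n (n + n) := pair LinearMap.id LinearMap.id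

/-! ### Every linear map is denoted by a term -/

theorem fn_cast_id {n m : ℕ} (h : n = m) :
    fn (PTerm.cast rfl h (PTerm.id n) : FT k n m) = castL h := by
  subst h; rfl

theorem genFn_copy : (genFn .copy : Lin k 1 2) = dup 1 := by
  refine LinearMap.ext fun v => funext fun i => ?_
  fin_cases i <;> rfl

theorem genFn_add : (genFn .add : Lin k 2 1) = fst 1 1 + snd 1 1 := by
  refine LinearMap.ext fun v => funext fun i => ?_
  fin_cases i; rfl

/-- Duplicate each block and exchange the two middle blocks; this builds a term for `dup` by
induction from the copy generator. -/
theorem dup_add (n m : ℕ) : (dup (n + m) : Lin k _ _) =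
    castL (Nat.add_assoc n m (n + m)).symm ∘ₗ
      blk LinearMap.id (castL (Nat.add_assoc m n m) ∘ₗ blk (swapL n m) LinearMap.id ∘ₗ
        castL (Nat.add_assoc n m m).symm) ∘ₗ
      castL (Nat.add_assoc n n (m + m)) ∘ₗ blk (dup n) (dup m) := by
  simp only [castL_assoc, castL_assoc_symm, blk_eq, swapL_eq, dup]
  refine pair_ext (pair_ext ?_ ?_) (pair_ext ?_ ?_) <;> simp [LinearMap.comp_assoc]

/-- The linear map is denoted by a term. -/
def IsTermFn {n m : ℕ} (A : Lin k n m) : Prop := ∃ t : FT k n m, fn t = A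

namespace IsTermFn

theorem comp {n m o : ℕ} {A : Lin k n m} {B : Lin k m o} (hB : IsTermFn B) (hA : IsTermFn A) :
    IsTermFn (B ∘ₗ A) := by
  obtain ⟨t, rfl⟩ := hA
  obtain ⟨s, rfl⟩ := hB
  exact ⟨.comp t s, rfl⟩

theorem blk {n m n' m' : ℕ} {A : Lin k n m} {B : Lin k n' m'} (hA : IsTermFn A)
    (hB : IsTermFn B) : IsTermFn (blk A B) := by
  obtain ⟨t, rfl⟩ := hA
  obtain ⟨s, rfl⟩ := hB
  exact ⟨.tensor t s, rfl⟩

theorem castL {n m : ℕ} (h : n = m) : IsTermFn (castL h : Lin k n m) := ⟨_, fn_cast_id h⟩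

theorem id (n : ℕ) : IsTermFn (LinearMap.id : Lin k n n) := ⟨.id n, rfl⟩

theorem dup (n : ℕ) : IsTermFn (dup n : Lin k n _) := by
  induction n with
  | zero => exact ⟨.id 0, lin_zero_ext _ _⟩
  | succ n ih =>
    rw [dup_add]
    exact (castL _).comp (((id _).blk ((castL _).comp ((blk ⟨.swap n 1, rfl⟩ (id _)).comp
      (castL _)))).comp ((castL _).comp (ih.blk ⟨.gen .copy, genFn_copy⟩)))

theorem pair {n m m' : ℕ} {A : Lin k n m} {B : Lin k n m'} (hA : IsTermFn A)
    (hB : IsTermFn B) : IsTermFn (pair A B) := by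
  have h := (hA.blk hB).comp (dup n)
  rw [blk_eq, IHP.dup] at h
  simpa [LinearMap.comp_assoc] using h

end IsTermFn

theorem isTermFn_row {n : ℕ} (A : Lin k n 1) : IsTermFn A := by
  induction n with
  | zero => exact ⟨.gen .zero, lin_from_zero_ext _ _⟩
  | succ n ih =>
    obtain ⟨t, ht⟩ := ih (A ∘ₗ pair LinearMap.id 0)
    -- The coefficient of the last variable.
    let c : k := A (fun i => if i = Fin.last n then 1 else 0) 0
    refine ⟨.comp (.tensor t (.gen (.scalar c))) (.gen .add), ?_⟩
    change genFn .add ∘ₗ blk (fn t) (c • LinearMap.id) = A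
    rw [ht, genFn_add, LinearMap.add_comp, blk_eq, fst_pair, snd_pair]
    refine LinearMap.ext fun v => funext fun i => ?_
    have hi : i = 0 := Subsingleton.elim _ _
    subst hi
    have hv : v = pair LinearMap.id 0 (fst n 1 v) +
        v (Fin.last n) • (fun i => if i = Fin.last n then 1 else 0) := by
      funext i
      induction i using Fin.lastCases with
      | last =>
        have : pair (LinearMap.id : Lin k n n) (0 : Lin k n 1) (fst n 1 v) (Fin.last n) = 0 :=
          Fin.append_right (fst n 1 v) (0 : Fin 1 → k) 0
        simp [this]
      | cast i =>
        have : pair (LinearMap.id : Lin k n n) (0 : Lin k n 1) (fst n 1 v) i.castSucc =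
          v i.castSucc := Fin.append_left (fst n 1 v) (0 : Fin 1 → k) i
        simp [this, (Fin.castSucc_lt_last i).ne]
    conv_rhs => rw [hv, map_add, map_smul]
    exact congrArg (A (pair LinearMap.id 0 (fst n 1 v)) 0 + ·) (mul_comm c (v (Fin.last n)))

theorem isTermFn {n m : ℕ} (A : Lin k n m) : IsTermFn A := by
  induction m with
  | zero =>
    induction n with
    | zero => exact ⟨.id 0, lin_zero_ext _ _⟩
    | succ n ih =>
      obtain ⟨t, _⟩ := ih 0
      exact ⟨.tensor t (.gen .delete), lin_zero_ext _ _⟩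
  | succ m ih =>
    have h := (ih (fst m 1 ∘ₗ A)).pair (isTermFn_row (snd m 1 ∘ₗ A))
    rwa [pair_fst_snd_comp] at h

/-! ### The functor from linear maps to circuits -/

variable [LinearOrder k]

/-- The circuit of a linear map. -/
noncomputable def F {n m : ℕ} (A : Lin k n m) : Q k n m := inc (isTermFn A).choose

/-- Makes the choice of term in `F` immaterial. Functoriality follows, and rewiring identities
between matrix circuits can be checked on linear maps. -/
theorem F_fn {n m : ℕ} (t : FT k n m) : F (fn t) = inc t :=
  inc_eq_of_fn_eq (isTermFn (fn t)).choose_spec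

theorem F_comp {n m o : ℕ} (A : Lin k n m) (B : Lin k m o) : F A ⨟ F B = F (B ∘ₗ A) := by
  obtain ⟨s, rfl⟩ := isTermFn A
  obtain ⟨t, rfl⟩ := isTermFn B
  rw [F_fn, F_fn]
  exact (F_fn (.comp s t)).symm

theorem F_tensor {n m n' m' : ℕ} (A : Lin k n m) (B : Lin k n' m') :
    F A ⊠ F B = F (blk A B) := by
  obtain ⟨s, rfl⟩ := isTermFn A
  obtain ⟨t, rfl⟩ := isTermFn B
  rw [F_fn, F_fn]
  exact (F_fn (.tensor s t)).symm

theorem F_id (n : ℕ) : F (LinearMap.id : Lin k n n) = idq n := F_fn (.id n)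

theorem F_swapL (n m : ℕ) : F (swapL n m : Lin k _ _) = swapq n m := F_fn (.swap n m)

theorem F_castL {n m : ℕ} (h : n = m) : F (castL h : Lin k _ _) = cst h := by
  subst h; exact F_id n

theorem F_dup_one : F (dup 1 : Lin k 1 2) = copy := by
  rw [← genFn_copy]; exact F_fn (.gen .copy)

theorem F_del (A : Lin k 1 0) : F A = del := by
  rw [lin_zero_ext A (fn (.gen .delete))]; exact F_fn (.gen .delete)

theorem F_sc (r : k) : F (r • LinearMap.id : Lin k 1 1) = sc r := F_fn (.gen (.scalar r))

theorem F_add : F (fst 1 1 + snd 1 1 : Lin k 2 1) = add := by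
  rw [← genFn_add]; exact F_fn (.gen .add)

theorem F_zero (A : Lin k 0 1) : F A = zero := by
  rw [lin_from_zero_ext A (fn (.gen .zero))]; exact F_fn (.gen .zero)

theorem F_pair {n m m' : ℕ} (A : Lin k n m) (B : Lin k n m') :
    F (pair A B) = F (dup n) ⨟ (F A ⊠ F B) := by
  rw [F_tensor, F_comp, blk_eq, dup]
  simp [LinearMap.comp_assoc]

end IHP

namespace IHP

variable {k : Type u} [Field k] [LinearOrder k]

/-! ### Substitution, conjunction and quantification -/

/-- Substitution of a linear map into a circuit. -/
noncomputable def sub {n m p : ℕ} (A : Lin k n m) (f : Q k m p) : Q k n p := F A ⨟ f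

@[simp] theorem sub_id {n p : ℕ} (f : Q k n p) : sub LinearMap.id f = f := by
  rw [sub, F_id, idq_comp]

@[simp] theorem sub_sub {n m o p : ℕ} (A : Lin k n m) (B : Lin k m o) (f : Q k o p) :
    sub A (sub B f) = sub (B ∘ₗ A) f := by
  rw [sub, sub, ← compq_assoc, F_comp]; rfl

theorem sub_F {n m p : ℕ} (A : Lin k n m) (B : Lin k m p) : sub A (F B) = F (B ∘ₗ A) :=
  F_comp A B

/-- Restriction of a circuit by a condition on its inputs. -/
noncomputable def guard {n p : ℕ} (f : Q k n p) (e : Q k n 0) : Q k n p := F (dup n) ⨟ (f ⊠ e)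

theorem sub_guard {n m p : ℕ} (A : Lin k n m) (f : Q k m p) (e : Q k m 0) :
    sub A (guard f e) = guard (sub A f) (sub A e) := by
  simp only [sub, guard]
  rw [interchange, ← compq_assoc, ← compq_assoc, F_comp, ← F_pair, dup, pair_comp]
  rfl

/-- Parallel composition is conjunction over disjoint sets of variables. -/
theorem tensor_eq_guard {n n' p : ℕ} (f : Q k n p) (e : Q k n' 0) :
    f ⊠ e = guard (sub (fst n n') f) (sub (snd n n') e) := by
  simp only [sub, guard]
  rw [interchange, ← compq_assoc, ← F_pair, pair_fst_snd, F_id, idq_comp]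

theorem guard_guard_dup {n p : ℕ} (f : Q k n p) (e e' : Q k n 0) :
    guard (guard f e) e' = guard f (guard e e') := by
  have h : F (dup n) ⨟ (F (dup n) ⊠ idq n) ⨟ cst (Nat.add_assoc n n n) =
      F (dup n) ⨟ (idq n ⊠ F (dup n) : Q k _ _) := by
    rw [← F_id, F_tensor, F_tensor, ← F_castL, F_comp, F_comp, F_comp, castL_assoc, blk_eq,
      blk_eq, dup]
    congr 1
    exact pair_ext (by simp [LinearMap.comp_assoc])
      (pair_ext (by simp [LinearMap.comp_assoc]) (by simp [LinearMap.comp_assoc]))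
  simp only [guard]
  rw [tensor_comp_left, tensor_comp_right, tensor_assoc, ← compq_assoc, ← compq_assoc,
    ← compq_assoc, ← compq_assoc, h]
  exact comp_idq _

theorem F_eq_one {n : ℕ} (A B : Lin k n 0) : F A = F B := by rw [lin_zero_ext A B]

theorem guard_F {n p : ℕ} (f : Q k n p) (A : Lin k n 0) : guard f (F A) = f := by
  have h := interchange (F LinearMap.id) f (F A) (idq 0)
  rw [F_id, idq_comp, comp_idq, tensor_id_zero, ← F_id] at h
  rw [guard, h, ← compq_assoc, ← F_pair]
  have h₂ : (pair LinearMap.id A : Lin k n (n + 0)) = (LinearMap.id : Lin k n n) :=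
    pair_ext (by rw [fst_pair]; rfl) (lin_zero_ext _ _)
  rw [h₂, F_id, idq_comp]

theorem guard_comm {n : ℕ} (e e' : Q k n 0) : guard e e' = guard e' e := by
  rw [guard, guard]
  have h := swap_natural e e'
  rw [swap_zero, cst_rfl] at h
  have h' : e ⊠ e' = swapq n n ⨟ (e' ⊠ e) := (comp_idq _).symm.trans h
  rw [h', ← F_swapL, ← compq_assoc, F_comp, swapL_eq, dup]
  simp

/-- Conjunction of formulas, with truth as unit. Idempotence is not included; it is established
later for members of `Cone`. -/
noncomputable instance (n : ℕ) : CommMonoid (Q k n 0) where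
  mul e e' := guard e e'
  mul_assoc e e' e'' := guard_guard_dup e e' e''
  one := F 0
  one_mul e := (guard_comm _ _).trans (guard_F e 0)
  mul_one e := guard_F e 0
  mul_comm e e' := guard_comm e e'

theorem mul_def {n : ℕ} (e e' : Q k n 0) : e * e' = guard e e' := rfl

theorem one_def {n : ℕ} : (1 : Q k n 0) = F 0 := rfl

theorem guard_guard {n p : ℕ} (f : Q k n p) (e e' : Q k n 0) :
    guard (guard f e) e' = guard f (e * e') := guard_guard_dup f e e'

@[simp] theorem guard_one {n p : ℕ} (f : Q k n p) : guard f 1 = f := guard_F f 0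

@[simp] theorem sub_mul {n m : ℕ} (A : Lin k n m) (e e' : Q k m 0) :
    sub A (e * e') = sub A e * sub A e' := sub_guard A e e'

@[simp] theorem sub_one {n m : ℕ} (A : Lin k n m) : sub A (1 : Q k m 0) = 1 := by
  rw [one_def, sub, F_comp]; exact F_eq_one _ _

theorem tensor_eq_mul {n m : ℕ} (e : Q k n 0) (e' : Q k m 0) :
    (e ⊠ e' : Q k (n + m) 0) = sub (fst n m) e * sub (snd n m) e' := tensor_eq_guard e e'

/-- Precomposition with a circuit on the last inputs. -/
def wp {l n m p : ℕ} (c : Q k n m) (f : Q k (l + m) p) : Q k (l + n) p := (idq l ⊠ c) ⨟ f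

theorem wp_comp {l n m o p : ℕ} (c : Q k n m) (d : Q k m o) (f : Q k (l + o) p) :
    wp (c ⨟ d) f = wp c (wp d f) := by
  rw [wp, tensor_comp_right, compq_assoc]; rfl

theorem wp_F {l n m p : ℕ} (A : Lin k n m) (f : Q k (l + m) p) :
    wp (F A) f = sub (pair (fst l n) (A ∘ₗ snd l n)) f := by
  rw [wp, ← F_id, F_tensor]; rfl

/-- Substitution acts on the parameters only and `c` on the other wires, so the two commute by
interchange. -/
theorem sub_wp {l l' n m p : ℕ} (A : Lin k l' l) (c : Q k n m) (f : Q k (l + m) p) :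
    sub (pair (A ∘ₗ fst l' n) (snd l' n)) (wp c f) =
      wp c (sub (pair (A ∘ₗ fst l' m) (snd l' m)) f) := by
  have h : ∀ n, (pair (A ∘ₗ fst l' n) (snd l' n) : Lin k _ _) = blk A LinearMap.id :=
    fun n => rfl
  rw [h, h, sub, sub, wp, wp, ← F_tensor, ← F_tensor, F_id, F_id, ← compq_assoc, ← compq_assoc,
    ← interchange, ← interchange]
  simp

theorem cst_cancel_assoc {n m p : ℕ} (h : n = m) (h' : m = n) (f : Q k n p) :
    cst h ⨟ (cst h' ⨟ f) = f := by
  subst h; simp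

/-- A condition on the parameters alone is unaffected by `c`. For `c = codel` this is Frobenius
reciprocity for `ex`. -/
theorem wp_guard {l n m p : ℕ} (c : Q k n m) (f : Q k (l + m) p) (e : Q k l 0) :
    wp c (guard f (sub (fst l m) e)) = guard (wp c f) (sub (fst l n) e) := by
  -- Only the parameter block needs copying: its second copy is routed to the far right, out of the
  -- way of `c`.
  have key : ∀ a, F (dup (l + a)) ⨟ (idq (l + a) ⊠ F (fst l a)) = 
      (F (dup l) ⊠ idq a : Q k _ _) ⨟ F (pair (pair (fst l l ∘ₗ fst (l + l) a) (snd (l + l) a))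
        (snd l l ∘ₗ fst (l + l) a)) := by
    intro a
    rw [← F_id, ← F_pair, ← F_id, F_tensor, F_comp, blk_eq, dup]
    congr 1
    exact pair_ext (pair_ext (by simp [LinearMap.comp_assoc]) (by simp))
      (by simp [LinearMap.comp_assoc])
  have key₂ : (idq (l + l) ⊠ c) ⨟ F (pair (pair (fst l l ∘ₗ fst (l + l) m) (snd (l + l) m))
        (snd l l ∘ₗ fst (l + l) m)) = F (pair (pair (fst l l ∘ₗ fst (l + l) n) (snd (l + l) n))
        (snd l l ∘ₗ fst (l + l) n)) ⨟ (idq l ⊠ c ⊠ idq l) := by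
    have e : ∀ a, F (pair (pair (fst l l ∘ₗ fst (l + l) a) (snd (l + l) a))
        (snd l l ∘ₗ fst (l + l) a)) = cst (Nat.add_assoc l l a) ⨟
          (idq l ⊠ swapq l a : Q k _ _) ⨟ cst (Nat.add_assoc l a l).symm := by
      intro a
      rw [← F_castL, ← F_castL, ← F_swapL, ← F_id, F_tensor, F_comp, F_comp, castL_assoc,
        castL_assoc_symm, blk_eq, swapL_eq]
      congr 1
      exact pair_ext (pair_ext (by simp) (by simp [LinearMap.comp_assoc]))
        (by simp [LinearMap.comp_assoc])
    rw [e, e, ← idq_tensor_idq, tensor_assoc, tensor_assoc]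
    simp only [compq_assoc]
    rw [cst_cancel_assoc, cst_cancel_assoc, ← compq_assoc (idq l ⊠ _), ← compq_assoc (idq l ⊠ _),
      ← interchange, ← interchange, swap_natural]
  have hc : F (dup l) ⊠ c = (F (dup l) ⊠ idq n) ⨟ (idq (l + l) ⊠ c) := by
    rw [← interchange, idq_comp, comp_idq]
  rw [wp, guard, sub, tensor_comp_right, ← compq_assoc (F (dup (l + m))), key, compq_assoc,
    ← compq_assoc (idq l ⊠ c), ← interchange, idq_comp, comp_idq, hc, compq_assoc,
    ← compq_assoc (idq (l + l) ⊠ c), key₂, compq_assoc, ← interchange, idq_comp, ← compq_assoc,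
    ← key, compq_assoc, ← interchange, idq_comp]
  rfl

/-- Exchange of the last two blocks. -/
def exch (l a b : ℕ) : Lin k (l + a + b) (l + b + a) :=
  pair (pair (fst l a ∘ₗ fst (l + a) b) (snd (l + a) b)) (snd l a ∘ₗ fst (l + a) b)

theorem F_exch (l a b : ℕ) : F (exch l a b) = cst (Nat.add_assoc l a b) ⨟
    (idq l ⊠ swapq a b : Q k _ _) ⨟ cst (Nat.add_assoc l b a).symm := by
  rw [← F_castL, ← F_castL, ← F_swapL, ← F_id, F_tensor, F_comp, F_comp, castL_assoc,
    castL_assoc_symm, blk_eq, swapL_eq, exch]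
  congr 1
  exact pair_ext (pair_ext (by simp) (by simp [LinearMap.comp_assoc]))
    (by simp [LinearMap.comp_assoc])

theorem wp_exch {l n m r p : ℕ} (c : Q k n m) (f : Q k (l + m + r) p) :
    (idq l ⊠ c ⊠ idq r) ⨟ f = sub (exch l n r) (wp c (sub (exch l r m) f)) := by
  simp only [sub, wp]
  rw [F_exch, F_exch, ← idq_tensor_idq, tensor_assoc, tensor_assoc]
  simp only [compq_assoc]
  rw [cst_cancel_assoc, cst_cancel_assoc, ← compq_assoc (idq l ⊠ _), ← compq_assoc (idq l ⊠ _),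
    ← interchange, ← compq_assoc (_ ⊠ (swapq n r ⨟ _)), ← interchange, compq_assoc (swapq n r),
    swap_natural, ← compq_assoc (swapq n r), swap_swap]
  simp [compq_assoc]

/-- While one factor acts, the wires of the other serve as parameters. This is the reason for
allowing an arbitrary parameter block `l`. -/
theorem wp_tensor {l n m n' m' p : ℕ} (c : Q k n m) (d : Q k n' m') (f : Q k (l + (m + m')) p) :
    wp (c ⊠ d) f = sub (castL (Nat.add_assoc l n n').symm) (sub (exch l n n') (wp c
      (sub (exch l n' m) (wp d (sub (castL (Nat.add_assoc l m m')) f))))) := by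
  rw [← wp_exch, sub, sub, F_castL, F_castL, wp, wp, ← compq_assoc (idq l ⊠ c ⊠ idq n'),
    ← interchange, idq_comp, comp_idq, tensor_assoc]
  simp only [compq_assoc]
  rw [cst_cancel_assoc, cst_cancel_assoc]

/-- Existential quantification of the last variable. -/
def ex {n p : ℕ} (f : Q k (n + 1) p) : Q k n p := wp (l := n) codel f

theorem sub_ex {n m p : ℕ} (A : Lin k n m) (f : Q k (m + 1) p) :
    sub A (ex f) = ex (sub (pair (A ∘ₗ fst n 1) (snd n 1)) f) := by
  rw [ex, ex, ← sub_wp]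
  congr 1
  exact pair_ext (by rw [fst_pair]; rfl) (lin_zero_ext _ _)

theorem ex_guard {n p : ℕ} (f : Q k (n + 1) p) (e : Q k n 0) :
    ex (guard f (sub (fst n 1) e)) = guard (ex f) e := by
  rw [ex, wp_guard]
  exact congrArg _ (sub_id e)

theorem ex_mul {n : ℕ} (f : Q k (n + 1) 0) (e : Q k n 0) :
    ex (f * sub (fst n 1) e) = ex f * e := ex_guard f e

theorem ex_mul' {n : ℕ} (f : Q k (n + 1) 0) (e : Q k n 0) :
    ex (sub (fst n 1) e * f) = e * ex f := by
  rw [mul_comm, ex_mul, mul_comm]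

-- The range of quantification is nonempty: `codelete` followed by `delete` is trivial.
@[simp] theorem ex_one (n : ℕ) : ex (1 : Q k (n + 1) 0) = 1 := by
  have h : (1 : Q k (n + 1) 0) = (F (0 : Lin k n 0) ⊠ del : Q k (n + 1) (0 + 0)) := by
    rw [← F_del 0, F_tensor]; exact F_eq_one _ _
  rw [h, ex, wp, ← interchange, ax_codelete_delete, idq_comp, tensor_id_zero]
  rfl

theorem ex_ex {n p : ℕ} (f : Q k (n + 1 + 1) p) :
    ex (ex f) = (idq n ⊠ codel ⊠ codel : Q k (n + 0 + 0) (n + 1 + 1)) ⨟ f := by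
  have h := interchange (k := k) (idq n ⊠ codel) (idq (n + 1)) (idq 0) codel
  rw [comp_idq, idq_comp, tensor_id_zero] at h
  rw [h, compq_assoc]
  rfl

theorem ex_exch {n p : ℕ} (f : Q k (n + 1 + 1) p) : ex (ex (sub (exch n 1 1) f)) = ex (ex f) := by
  have h : (codel ⊠ codel : Q k (0 + 0) (1 + 1)) ⨟ swapq 1 1 = codel ⊠ codel := by
    rw [swap_natural, swap_zero]
    exact idq_comp _
  rw [ex_ex, ex_ex, sub, F_exch, tensor_assoc]
  simp only [compq_assoc]
  rw [cst_cancel_assoc, ← compq_assoc (idq n ⊠ _), ← interchange, h, idq_comp]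

end IHP

namespace IHP

variable {k : Type u} [Field k]

/-! ### Consequences of the axioms of interacting Hopf algebras -/

variable [LinearOrder k]

theorem sc_neg_one_sq : sc (-1 : k) ⨟ sc (-1) = idq 1 := by
  rw [ax_scalar_mul, neg_one_mul, neg_neg, sc_one]

theorem sc_cozero {r : k} (hr : r ≠ 0) : sc r ⨟ cozero = cozero := by
  conv_lhs => rw [← ax_coscalar_cozero r]
  rw [← compq_assoc, ax_scalar_inv r hr, idq_comp]

theorem cosc_eq {r : k} (hr : r ≠ 0) : cosc r = sc r⁻¹ := by
  have h := congrArg (fun x => x ⨟ cosc r) (ax_scalar_mul r⁻¹ r)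
  simp only [compq_assoc, ax_scalar_inv r hr, inv_mul_cancel₀ hr, sc_one, idq_comp, comp_idq] at h
  exact h.symm

theorem cocopy_unit_right : (idq 1 ⊠ codel : Q k (1 + 0) (1 + 1)) ⨟ cocopy = idq 1 := by
  rw [← ax_cocopy_comm, ← compq_assoc, swap_natural, swap_zero, cst_rfl, compq_assoc]
  exact (idq_comp _).trans ax_cocopy_unit

theorem coadd_counit_right : (coadd : Q k 1 2) ⨟ (idq 1 ⊠ cozero : Q k (1 + 1) (1 + 0)) = idq 1 := by
  rw [← ax_coadd_cocomm, compq_assoc, ← swap_natural, zero_swap, ← compq_assoc, ax_coadd_counit]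
  exact idq_comp _

/-- An arbitrary number plus `x` is an arbitrary number. The Frobenius law inserts `coadd` after
`codel`, where it splits into two copies of `codel`; what remains attached to `x` is a signed cap
with a free end, that is, `del`. -/
theorem codel_add : (idq 1 ⊠ codel : Q k (1 + 0) (1 + 1)) ⨟ add = del ⨟ codel := by
  have h₁ : (idq 1 ⊠ (codel ⨟ coadd) : Q k (1 + 0) (1 + 2)) ⨟
      ((add ⨟ cozero) ⊠ idq 1 : Q k (2 + 1) (0 + 1)) = (idq 1 ⊠ codel : Q k (1 + 0) (1 + 1)) ⨟ add := by
    rw [tensor_comp_right, tensor_comp_left, compq_assoc, ← compq_assoc (idq 1 ⊠ coadd),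
      ← ax_add_frob_right, compq_assoc, ax_coadd_counit, comp_idq]
  have h₂ : (idq 1 ⊠ codel : Q k (1 + 0) (1 + 1)) ⨟ (add ⨟ cozero) = del := by
    rw [ax_cap_white, ← compq_assoc, ← interchange, idq_comp, comp_idq]
    have : (sc (-1) ⊠ codel : Q k (1 + 0) (1 + 1)) = sc (-1) ⨟ (idq 1 ⊠ codel) := by
      conv_rhs => rw [← tensor_id_zero (sc (-1))]
      rw [← interchange, idq_comp, comp_idq]
    rw [this]
    change sc (-1) ⨟ (idq 1 ⊠ codel : Q k (1 + 0) (1 + 1)) ⨟ (cocopy ⨟ del) = del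
    rw [compq_assoc, ← compq_assoc _ cocopy, cocopy_unit_right, idq_comp, ax_scalar_delete]
  rw [← h₁, ax_codelete_coadd]
  have h₃ : (idq 1 ⊠ (codel ⊠ codel : Q k (0 + 0) (1 + 1)) : Q k (1 + 0) (1 + 2)) =
      (idq 1 ⊠ codel : Q k (1 + 0) (1 + 1)) ⊠ codel := by
    rw [tensor_assoc]
    exact ((comp_idq _).trans (idq_comp _)).symm
  rw [h₃, ← interchange, h₂, comp_idq]
  have h := interchange (k := k) del (idq 0) (idq 0) codel
  rw [comp_idq, idq_comp, tensor_id_zero, id_zero_tensor] at h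
  exact h.trans (congrArg _ ((comp_idq _).trans (idq_comp _)))

/-- If `x = 0`, then `x` may be replaced by a fresh zero. One diagram is evaluated twice: by
splitting `cozero` over `cocopy`, and by turning `zero ; coadd` into a signed cup and straightening
it. The stray sign is cancelled at the end. -/
theorem copy_cozero : copy ⨟ (idq 1 ⊠ cozero : Q k (1 + 1) (1 + 0)) = cozero ⨟ zero := by
  have h₁ : ((zero ⨟ coadd) ⊠ idq 1 : Q k (0 + 1) (2 + 1)) ⨟
      (idq 1 ⊠ (cocopy ⨟ cozero) : Q k (1 + 2) (1 + 0)) =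
        cozero ⨟ zero := by
    rw [ax_cocopy_cozero]
    have h₃ : (idq 1 ⊠ (cozero ⊠ cozero : Q k (1 + 1) (0 + 0)) : Q k (1 + 2) (1 + 0)) =
        (idq 1 ⊠ cozero : Q k (1 + 1) (1 + 0)) ⊠ cozero := by
      rw [tensor_assoc]
      exact ((comp_idq _).trans (idq_comp _)).symm
    rw [h₃, ← interchange, compq_assoc, coadd_counit_right, idq_comp, comp_idq,
      tensor_right_effect, id_zero_tensor]
    exact congrArg (fun x => x ⨟ zero) ((comp_idq _).trans (idq_comp _))
  have h₂ : ((zero ⨟ coadd) ⊠ idq 1 : Q k (0 + 1) (2 + 1)) ⨟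
      (idq 1 ⊠ (cocopy ⨟ cozero) : Q k (1 + 2) (1 + 0)) =
        copy ⨟ (idq 1 ⊠ cozero : Q k (1 + 1) (1 + 0)) ⨟ sc (-1) := by
    rw [ax_cup_white]
    change ((codel ⨟ copy ⨟ (sc (-1) ⊠ idq 1)) ⊠ idq 1) ⨟ _ = _
    have h₄ : (sc (-1) ⊠ idq 1 ⊠ idq 1) ⨟ (idq 1 ⊠ (cocopy ⨟ cozero) : Q k (1 + 2) (1 + 0)) =
        (idq 1 ⊠ cocopy : Q k (1 + 2) (1 + 1)) ⨟ ((idq 1 ⊠ cozero : Q k (1 + 1) (1 + 0)) ⨟ sc (-1)) := by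
      have h₅ : (sc (-1) ⊠ idq 1 ⊠ idq 1 : Q k (2 + 1) (2 + 1)) =
          (sc (-1) ⊠ idq 2 : Q k (1 + 2) (1 + 2)) := by
        rw [tensor_assoc, idq_tensor_idq]
        exact (comp_idq _).trans (idq_comp _)
      rw [h₅, ← interchange, idq_comp, comp_idq, ← tensor_right_effect, ← interchange, idq_comp]
    rw [tensor_comp_left, tensor_comp_left, compq_assoc, h₄, compq_assoc,
      ← compq_assoc (copy ⊠ idq 1), ax_copy_frob_left, ← compq_assoc,
      ← compq_assoc (codel ⊠ idq 1), ax_cocopy_unit, idq_comp, compq_assoc]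
  have h := congrArg (fun x => x ⨟ sc (-1)) (h₂.symm.trans h₁)
  simpa only [compq_assoc, sc_neg_one_sq, comp_idq, ax_zero_scalar] using h

/-- Splitting `x` into two summands means choosing `y` freely and returning `(x - y, y)`. -/
theorem coadd_eq : coadd = (idq 1 ⊠ codel : Q k (1 + 0) (1 + 1)) ⨟
    F (pair (fst 1 1 - snd 1 1) (snd 1 1)) := by
  have h := congrArg (fun x => (idq 1 ⊠ zero : Q k (1 + 0) (1 + 1)) ⨟ x) (ax_add_frob_right (k := k))
  simp only [← compq_assoc] at h
  rw [add_unit_right, idq_comp, ← interchange, idq_comp, ax_cup_white] at h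
  rw [h]
  change (idq 1 ⊠ (codel ⨟ copy ⨟ (sc (-1) ⊠ idq 1)) : Q k (1 + 0) (1 + 2)) ⨟ _ = _
  rw [compq_assoc, tensor_comp_right, compq_assoc, ← F_dup_one, ← F_sc, ← F_add, ← F_id, F_tensor,
    F_comp, F_tensor, F_tensor, F_comp]
  congr 2
  refine LinearMap.ext fun v => funext fun i => ?_
  fin_cases i
  · change v 0 + (-1) * v 1 = v 0 - v 1
    ring
  · rfl

theorem cap_eq : cap = sub (fst 1 1 - snd 1 1) (cozero : Q k 1 0) := by
  have h := congrArg (fun x => (sc (-1) ⊠ idq 1) ⨟ x) (ax_cap_white (k := k))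
  simp only [← compq_assoc] at h
  rw [← interchange, sc_neg_one_sq, idq_comp, idq_tensor_idq, idq_comp, ← F_sc, ← F_add, ← F_id,
    F_tensor, F_comp] at h
  rw [← h]
  conv_rhs => rw [← sc_cozero (neg_ne_zero.2 (one_ne_zero (α := k))), ← F_sc]
  rw [sub, ← compq_assoc, F_comp]
  congr 2
  refine LinearMap.ext fun v => funext fun i => ?_
  fin_cases i
  change (-1) * v 0 + v 1 = (-1) * (v 0 - v 1)
  ring

/-! ### Equations -/

/-- The condition that two linear forms agree. -/
noncomputable def eqv {n : ℕ} (u v : Lin k n 1) : Q k n 0 := sub (u - v) cozero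

theorem sub_eqv {n m : ℕ} (A : Lin k n m) (u v : Lin k m 1) :
    sub A (eqv u v) = eqv (u ∘ₗ A) (v ∘ₗ A) := by
  rw [eqv, eqv, sub_sub, LinearMap.sub_comp]

theorem sub_smul_cozero {n : ℕ} {r : k} (hr : r ≠ 0) (u : Lin k n 1) :
    sub (r • u) cozero = sub u (cozero : Q k 1 0) := by
  conv_rhs => rw [← sc_cozero hr, ← F_sc]
  rw [sub, sub, ← compq_assoc, F_comp]
  rfl

theorem eqv_comm {n : ℕ} (u v : Lin k n 1) : eqv u v = eqv v u := by
  have h : (-1 : k) • (u - v) = v - u :=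
    LinearMap.ext fun x => funext fun i => by
      change (-1 : k) * (u x i - v x i) = v x i - u x i
      ring
  rw [eqv, ← sub_smul_cozero (r := (-1 : k)) (neg_ne_zero.2 one_ne_zero), h, eqv]

theorem tensor_guard {l n m : ℕ} (g : Q k n m) (e : Q k n 0) :
    idq l ⊠ guard g e = guard (idq l ⊠ g) (sub (snd l n) e) := by
  have h : F (dup (l + n)) ⨟ (idq (l + n) ⊠ F (snd l n)) =
      (idq l ⊠ F (dup n) : Q k _ _) ⨟ cst (Nat.add_assoc l n n).symm := by
    rw [← F_castL, ← F_id, ← F_id, F_tensor, F_tensor, F_comp, F_comp, castL_assoc_symm, blk_eq,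
      blk_eq, dup]
    congr 1
    exact pair_ext (pair_ext (by simp [dup]) (by simp [LinearMap.comp_assoc, dup]))
      (by simp [LinearMap.comp_assoc, dup])
  rw [guard, guard, sub, tensor_comp_right, tensor_comp_right, ← compq_assoc, h, tensor_assoc]
  simp only [compq_assoc]
  rw [cst_cancel_assoc]
  exact congrArg _ (comp_idq _).symm

theorem wp_guard_left {l n m p : ℕ} (g : Q k n m) (e : Q k n 0) (f : Q k (l + m) p) :
    wp (guard g e) f = guard (wp g f) (sub (snd l n) e) := by
  rw [wp, tensor_guard, guard, guard, wp, compq_assoc]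
  congr 1
  have h := interchange (idq l ⊠ g) f (sub (snd l n) e) (idq 0)
  rw [comp_idq, tensor_id_zero] at h
  exact h.symm

theorem guard_comp {n m p : ℕ} (g : Q k n m) (e : Q k n 0) (f : Q k m p) :
    guard (g ⨟ f) e = guard g e ⨟ f := by
  rw [guard, guard, compq_assoc]
  congr 1
  have h := interchange g f e (idq 0)
  rwa [comp_idq, tensor_id_zero] at h

theorem guard_cozero : guard (idq 1) (cozero : Q k 1 0) = guard (F 0) cozero := by
  have h : (F 0 : Q k 1 1) = del ⨟ zero := by rw [← F_del 0, ← F_zero 0, F_comp]; rfl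
  rw [guard, F_dup_one, copy_cozero, h, guard_comp, guard, F_dup_one]
  congr 1
  have h₂ := interchange (k := k) del (idq 0) (idq 1) cozero
  rw [comp_idq, idq_comp, id_zero_tensor] at h₂
  rw [h₂, ← compq_assoc, ax_copy_counit, idq_comp]
  exact ((comp_idq _).trans (idq_comp _)).symm

/-- Under the condition `y = 0`, zero may be substituted for `y`; this is `copy_cozero` with
parameters. -/
theorem guard_snd_cozero {n p : ℕ} (f : Q k (n + 1) p) :
    guard f (sub (snd n 1) cozero) =
      guard (sub (pair (fst n 1) 0) f) (sub (snd n 1) cozero) := by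
  have h := congrArg (fun c => wp (l := n) c f) (guard_cozero (k := k))
  simp only [wp_guard_left] at h
  rw [wp_F, ← F_id, wp_F] at h
  simpa using h

/-- Translation invariance of the quantifier, `∃ y, f (x, y + u x)` being `∃ y, f (x, y)`, which
rests on `codel_add`. -/
theorem ex_shear {n p : ℕ} (u : Lin k n 1) (f : Q k (n + 1) p) :
    ex (sub (pair (fst n 1) (snd n 1 + u ∘ₗ fst n 1)) f) = ex f := by
  have h : F (pair (fst n 1) (snd n 1 + u ∘ₗ fst n 1)) =
      (F (pair LinearMap.id u) ⊠ idq 1) ⨟ cst (Nat.add_assoc n 1 1) ⨟ (idq n ⊠ add) := by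
    rw [← F_add, ← F_id, ← F_id, F_tensor, F_tensor, ← F_castL, F_comp, F_comp, castL_assoc,
      blk_eq, blk_eq]
    congr 1
    refine pair_ext (by simp [LinearMap.comp_assoc]) ?_
    simp only [snd_pair, LinearMap.comp_assoc, snd_pair_comp, LinearMap.add_comp]
    erw [fst_pair_comp]
    simp [LinearMap.comp_assoc, add_comm]
  have h₂ : (idq n ⊠ codel : Q k (n + 0) (n + 1)) ⨟ (F (pair LinearMap.id u) ⊠ idq 1) =
      F (pair LinearMap.id u) ⨟ (idq (n + 1) ⊠ codel : Q k (n + 1 + 0) (n + 1 + 1)) := by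
    have h₃ := interchange (F (pair LinearMap.id u)) (idq (n + 1)) (idq 0) codel
    rw [tensor_id_zero] at h₃
    rw [← interchange, ← h₃]
    simp
  have h₄ : (idq (n + 1) ⊠ codel : Q k (n + 1 + 0) (n + 1 + 1)) ⨟ cst (Nat.add_assoc n 1 1) =
      (idq n ⊠ (idq 1 ⊠ codel : Q k (1 + 0) (1 + 1)) : Q k (n + (1 + 0)) (n + (1 + 1))) := by
    rw [← idq_tensor_idq, tensor_assoc]
    simp only [compq_assoc]
    rw [cst_cst, cst_rfl]
    exact (idq_comp _).trans (comp_idq _)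
  have h₅ : F (pair LinearMap.id u) ⨟ (idq n ⊠ del : Q k (n + 1) (n + 0)) = idq n := by
    rw [← F_del 0, ← F_id, F_tensor, F_comp]
    refine congrArg F (pair_ext (B := LinearMap.id) ?_ (lin_zero_ext _ _))
    rw [blk_eq, fst_pair_comp]
    simp
    rfl
  rw [ex, ex, wp, wp, sub, h, ← compq_assoc, ← compq_assoc, ← compq_assoc, h₂,
    compq_assoc _ _ (cst _)]
  rw [h₄, compq_assoc _ _ (idq n ⊠ add), ← tensor_comp_right, codel_add, tensor_comp_right,
    ← compq_assoc, h₅]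
  exact congrArg (fun x => x ⨟ f) (idq_comp _)

theorem ex_guard_snd_cozero {n p : ℕ} (g : Q k n p) :
    ex (guard (sub (fst n 1) g) (sub (snd n 1) cozero)) = g := by
  rw [← tensor_eq_guard, ex, wp, ← interchange, idq_comp, ax_codelete_cozero, tensor_id_zero]

/-- The one-point rule. Translating the bound variable by `u` turns the equation `y = u x` into `y =
0`, where `guard_snd_cozero` applies. -/
theorem ex_guard_eqv {n p : ℕ} (u : Lin k n 1) (f : Q k (n + 1) p) :
    ex (guard f (eqv (snd n 1) (u ∘ₗ fst n 1))) = sub (pair LinearMap.id u) f := by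
  rw [← ex_shear u, sub_guard, sub_eqv, eqv]
  have h : snd n 1 ∘ₗ pair (fst n 1) (snd n 1 + u ∘ₗ fst n 1) -
      (u ∘ₗ fst n 1) ∘ₗ pair (fst n 1) (snd n 1 + u ∘ₗ fst n 1) = snd n 1 := by
    rw [LinearMap.comp_assoc, fst_pair, snd_pair, add_sub_cancel_right]
  have h₂ : pair (fst n 1) (snd n 1 + u ∘ₗ fst n 1) ∘ₗ pair (fst n 1) 0 =
      pair LinearMap.id u ∘ₗ fst n 1 := by
    simp [LinearMap.add_comp, LinearMap.comp_assoc]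
  rw [h, guard_snd_cozero, sub_sub, h₂, ← sub_sub, ex_guard_snd_cozero]

end IHP

namespace IHP

variable {k : Type u} [Field k]

theorem lin_one_ext {n : ℕ} {A B : Lin k n 1} (h : ∀ v, A v 0 = B v 0) : A = B :=
  LinearMap.ext fun v => funext fun i => by rw [Subsingleton.elim i 0, h]

theorem neg_one_smul_lin {n : ℕ} (u : Lin k n 1) : (-1 : k) • u = -u :=
  lin_one_ext fun x => by
    change (-1 : k) * u x 0 = -(u x 0)
    ring

theorem exists_coeff {n : ℕ} (u : Lin k (n + 1) 1) :
    ∃ (c : k) (u₀ : Lin k n 1), u = u₀ ∘ₗ fst n 1 + c • snd n 1 := by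
  refine ⟨u (Fin.append 0 1) 0, u ∘ₗ pair LinearMap.id 0, lin_one_ext fun v => ?_⟩
  have h : v = pair LinearMap.id 0 (fst n 1 v) + v (Fin.last n) • Fin.append 0 1 := by
    funext i
    induction i using Fin.addCases with
    | left i => simp [pair_apply, fst, LinearMap.funLeft]
    | right i =>
      rw [Subsingleton.elim i 0]
      simp [pair_apply]
      rfl
  conv_lhs => rw [h, map_add, map_smul]
  change _ + v (Fin.last n) * u (Fin.append 0 1) 0 = _ + u (Fin.append 0 1) 0 * v (Fin.last n)
  rw [mul_comm]
  rfl

variable [LinearOrder k]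

/-! ### Relations of one variable with another -/

theorem guard_fst_eq (e : Q k (1 + 1) 0) :
    guard (F (fst 1 1)) e = (copy ⊠ idq 1 : Q k (1 + 1) (2 + 1)) ⨟ (idq 1 ⊠ e : Q k (1 + 2) (1 + 0)) := by
  have h : F (dup 2) ⨟ (F (fst 1 1) ⊠ idq 2) = (copy ⊠ idq 1 : Q k (1 + 1) (2 + 1)) := by
    rw [← F_dup_one, ← F_id, ← F_id, F_tensor, F_tensor, F_comp]
    refine congrArg F (LinearMap.ext fun v => funext fun i => ?_)
    fin_cases i <;> rfl
  have h₂ := interchange (F (fst 1 1)) (idq 1) (idq 2) e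
  rw [idq_comp, comp_idq] at h₂
  exact (congrArg _ h₂).trans ((compq_assoc _ _ _).symm.trans (congrArg (fun x => x ⨟ _) h))

theorem cocopy_eq : cocopy = guard (F (fst 1 1)) (cap : Q k 2 0) := by
  have h₂ := congrArg (fun x => x ⨟ (idq 1 ⊠ del : Q k (1 + 1) (1 + 0))) (ax_copy_frob_left (k := k))
  simp only [compq_assoc, ← tensor_comp_right] at h₂
  rw [copy_counit_right, comp_idq] at h₂
  exact h₂.symm.trans (guard_fst_eq cap).symm

theorem wp_codel {l p : ℕ} (f : Q k (l + 1 + 1) p) :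
    wp (l := l) (idq 1 ⊠ codel : Q k (1 + 0) (1 + 1)) f = ex f := by
  rw [ex, wp, wp, ← idq_tensor_idq, tensor_assoc, cst_rfl, cst_rfl]
  exact congrArg (fun x => x ⨟ f) ((comp_idq _).trans (idq_comp _)).symm

theorem wp_coadd {l p : ℕ} (f : Q k (l + 2) p) :
    wp coadd f = ex (sub (pair (fst l 2) (pair (fst 1 1 - snd 1 1) (snd 1 1) ∘ₗ snd l 2)) f) := by
  rw [coadd_eq, wp_comp]
  exact (wp_codel _).trans (congrArg ex (wp_F _ f))

/-- The relation with given graph. -/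
noncomputable def rel (e : Q k (1 + 1) 0) : Q k 1 1 := ex (guard (F (snd 1 1)) e)

theorem wp_rel {l p : ℕ} (e : Q k (1 + 1) 0) (f : Q k (l + 1) p) :
    wp (rel e) f = ex (guard (sub (pair (fst l 1 ∘ₗ fst (l + 1) 1) (snd (l + 1) 1)) f)
      (sub (pair (snd l 1 ∘ₗ fst (l + 1) 1) (snd (l + 1) 1)) e)) := by
  have h : rel e = (idq 1 ⊠ codel : Q k (1 + 0) (1 + 1)) ⨟ guard (F (snd 1 1)) e := rfl
  rw [h, wp_comp]
  refine (wp_codel _).trans (congrArg ex ?_)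
  rw [wp_guard_left, wp_F]
  congr 2
  · exact congrArg (pair _) (lin_one_ext fun v => rfl)
  · refine LinearMap.ext fun v => funext fun i => ?_
    fin_cases i <;> rfl

theorem rel_cap : rel cap = (idq 1 : Q k 1 1) := by
  have h := ex_guard_eqv (k := k) LinearMap.id (F (snd 1 1))
  rw [sub_F, snd_pair, F_id, eqv_comm, LinearMap.id_comp, eqv, ← cap_eq] at h
  exact h

theorem guard_eq_swap {n : ℕ} (f : Q k n 1) (e : Q k n 0) :
    guard f e = F (dup n) ⨟ (e ⊠ f : Q k (n + n) (0 + 1)) := by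
  have h := swap_natural f e
  rw [swap_zero, cst_rfl] at h
  have h' : f ⊠ e = swapq n n ⨟ (e ⊠ f) := (comp_idq _).symm.trans h
  rw [guard, h', ← F_swapL, ← compq_assoc, F_comp, swapL_eq, dup]
  simp

theorem guard_snd_eq (e : Q k (1 + 1) 0) :
    guard (F (snd 1 1)) e = (idq 1 ⊠ copy : Q k (1 + 1) (1 + 2)) ⨟ (e ⊠ idq 1 : Q k (2 + 1) (0 + 1)) := by
  have h : F (dup 2) ⨟ (idq 2 ⊠ F (snd 1 1)) = (idq 1 ⊠ copy : Q k (1 + 1) (1 + 2)) := by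
    rw [← F_dup_one, ← F_id, ← F_id, F_tensor, F_tensor, F_comp]
    refine congrArg F (LinearMap.ext fun v => funext fun i => ?_)
    fin_cases i <;> rfl
  have h₂ := interchange (idq 2) e (F (snd 1 1)) (idq 1)
  rw [idq_comp, comp_idq] at h₂
  exact (guard_eq_swap _ _).trans ((congrArg _ h₂).trans
    ((compq_assoc _ _ _).symm.trans (congrArg (fun x => x ⨟ _) h)))

/-- With `rel_cap`, this recovers a circuit on one wire from its graph; it is applied to `geq`. -/
theorem comp_rel (c : Q k 1 1) (e : Q k (1 + 1) 0) : c ⨟ rel e = rel ((c ⊠ idq 1) ⨟ e) := by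
  have h : ∀ e : Q k (1 + 1) 0, rel e = (idq 1 ⊠ codel : Q k (1 + 0) (1 + 1)) ⨟
    ((idq 1 ⊠ copy : Q k (1 + 1) (1 + 2)) ⨟ (e ⊠ idq 1 : Q k (2 + 1) (0 + 1))) :=
    fun e => congrArg _ (guard_snd_eq e)
  have h₁ : c ⨟ (idq 1 ⊠ codel : Q k (1 + 0) (1 + 1)) = (idq 1 ⊠ codel) ⨟ (c ⊠ idq 1) := by
    have h₃ := interchange c (idq 1) (idq 0) codel
    rw [tensor_id_zero] at h₃
    rw [← interchange, ← h₃]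
    simp
  have h₂ : (c ⊠ idq 1 : Q k (1 + 1) (1 + 1)) ⨟ (idq 1 ⊠ copy : Q k (1 + 1) (1 + 2)) =
      (idq 1 ⊠ copy) ⨟ ((c ⊠ idq 1) ⊠ idq 1 : Q k (1 + 1 + 1) (1 + 1 + 1)) := by
    rw [tensor_assoc, idq_tensor_idq]
    refine Eq.trans ?_ (congrArg _ ((comp_idq (idq 3 ⨟ _)).trans (idq_comp _)).symm)
    exact (interchange c (idq 1) (idq 1) copy).symm.trans
      ((congrArg₂ _ ((comp_idq c).trans (idq_comp c).symm)
        ((idq_comp copy).trans (comp_idq copy).symm)).trans (interchange (idq 1) c copy (idq 2)))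
  rw [h, h, ← compq_assoc, h₁, compq_assoc, ← compq_assoc (c ⊠ idq 1), h₂, compq_assoc]
  congr 2
  rw [tensor_comp_left]

/-- The condition that one variable is at least another one. -/
def geE : Q k (1 + 1) 0 := (geq ⊠ idq 1 : Q k (1 + 1) (1 + 1)) ⨟ cap

theorem geq_eq_rel : geq = rel (geE : Q k (1 + 1) 0) := by
  rw [geE, ← comp_rel, rel_cap, comp_idq]

theorem leq_eq_rel : leq = rel (sub (pair (snd 1 1) (fst 1 1)) (geE : Q k (1 + 1) 0)) := by
  have h : leq = (codel ⊠ idq 1 : Q k (0 + 1) (1 + 1)) ⨟ guard (F (fst 1 1)) (geE : Q k (1 + 1) 0) := by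
    have h₁ : (idq 1 ⊠ geq ⊠ idq 1 : Q k (1 + 1 + 1) (1 + 1 + 1)) =
        (idq 1 ⊠ (geq ⊠ idq 1 : Q k (1 + 1) (1 + 1)) : Q k (1 + (1 + 1)) (1 + (1 + 1))) := by
      rw [tensor_assoc]
      exact (comp_idq _).trans (idq_comp _)
    have h₂ : (leq : Q k 1 1) = (cup ⊠ idq 1 : Q k (0 + 1) (2 + 1)) ⨟
      (idq 1 ⊠ geq ⊠ idq 1 : Q k (1 + 1 + 1) (1 + 1 + 1)) ⨟
        (idq 1 ⊠ cap : Q k (1 + 2) (1 + 0)) := rfl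
    have h₃ : (cup : Q k 0 2) = codel ⨟ copy := rfl
    rw [guard_fst_eq, h₂, h₁, h₃, tensor_comp_left, geE, tensor_comp_right, compq_assoc,
      compq_assoc]
  have h₂ : (codel ⊠ idq 1 : Q k (0 + 1) (1 + 1)) = (idq 1 ⊠ codel : Q k (1 + 0) (1 + 1)) ⨟
      F (pair (snd 1 1) (fst 1 1)) := by
    rw [← swapL_eq, F_swapL, swap_natural, swap_zero, cst_rfl]
    exact (idq_comp _).symm
  have h₃ := sub_guard (pair (snd 1 1) (fst 1 1)) (F (fst 1 1)) (geE : Q k (1 + 1) 0)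
  rw [sub_F, fst_pair] at h₃
  rw [rel, ← h₃, h, h₂, compq_assoc]
  rfl

end IHP

namespace IHP

variable {k : Type u} [Field k] [LinearOrder k]

/-! ### The order -/

/-- The condition `u ≥ v` on linear forms. -/
noncomputable def gm {n : ℕ} (u v : Lin k n 1) : Q k n 0 := sub (pair u v) geE

@[simp] theorem sub_gm {n m : ℕ} (A : Lin k n m) (u v : Lin k m 1) :
    sub A (gm u v) = gm (u ∘ₗ A) (v ∘ₗ A) := by
  rw [gm, gm, sub_sub, pair_comp]

theorem wp_geq {l : ℕ} (f : Q k (l + 1) 0) :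
    wp geq f = ex (sub (pair (fst l 1 ∘ₗ fst (l + 1) 1) (snd (l + 1) 1)) f *
      gm (snd l 1 ∘ₗ fst (l + 1) 1) (snd (l + 1) 1)) := by
  rw [geq_eq_rel, wp_rel]; rfl

theorem wp_leq {l : ℕ} (f : Q k (l + 1) 0) :
    wp leq f = ex (sub (pair (fst l 1 ∘ₗ fst (l + 1) 1) (snd (l + 1) 1)) f *
      gm (snd (l + 1) 1) (snd l 1 ∘ₗ fst (l + 1) 1)) := by
  rw [leq_eq_rel, wp_rel, sub_sub, pair_comp, fst_pair, snd_pair]; rfl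

/-- The one-point rule removes the quantifier produced by `geq` when its output is pinned to a form
in the parameters. -/
theorem wp_geq_eqv {l : ℕ} (g : Q k (l + 1) 0) (u : Lin k l 1) :
    wp geq (g * eqv (snd l 1) (u ∘ₗ fst l 1)) =
      sub (pair (fst l 1) (u ∘ₗ fst l 1)) g * gm (snd l 1) (u ∘ₗ fst l 1) := by
  rw [wp_geq, sub_mul, sub_eqv, snd_pair, LinearMap.comp_assoc, fst_pair, mul_right_comm,
    ← LinearMap.comp_assoc, mul_def, ex_guard_eqv, sub_mul, sub_sub, sub_gm, pair_comp]
  simp [LinearMap.comp_assoc]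

theorem wp_leq_eqv {l : ℕ} (g : Q k (l + 1) 0) (u : Lin k l 1) :
    wp leq (g * eqv (snd l 1) (u ∘ₗ fst l 1)) =
      sub (pair (fst l 1) (u ∘ₗ fst l 1)) g * gm (u ∘ₗ fst l 1) (snd l 1) := by
  rw [wp_leq, sub_mul, sub_eqv, snd_pair, LinearMap.comp_assoc, fst_pair, mul_right_comm,
    ← LinearMap.comp_assoc, mul_def, ex_guard_eqv, sub_mul, sub_sub, sub_gm, pair_comp]
  simp [LinearMap.comp_assoc]

theorem wp_sc {l p : ℕ} (r : k) (f : Q k (l + 1) p) :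
    wp (sc r) f = sub (pair (fst l 1) (r • snd l 1)) f := by
  rw [← F_sc, wp_F]; rfl

theorem wp_del {l p : ℕ} (f : Q k l p) : wp (l := l) (m := 0) del f = sub (fst l 1) f := by
  rw [← F_del 0, wp_F]
  exact congrArg (fun A => sub A f) (pair_ext (n := l + 1) (m := l) (m' := 0) (fst_pair _ _) (lin_zero_ext _ _))

theorem eqv_smul {n : ℕ} {r : k} (hr : r ≠ 0) (u v : Lin k n 1) :
    eqv (r • u) (r • v) = eqv u v := by
  rw [eqv, eqv, ← sub_smul_cozero hr (u - v), smul_sub]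

/-- Invariance of the quantifier under rescaling of the bound variable, used below with `r = -1` to
reverse inequalities. -/
theorem ex_smul {n p : ℕ} {r : k} (hr : r ≠ 0) (f : Q k (n + 1) p) :
    ex (sub (pair (fst n 1) (r • snd n 1)) f) = ex f := by
  have h := ax_codelete_coscalar r⁻¹
  rw [cosc_eq (inv_ne_zero hr), inv_inv] at h
  rw [← wp_sc, ex, ← wp_comp (l := n), h, ex]

theorem ex_eqv {n : ℕ} (u : Lin k n 1) : ex (eqv (snd n 1) (u ∘ₗ fst n 1)) = 1 := by
  have h := ex_guard_eqv u (1 : Q k (n + 1) 0)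
  rwa [← mul_def, one_mul, sub_one] at h

theorem ex_gm_left {n : ℕ} (u : Lin k n 1) : ex (gm (u ∘ₗ fst n 1) (snd n 1)) = 1 := by
  have h : wp geq (1 : Q k (n + 1) 0) = 1 := by
    have h₁ : (1 : Q k (n + 1) 0) = F (0 : Lin k n 0) ⊠ del := by
      rw [← F_del 0, F_tensor]; exact F_eq_one _ _
    rw [h₁, wp, ← interchange, idq_comp]
    exact congrArg _ (cls_eq_of_geq .geq_delete)
  rw [wp_geq, sub_one, one_mul] at h
  have h₂ := congrArg (sub (pair LinearMap.id u)) h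
  rw [sub_one, sub_ex, sub_gm] at h₂
  simpa [LinearMap.comp_assoc] using h₂

/-- Any two forms have a common upper bound, which is what the axiom on `≤ ; ≥` expresses. -/
theorem direction {n : ℕ} (u v : Lin k n 1) :
    ex (gm (snd n 1) (u ∘ₗ fst n 1) * gm (snd n 1) (v ∘ₗ fst n 1)) = 1 := by
  have h : leq ⨟ geq = (del ⨟ codel : Q k 1 1) := cls_eq_of_geq .direction
  -- Testing both sides against "the output equals the parameter" turns an equation of circuits into
  -- one of formulas in input and output. The factor `1` only matches the shape `g * eqv` of
  -- `wp_geq_eqv`.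
  have h₂ := congrArg (fun c => wp (l := 1) c (1 * eqv (snd 1 1) (LinearMap.id ∘ₗ fst 1 1))) h
  simp only [wp_comp, wp_geq_eqv] at h₂
  rw [wp_leq] at h₂
  have h₃ := ex_eqv (k := k) (LinearMap.id : Lin k 1 1)
  rw [ex] at h₃
  rw [one_mul, h₃] at h₂
  have h₄ := h₂.trans (wp_del _)
  have h₅ := congrArg (sub (pair u v)) h₄
  simp only [sub_ex, sub_mul, sub_one, sub_gm, one_mul] at h₅
  rw [← h₅]
  exact congrArg ex (congrArg₂ _
    (congrArg₂ _ (lin_one_ext fun _ => rfl) (lin_one_ext fun _ => rfl))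
    (congrArg₂ _ (lin_one_ext fun _ => rfl) (lin_one_ext fun _ => rfl)))

/-- A coordinate form. -/
def co {n : ℕ} (i : Fin n) : Lin k n 1 := LinearMap.funLeft k k fun _ => i

theorem wp_cocopy {l : ℕ} (f : Q k (l + 1) 0) :
    wp cocopy f = sub (pair (fst l 2) (fst 1 1 ∘ₗ snd l 2)) f *
      eqv (snd 1 1 ∘ₗ snd l 2) (fst 1 1 ∘ₗ snd l 2) := by
  rw [cocopy_eq, wp_guard_left, wp_F, eqv_comm, ← sub_eqv, eqv, ← cap_eq]
  rfl

theorem wp_geq_of {l : ℕ} {f g g' : Q k (l + 1) 0} (u : Lin k l 1)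
    (h : f = g * eqv (snd l 1) (u ∘ₗ fst l 1))
    (h' : sub (pair (fst l 1) (u ∘ₗ fst l 1)) g * gm (snd l 1) (u ∘ₗ fst l 1) = g') :
    wp geq f = g' := by
  rw [h, wp_geq_eqv, h']

/-- Naming the intermediate formulas lets each be stated in coordinates, where the index bookkeeping
is settled by reduction. -/
theorem wp_tensor_of {l n m n' m' : ℕ} {c : Q k n m} {d : Q k n' m'} {f : Q k (l + (m + m')) 0}
    {a b r} (h₁ : wp d (sub (castL (Nat.add_assoc l m m')) f) = a)
    (h₂ : wp c (sub (exch l n' m) a) = b)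
    (h₃ : sub (castL (Nat.add_assoc l n n').symm) (sub (exch l n n') b) = r) :
    wp (c ⊠ d) f = r := by
  rw [wp_tensor, h₁, h₂, h₃]

theorem eq_of_eq_mul_comm {n : ℕ} {e a b : Q k n 0} (h : e = b * a) : e = a * b :=
  h.trans (mul_comm _ _)

/-- Coordinates `0, 1` are the prescribed outputs, `2, 3` the inputs, and `4` is the bound value on
the middle wire. The formula is pulled back through the circuit from right to left. -/
theorem spider_left : wp (l := 2) ((geq ⊠ geq : Q k (1 + 1) (1 + 1)) ⨟ cocopy ⨟ copy ⨟ (geq ⊠ geq))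
    (eqv (co 2) (co 0) * eqv (co 3) (co 1)) =
      (ex (gm (co 2) (co 4) * gm (co 3) (co 4) * (gm (co 4) (co 0) * gm (co 4) (co 1))) :
        Q k (2 + 2) 0) := by
  have s₁ : wp (l := 2) (geq ⊠ geq : Q k (1 + 1) (1 + 1)) (eqv (co 2) (co 0) * eqv (co 3) (co 1)) =
      gm (co 2) (co 0) * gm (co 3) (co 1) := by
    refine wp_tensor_of (a := eqv (co 2) (co 0) * gm (co 3) (co 1))
      (b := gm (co 2) (co 1) * gm (co 3) (co 0))
      (wp_geq_of (l := 2 + 1) (co 1) (g := eqv (co 2) (co 0)) ?_ ?_)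
      (wp_geq_of (l := 2 + 1) (co 0) (g := gm (co 2) (co 1)) (eq_of_eq_mul_comm ?_) ?_)
      (eq_of_eq_mul_comm ?_)
    all_goals
      simp only [sub_mul, sub_gm, sub_eqv]
      repeat' first | exact lin_one_ext fun _ => rfl | refine congrArg₂ _ ?_ ?_
  have s₂ : wp (l := 2) copy (gm (co 2) (co 0) * gm (co 3) (co 1)) =
      (gm (co 2) (co 0) * gm (co 2) (co 1) : Q k (2 + 1) 0) := by
    rw [← F_dup_one, wp_F]
    simp only [sub_mul, sub_gm]
    repeat' first | exact lin_one_ext fun _ => rfl | refine congrArg₂ _ ?_ ?_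
  have s₃ : wp (l := 2) cocopy (gm (co 2) (co 0) * gm (co 2) (co 1)) =
      (gm (co 2) (co 0) * gm (co 2) (co 1) * eqv (co 3) (co 2) : Q k (2 + 2) 0) := by
    rw [wp_cocopy]
    simp only [sub_mul, sub_gm]
    repeat' first | exact lin_one_ext fun _ => rfl | refine congrArg₂ _ ?_ ?_
  have s₄ : wp (l := 2) (geq ⊠ geq : Q k (1 + 1) (1 + 1))
      (gm (co 2) (co 0) * gm (co 2) (co 1) * eqv (co 3) (co 2)) =
      (ex (gm (co 4) (co 0) * gm (co 4) (co 1) * gm (co 3) (co 4) * gm (co 2) (co 4)) :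
        Q k (2 + 2) 0) := by
    refine wp_tensor_of (a := gm (co 2) (co 0) * gm (co 2) (co 1) * gm (co 3) (co 2))
      (b := ex (gm (co 4) (co 0) * gm (co 4) (co 1) * gm (co 2) (co 4) * gm (co 3) (co 4)))
      (wp_geq_of (l := 2 + 1) (co 2) (g := gm (co 2) (co 0) * gm (co 2) (co 1)) ?_ ?_)
      ((wp_geq _).trans ?_) ?_
    all_goals
      simp only [sub_ex, sub_mul, sub_gm, sub_eqv]
      repeat' first | exact lin_one_ext fun _ => rfl | refine congrArg ex ?_ | refine congrArg₂ _ ?_ ?_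
  rw [wp_comp, wp_comp, wp_comp, s₁, s₂, s₃, s₄]
  refine congrArg ex ?_
  rw [mul_assoc, mul_comm, mul_comm (gm (co 3) _)]

theorem spider_right : wp (l := 2) ((copy ⊠ copy) ⨟ (geq ⊠ geq ⊠ geq ⊠ geq :
      Q k (1 + 1 + 1 + 1) (1 + 1 + 1 + 1)) ⨟
      (idq 1 ⊠ swapq 1 1 ⊠ idq 1 : Q k (1 + (1 + 1) + 1) (1 + (1 + 1) + 1)) ⨟
      (cocopy ⊠ cocopy : Q k (2 + 2) (1 + 1)))
    (eqv (co 2) (co 0) * eqv (co 3) (co 1)) =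
      (gm (co 2) (co 0) * gm (co 2) (co 1) * (gm (co 3) (co 0) * gm (co 3) (co 1)) :
        Q k (2 + 2) 0) := by
  have t₁ : wp (l := 2) (cocopy ⊠ cocopy : Q k (2 + 2) (1 + 1))
      (eqv (co 2) (co 0) * eqv (co 3) (co 1)) =
      eqv (co 2) (co 0) * eqv (co 4) (co 1) * eqv (co 5) (co 4) * eqv (co 3) (co 2) := by
    refine wp_tensor_of (a := eqv (co 2) (co 0) * eqv (co 3) (co 1) * eqv (co 4) (co 3))
      (b := eqv (co 4) (co 0) * eqv (co 2) (co 1) * eqv (co 3) (co 2) * eqv (co 5) (co 4))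
      ((wp_cocopy _).trans ?_) ((wp_cocopy _).trans ?_) ?_
    all_goals
      simp only [sub_mul, sub_eqv]
      repeat' first | exact lin_one_ext fun _ => rfl | refine congrArg₂ _ ?_ ?_
  have t₂ : wp (l := 2) (idq 1 ⊠ swapq 1 1 ⊠ idq 1 : Q k (1 + (1 + 1) + 1) (1 + (1 + 1) + 1))
      (eqv (co 2) (co 0) * eqv (co 4) (co 1) * eqv (co 5) (co 4) * eqv (co 3) (co 2)) =
      eqv (co 2) (co 0) * eqv (co 3) (co 1) * eqv (co 5) (co 3) * eqv (co 4) (co 2) := by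
    rw [← F_id, ← F_swapL, F_tensor, F_tensor, wp_F]
    simp only [sub_mul, sub_eqv]
    repeat' first | exact lin_one_ext fun _ => rfl | refine congrArg₂ _ ?_ ?_
  have t₃ : wp (l := 2) (geq ⊠ geq ⊠ geq ⊠ geq : Q k (1 + 1 + 1 + 1) (1 + 1 + 1 + 1))
      (eqv (co 2) (co 0) * eqv (co 3) (co 1) * eqv (co 5) (co 3) * eqv (co 4) (co 2)) =
      gm (co 2) (co 0) * gm (co 3) (co 1) * gm (co 5) (co 1) * gm (co 4) (co 0) := by
    -- Each `wp_geq_of` consumes an equation standing last; `p₁` and `p₂` move it there, and `p₃`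
    -- restores the final order.
    have p₁ (a b c d : Q k (2 + 1 + 3) 0) : a * b * c * d = a * c * d * b := by ac_rfl
    have p₂ (a b c d : Q k (2 + 1 + 3) 0) : a * b * c * d = b * c * d * a := by ac_rfl
    have p₃ (a b c d : Q k (2 + 1 + 3) 0) : a * b * c * d = d * c * a * b := by ac_rfl
    rw [mul_right_comm]
    refine wp_tensor_of (a := eqv (co 2) (co 0) * eqv (co 3) (co 1) * eqv (co 4) (co 2) *
        gm (co 5) (co 3))
      (b := gm (co 2) (co 1) * gm (co 5) (co 0) * gm (co 4) (co 1) * gm (co 3) (co 0))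
      (wp_geq_of (l := 2 + 3) (co 3)
        (g := eqv (co 2) (co 0) * eqv (co 3) (co 1) * eqv (co 4) (co 2)) ?_ ?_)
      ((congrArg (wp _) (congrArg (sub _) (mul_right_comm _ _ _))).trans
        (wp_tensor_of (l := 2 + 1) (n := 2) (m := 2)
          (a := eqv (co 3) (co 0) * eqv (co 4) (co 1) * gm (co 2) (co 4) * gm (co 5) (co 3))
          (b := gm (co 2) (co 1) * gm (co 3) (co 0) * gm (co 5) (co 1) * gm (co 4) (co 0))
        (wp_geq_of (l := 2 + 1 + 2) (co 3)
          (g := eqv (co 3) (co 0) * eqv (co 4) (co 1) * gm (co 2) (co 4)) ?_ ?_)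
        ((congrArg (wp _) (congrArg (sub _) (p₁ _ _ _ _))).trans
          (wp_tensor_of (l := 2 + 1 + 1) (n := 1) (m := 1)
            (a := eqv (co 4) (co 0) * gm (co 2) (co 1) * gm (co 3) (co 4) * gm (co 5) (co 1))
            (b := gm (co 2) (co 1) * gm (co 3) (co 0) * gm (co 4) (co 1) * gm (co 5) (co 0))
            (wp_geq_of (l := 2 + 1 + 1 + 1) (co 1)
              (g := eqv (co 4) (co 0) * gm (co 2) (co 5) * gm (co 3) (co 4)) ?_ ?_)
            ((congrArg (wp _) (congrArg (sub _) (p₂ _ _ _ _))).trans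
              (wp_geq_of (l := 2 + 1 + 1 + 1) (co 0)
                (g := gm (co 2) (co 1) * gm (co 3) (co 5) * gm (co 4) (co 1)) ?_ ?_)) ?_)) ?_))
      ((congrArg (sub _) (congrArg (sub _) (p₃ _ _ _ _))).trans ?_)
    all_goals
      simp only [sub_mul, sub_gm, sub_eqv]
      repeat' first | exact lin_one_ext fun _ => rfl | refine congrArg₂ _ ?_ ?_
  have t₄ : wp (l := 2) (copy ⊠ copy)
      (gm (co 2) (co 0) * gm (co 3) (co 1) * gm (co 5) (co 1) * gm (co 4) (co 0)) =
      (gm (co 2) (co 0) * gm (co 2) (co 1) * gm (co 3) (co 1) * gm (co 3) (co 0) :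
        Q k (2 + 2) 0) := by
    rw [← F_dup_one, F_tensor, wp_F]
    simp only [sub_mul, sub_gm]
    repeat' first | exact lin_one_ext fun _ => rfl | refine congrArg₂ _ ?_ ?_
  rw [wp_comp, wp_comp, wp_comp, t₁, t₂, t₃, t₄, mul_assoc, mul_comm (gm (co 3) (co 1))]

/-- The interpolation law: a value lies below both `xᵢ` and above both `yⱼ` exactly when all four
comparisons hold. It is the spider axiom read as a formula, and the source of every elimination
step. -/
theorem gm_spider {n : ℕ} (x₁ x₂ y₁ y₂ : Lin k n 1) :
    ex (gm (x₁ ∘ₗ fst n 1) (snd n 1) * gm (x₂ ∘ₗ fst n 1) (snd n 1) *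
      (gm (snd n 1) (y₁ ∘ₗ fst n 1) * gm (snd n 1) (y₂ ∘ₗ fst n 1))) =
      gm x₁ y₁ * gm x₁ y₂ * (gm x₂ y₁ * gm x₂ y₂) := by
  have h : (geq ⊠ geq : Q k (1 + 1) (1 + 1)) ⨟ cocopy ⨟ copy ⨟ (geq ⊠ geq) =
      (copy ⊠ copy) ⨟ (geq ⊠ geq ⊠ geq ⊠ geq : Q k (1 + 1 + 1 + 1) (1 + 1 + 1 + 1)) ⨟
      (idq 1 ⊠ swapq 1 1 ⊠ idq 1 : Q k (1 + (1 + 1) + 1) (1 + (1 + 1) + 1)) ⨟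
      (cocopy ⊠ cocopy : Q k (2 + 2) (1 + 1)) := cls_eq_of_geq .spider
  have h₂ := congrArg (fun c => sub (pair (pair y₁ y₂) (pair x₁ x₂))
    (wp (l := 2) c (eqv (co 2) (co 0) * eqv (co 3) (co 1)))) h
  simp only [spider_left, spider_right, sub_ex, sub_mul, sub_gm] at h₂
  refine Eq.trans (congrArg ex ?_) (h₂.trans ?_)
  all_goals
    repeat' first | exact lin_one_ext fun _ => rfl | refine congrArg₂ _ ?_ ?_

variable [IsStrictOrderedRing k]

/-- The axiom for negative scalars at `-1`; it yields dual statements such as `ex_gm_gm` from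
`direction`. -/
theorem gm_neg {n : ℕ} (u v : Lin k n 1) : gm (-v) (-u) = gm u v := by
  have h : sc (-1) ⨟ geq = (leq ⨟ sc (-1) : Q k 1 1) :=
    cls_eq_of_geq (.scalar_neg (-1 : k) (neg_one_lt_zero))
  have h₂ := congrArg (fun c => wp (l := 1) c (1 * eqv (snd 1 1) (LinearMap.id ∘ₗ fst 1 1))) h
  simp only [wp_comp, wp_geq_eqv, wp_sc] at h₂
  rw [sub_one, one_mul, sub_mul, sub_one, sub_gm, sub_eqv, snd_pair, LinearMap.comp_assoc,
    fst_pair] at h₂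
  have h₃ : eqv ((-1 : k) • snd 1 1) (LinearMap.id ∘ₗ fst 1 1) =
    eqv (snd 1 1) ((-LinearMap.id : Lin k 1 1) ∘ₗ fst 1 1) := by
    rw [← eqv_smul (neg_ne_zero.2 one_ne_zero : (-1 : k) ≠ 0)]
    congr 1
    · exact lin_one_ext fun v => by change (-1 : k) * (-1 * v 1) = v 1; ring
    · exact lin_one_ext fun v => by change (-1 : k) * v 0 = - v 0; ring
  rw [h₃, wp_leq_eqv, sub_one, one_mul] at h₂
  have h₄ := congrArg (sub (pair (-u) v)) h₂
  rw [sub_gm, sub_gm] at h₄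
  have e₁ : ((-1 : k) • snd 1 1) ∘ₗ pair (-u) v = -v :=
    lin_one_ext fun x => neg_one_mul (v x 0)
  have e₂ : ((-LinearMap.id : Lin k 1 1) ∘ₗ fst 1 1) ∘ₗ pair (-u) v = u :=
    lin_one_ext fun x => neg_neg (u x 0)
  rwa [e₁, e₂, LinearMap.id_comp, fst_pair, snd_pair] at h₄

theorem ex_gm_right {n : ℕ} (u : Lin k n 1) : ex (gm (snd n 1) (u ∘ₗ fst n 1)) = 1 := by
  rw [← gm_neg, ← ex_gm_left (-u), ← ex_smul (neg_ne_zero.2 one_ne_zero : (-1 : k) ≠ 0) (gm _ (snd n 1)),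
    sub_gm, snd_pair, LinearMap.comp_assoc, fst_pair]
  exact congrArg ex (congrArg₂ _ (lin_one_ext fun x => rfl)
    (lin_one_ext fun x => (neg_one_mul (snd n 1 x 0)).symm))

theorem ex_gm_gm {n : ℕ} (u v : Lin k n 1) :
    ex (gm (u ∘ₗ fst n 1) (snd n 1) * gm (v ∘ₗ fst n 1) (snd n 1)) = 1 := by
  rw [← gm_neg, ← gm_neg (v ∘ₗ _), ← direction (-u) (-v),
    ← ex_smul (neg_ne_zero.2 one_ne_zero : (-1 : k) ≠ 0) (gm (snd n 1) _ * _), sub_mul,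
    sub_gm, sub_gm, snd_pair, LinearMap.comp_assoc, fst_pair, LinearMap.comp_assoc, fst_pair]
  rw [neg_one_smul_lin]
  rfl

/-- Setting `y₂ = y₁` in `gm_spider` would require idempotence, which is not yet known. Instead `y₂`
becomes a new variable and is quantified away: on the left by `ex_gm_left`, on the right by the
existence of a common lower bound. -/
theorem gm_spider_left {n : ℕ} (x₁ x₂ y : Lin k n 1) :
    ex (gm (x₁ ∘ₗ fst n 1) (snd n 1) * gm (x₂ ∘ₗ fst n 1) (snd n 1) *
      gm (snd n 1) (y ∘ₗ fst n 1)) = gm x₁ y * gm x₂ y := by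
  have h := congrArg ex (gm_spider (x₁ ∘ₗ fst n 1) (x₂ ∘ₗ fst n 1) (y ∘ₗ fst n 1) (snd n 1))
  have h₁ : sub (exch n 1 1) (gm ((x₁ ∘ₗ fst n 1) ∘ₗ fst (n + 1) 1) (snd (n + 1) 1) *
      gm ((x₂ ∘ₗ fst n 1) ∘ₗ fst (n + 1) 1) (snd (n + 1) 1) *
      (gm (snd (n + 1) 1) ((y ∘ₗ fst n 1) ∘ₗ fst (n + 1) 1) *
        gm (snd (n + 1) 1) (snd n 1 ∘ₗ fst (n + 1) 1))) =
      sub (fst (n + 1) 1) (gm (x₁ ∘ₗ fst n 1) (snd n 1) * gm (x₂ ∘ₗ fst n 1) (snd n 1) *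
        gm (snd n 1) (y ∘ₗ fst n 1)) * gm (snd n 1 ∘ₗ fst (n + 1) 1) (snd (n + 1) 1) := by
    simp [exch, LinearMap.comp_assoc, mul_assoc]
  have h₂ : gm (x₁ ∘ₗ fst n 1) (y ∘ₗ fst n 1) * gm (x₁ ∘ₗ fst n 1) (snd n 1) *
      (gm (x₂ ∘ₗ fst n 1) (y ∘ₗ fst n 1) * gm (x₂ ∘ₗ fst n 1) (snd n 1)) =
      sub (fst n 1) (gm x₁ y * gm x₂ y) *
        (gm (x₁ ∘ₗ fst n 1) (snd n 1) * gm (x₂ ∘ₗ fst n 1) (snd n 1)) := by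
    rw [sub_mul, sub_gm, sub_gm, mul_mul_mul_comm]
  rwa [← ex_exch, h₁, ex_mul', ex_gm_left, mul_one, h₂, ex_mul', ex_gm_gm, mul_one] at h

/-- The same device as in `gm_spider_left`, now quantifying away `x₂` with `ex_gm_right`. -/
theorem gm_trans {n : ℕ} (u v : Lin k n 1) :
    ex (gm (u ∘ₗ fst n 1) (snd n 1) * gm (snd n 1) (v ∘ₗ fst n 1)) = gm u v := by
  have h := congrArg ex (gm_spider_left (u ∘ₗ fst n 1) (snd n 1) (v ∘ₗ fst n 1))
  have h₁ : sub (exch n 1 1) (gm ((u ∘ₗ fst n 1) ∘ₗ fst (n + 1) 1) (snd (n + 1) 1) *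
      gm (snd n 1 ∘ₗ fst (n + 1) 1) (snd (n + 1) 1) *
      gm (snd (n + 1) 1) ((v ∘ₗ fst n 1) ∘ₗ fst (n + 1) 1)) =
      sub (fst (n + 1) 1) (gm (u ∘ₗ fst n 1) (snd n 1) * gm (snd n 1) (v ∘ₗ fst n 1)) *
        gm (snd (n + 1) 1) (snd n 1 ∘ₗ fst (n + 1) 1) := by
    simp [exch, LinearMap.comp_assoc, mul_right_comm]
  rwa [← ex_exch, h₁, ex_mul', ex_gm_right, mul_one, ← sub_gm, ex_mul', ex_gm_right,
    mul_one] at h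

end IHP

namespace IHP

variable {k : Type u} [Field k] [LinearOrder k]

/-! ### Half-spaces -/

theorem wp_geq_geq_add : wp (l := 1) ((geq ⊠ geq : Q k (1 + 1) (1 + 1)) ⨟ add)
    (1 * eqv (snd 1 1) (LinearMap.id ∘ₗ fst 1 1)) =
      (ex (gm (co 2) (co 0 - co 3) * gm (co 1) (co 3)) : Q k (1 + 2) 0) := by
  rw [wp_comp, ← F_add, wp_F]
  refine wp_tensor_of (a := 1 * gm (co 2) (co 0 - co 1))
    (b := ex (gm (co 1) (co 0 - co 3) * gm (co 2) (co 3)))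
    (wp_geq_of (l := 1 + 1) (co 0 - co 1) (g := 1) ?_ ?_)
    ((wp_geq _).trans ?_) ?_
  · rw [sub_mul, sub_one, sub_mul, sub_one, sub_eqv, sub_eqv, eqv, eqv]
    refine congrArg _ (congrArg (fun A => sub A cozero) (lin_one_ext fun v => ?_))
    change v 1 + v 2 - v 0 = v 2 - (v 0 - v 1)
    ring
  all_goals
    simp only [one_mul, sub_ex, sub_one, sub_mul, sub_gm]
    repeat' first
      | exact lin_one_ext fun _ => rfl
      | refine congrArg ex ?_
      | refine congrArg₂ _ ?_ ?_

theorem ex_comp {n p q : ℕ} (f : Q k (n + 1) p) (g : Q k p q) : ex f ⨟ g = ex (f ⨟ g) := by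
  rw [ex, wp, compq_assoc]; rfl

theorem eqv_zero {n : ℕ} (u : Lin k n 1) : eqv u 0 = sub u cozero := by rw [eqv, sub_zero]

theorem geq_cozero : geq ⨟ cozero = gm LinearMap.id (0 : Lin k 1 1) := by
  have h := ex_guard_eqv (k := k) (0 : Lin k 1 1) geE
  rw [← mul_def, mul_comm, LinearMap.zero_comp, eqv_zero] at h
  rw [geq_eq_rel, rel, ex_comp, ← guard_comp]
  exact h

theorem leq_cozero : leq ⨟ cozero = gm (0 : Lin k 1 1) LinearMap.id := by
  have h := ex_guard_eqv (k := k) (0 : Lin k 1 1) (sub (pair (snd 1 1) (fst 1 1)) geE)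
  rw [← mul_def, mul_comm, LinearMap.zero_comp, eqv_zero, sub_sub, pair_comp, snd_pair,
    fst_pair] at h
  rw [leq_eq_rel, rel, ex_comp, ← guard_comp]
  exact h

theorem copy_comp_tensor (e e' : Q k 1 0) : copy ⨟ (e ⊠ e' : Q k (1 + 1) (0 + 0)) = e * e' := by
  rw [mul_def, guard, F_dup_one]

/-- Copying and then merging is the identity, and `cocopy ; cozero` is two copies of `cozero`. -/
theorem cozero_mul_self : (cozero : Q k 1 0) * cozero = cozero := by
  have h : copy ⨟ cocopy = (idq 1 : Q k 1 1) := cls_eq_of_ax .copy_special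
  have h₂ := copy_comp_tensor (k := k) cozero cozero
  rw [← h₂, ← ax_cocopy_cozero, ← compq_assoc, h, idq_comp]

theorem mul_le_mul_effect {n : ℕ} {e e' f f' : Q k n 0} (h : e ≤ e') (h' : f ≤ f') :
    e * f ≤ e' * f' := by
  rw [mul_def, mul_def, guard, guard]
  exact comp_mono le_rfl (tensor_mono h h')

theorem geq_le_self_mul : (geq : Q k 1 1) ⨟ cozero ≤ (geq ⨟ cozero) * (geq ⨟ cozero) := by
  have h : (geq : Q k 1 1) ⨟ copy ≤ copy ⨟ (geq ⊠ geq : Q k (1 + 1) (1 + 1)) := .geq_le .geq_copy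
  have h₂ := comp_mono h (le_refl (cozero ⊠ cozero : Q k (1 + 1) (0 + 0)))
  rwa [compq_assoc, compq_assoc, ← interchange, copy_comp_tensor, copy_comp_tensor,
    cozero_mul_self] at h₂

theorem del_eq_one : (del : Q k 1 0) = 1 := (F_del 0).symm

theorem geq_cozero_le_one : (geq : Q k 1 1) ⨟ cozero ≤ 1 := by
  have h : (cozero : Q k 1 0) ≤ del := .ih_le .cozero_le_delete
  have h₂ := comp_mono (le_refl (geq : Q k 1 1)) h
  have h₃ : geq ⨟ del = (del : Q k 1 0) := cls_eq_of_geq .geq_delete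
  rwa [h₃, del_eq_one] at h₂

/-- The condition that a linear form is nonnegative. -/
noncomputable def nonneg {n : ℕ} (u : Lin k n 1) : Q k n 0 := gm u 0

@[simp] theorem sub_nonneg_effect {n m : ℕ} (A : Lin k n m) (u : Lin k m 1) :
    sub A (nonneg u) = nonneg (u ∘ₗ A) := sub_gm A u 0

theorem nonneg_eq_sub {n : ℕ} (u : Lin k n 1) : nonneg u = sub u (geq ⨟ cozero) := by
  rw [geq_cozero, sub_gm]; rfl

/-- One inequality holds because the effect lies below `1`, a consequence of `cozero ≤ delete`; the
other is the lax copying axiom for `geq`. -/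
theorem nonneg_mul_self {n : ℕ} (u : Lin k n 1) : nonneg u * nonneg u = nonneg u := by
  rw [nonneg_eq_sub, ← sub_mul]
  congr 1
  refine le_antisymm ?_ geq_le_self_mul
  have h := mul_le_mul_effect (geq_cozero_le_one (k := k)) (le_refl (geq ⨟ cozero))
  rwa [one_mul] at h

theorem nonneg_smul {n : ℕ} {r : k} (hr : 0 < r) (u : Lin k n 1) :
    nonneg (r • u) = nonneg u := by
  have h : sc r ⨟ geq = (geq ⨟ sc r : Q k 1 1) := cls_eq_of_geq (.scalar_pos r hr)
  have h₂ := congrArg (fun c => sub u (c ⨟ cozero)) h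
  simp only [compq_assoc] at h₂
  rw [sc_cozero hr.ne', ← nonneg_eq_sub, ← F_sc, ← sub, sub_sub, ← nonneg_eq_sub] at h₂
  exact h₂

variable [IsStrictOrderedRing k]

/-- The axiom moving `geq` through `add` is tested with inputs `u`, `-v` and output `0`. One side
reads `u - v ≥ 0`; the other asks for `z` with `u ≥ z` and `-v ≥ -z`, which contracts to `u ≥ v` by
`gm_neg` and `gm_trans`. -/
theorem gm_eq_nonneg {n : ℕ} (u v : Lin k n 1) : gm u v = nonneg (u - v) := by
  have h : add ⨟ geq = (geq ⊠ geq : Q k (1 + 1) (1 + 1)) ⨟ (add : Q k 2 1) :=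
    cls_eq_of_geq .add_geq
  have h₂ := congrArg (fun c => sub (pair 0 (pair u (-v)) : Lin k n (1 + 2))
    (wp (l := 1) c (1 * eqv (snd 1 1) (LinearMap.id ∘ₗ fst 1 1)))) h
  simp only [wp_geq_geq_add] at h₂
  rw [wp_comp, wp_geq_eqv, sub_one, one_mul, ← F_add, wp_F, sub_gm, sub_gm, sub_ex, sub_mul,
    sub_gm, sub_gm] at h₂
  rw [← gm_trans]
  refine Eq.trans (congrArg ex ?_) (h₂.symm.trans ?_)
  · rw [mul_comm, ← gm_neg (snd n 1) (v ∘ₗ fst n 1)]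
    refine congrArg₂ _ (congrArg₂ gm (lin_one_ext fun x => ?_) (lin_one_ext fun x => ?_))
      (congrArg₂ gm (lin_one_ext fun _ => rfl) (lin_one_ext fun _ => rfl))
    · rfl
    · change -(snd n 1 x 0) = 0 - snd n 1 x 0
      exact (zero_sub _).symm
  · refine congrArg₂ gm (lin_one_ext fun x => ?_) (lin_one_ext fun x => ?_)
    · change u x 0 + -(v x 0) = u x 0 - v x 0
      exact (sub_eq_add_neg _ _).symm
    · rfl

/-- From left to right, an equation is duplicated and each copy weakened by `cozero ≤ geq ; cozero`.
The converse is the antisymmetry axiom followed by `cozero`. -/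
theorem eqv_eq_nonneg {n : ℕ} (u v : Lin k n 1) : eqv u v = nonneg (u - v) * nonneg (v - u) := by
  have h₁ : (cozero : Q k 1 0) ≤ geq ⨟ cozero := .geq_le .cozero_le
  have h₂ : copy ⨟ (geq ⊠ leq : Q k (1 + 1) (1 + 1)) ⨟ cocopy ≤ (idq 1 : Q k 1 1) :=
    .geq_le .antisymm
  have h₃ := comp_mono h₂ (le_refl cozero)
  rw [idq_comp, compq_assoc, compq_assoc, ax_cocopy_cozero, ← interchange, copy_comp_tensor,
    geq_cozero, leq_cozero, gm_eq_nonneg 0 LinearMap.id] at h₃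
  refine le_antisymm ?_ ?_
  · rw [nonneg_eq_sub, nonneg_eq_sub, eqv]
    conv_lhs => rw [← cozero_mul_self, sub_mul]
    refine mul_le_mul_effect (comp_mono le_rfl h₁) ?_
    change eqv u v ≤ _
    rw [eqv_comm, eqv]
    exact comp_mono le_rfl h₁
  · have h₄ : sub (u - v) _ ≤ sub (u - v) _ := comp_mono (le_refl (F (u - v))) h₃
    rw [sub_mul, sub_gm, sub_nonneg_effect, LinearMap.sub_comp, LinearMap.id_comp] at h₄
    have e : (0 : Lin k 1 1) ∘ₗ (u - v) - (u - v) = v - u := by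
      rw [LinearMap.zero_comp, zero_sub, neg_sub]
    rwa [e] at h₄

end IHP

namespace IHP

variable {k : Type u} [Field k] [LinearOrder k]

/-! ### Elimination of variables -/

/-- Finite conjunctions of linear inequalities. -/
noncomputable def Cone (k : Type u) [Field k] [LinearOrder k] (n : ℕ) : Submonoid (Q k n 0) :=
  Submonoid.closure (Set.range nonneg)

theorem nonneg_mem_cone {n : ℕ} (u : Lin k n 1) : nonneg u ∈ Cone k n :=
  Submonoid.subset_closure ⟨u, rfl⟩

theorem sub_mem_cone {n m : ℕ} (A : Lin k n m) {e : Q k m 0} (he : e ∈ Cone k m) :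
    sub A e ∈ Cone k n := by
  induction he using Submonoid.closure_induction with
  | mem x hx =>
    obtain ⟨u, rfl⟩ := hx
    rw [sub_nonneg_effect]; exact nonneg_mem_cone _
  | one => rw [sub_one]; exact one_mem _
  | mul x y _ _ hx hy => rw [sub_mul]; exact mul_mem hx hy

theorem mul_self_of_mem_cone {n : ℕ} {e : Q k n 0} (he : e ∈ Cone k n) : e * e = e := by
  induction he using Submonoid.closure_induction with
  | mem x hx => obtain ⟨u, rfl⟩ := hx; exact nonneg_mul_self u
  | one => exact one_mul 1
  | mul x y _ _ hx hy => rw [mul_mul_mul_comm, hx, hy]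

/-- Finite conjunctions of upper bounds on the last variable. -/
noncomputable def Upper (k : Type u) [Field k] [LinearOrder k] (n : ℕ) : Submonoid (Q k (n + 1) 0) :=
  Submonoid.closure (Set.range fun u : Lin k n 1 => gm (u ∘ₗ fst n 1) (snd n 1))

/-- Finite conjunctions of lower bounds on the last variable. -/
noncomputable def Lower (k : Type u) [Field k] [LinearOrder k] (n : ℕ) : Submonoid (Q k (n + 1) 0) :=
  Submonoid.closure (Set.range fun u : Lin k n 1 => gm (snd n 1) (u ∘ₗ fst n 1))

/-- Replacement of the last but one variable by the last one. -/
def skip (n : ℕ) : Lin k (n + 1 + 1) (n + 1) := pair (fst n 1 ∘ₗ fst (n + 1) 1) (snd (n + 1) 1)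

/-- If `f y` is `∃ z, f z ∧ r y z`, exchanging quantifiers turns `∃ y, f y ∧ g y` into `∃ z, f z ∧ ∃
y, r y z ∧ g y`. Thus `f` is protected while `y` is eliminated from `r` and `g`, the device that
reduces finite families of bounds to the four-term spider. -/
theorem ex_mul_of_eq_ex {n : ℕ} {f : Q k (n + 1) 0} {r : Q k (n + 1 + 1) 0}
    (h : f = ex (sub (skip n) f * r)) (g : Q k (n + 1) 0) :
    ex (f * g) = ex (f * ex (sub (exch n 1 1) r * sub (skip n) g)) := by
  have h₁ : skip n ∘ₗ exch n 1 1 = (fst (n + 1) 1 : Lin k _ _) := by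
    rw [skip, exch, pair_comp, LinearMap.comp_assoc, fst_pair, fst_pair, snd_pair]
    exact pair_fst_snd_comp _
  have h₂ : fst (n + 1) 1 ∘ₗ exch n 1 1 = (skip n : Lin k _ _) := by
    rw [exch, fst_pair, skip]
  conv_lhs => rw [h, ← ex_mul, ← ex_exch, sub_mul, sub_mul, sub_sub, sub_sub, h₁, h₂, mul_assoc,
    ex_mul']

variable [IsStrictOrderedRing k]

theorem gm_mem_cone {n : ℕ} (u v : Lin k n 1) : gm u v ∈ Cone k n := by
  rw [gm_eq_nonneg]; exact nonneg_mem_cone _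

theorem upper_le_cone (n : ℕ) : Upper k n ≤ Cone k (n + 1) :=
  Submonoid.closure_le.2 (by rintro _ ⟨u, rfl⟩; exact gm_mem_cone _ _)

theorem gm_spider_right {n : ℕ} (x y₁ y₂ : Lin k n 1) :
    ex (gm (x ∘ₗ fst n 1) (snd n 1) *
      (gm (snd n 1) (y₁ ∘ₗ fst n 1) * gm (snd n 1) (y₂ ∘ₗ fst n 1))) = gm x y₁ * gm x y₂ := by
  have h := gm_spider x x y₁ y₂
  rwa [mul_self_of_mem_cone (gm_mem_cone _ _),
    mul_self_of_mem_cone (mul_mem (gm_mem_cone _ _) (gm_mem_cone _ _))] at h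

/-- Induction over the upper bounds, starting from `direction`. The hypothesis for the remaining
bounds, applied with both lower bounds equal to the last variable, shows that they are downward
closed; this is the input of `ex_mul_of_eq_ex`, and `gm_spider` handles the new bound. The freedom
in `A` is needed because that application takes place in a larger context. -/
theorem ex_upper_mul {n : ℕ} {e : Q k (n + 1) 0} (he : e ∈ Upper k n) :
    ∀ {m : ℕ} (A : Lin k m n) (w₁ w₂ : Lin k m 1),
      ex (sub (pair (A ∘ₗ fst m 1) (snd m 1)) e *
        (gm (snd m 1) (w₁ ∘ₗ fst m 1) * gm (snd m 1) (w₂ ∘ₗ fst m 1))) =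
        sub (pair A w₁) e * sub (pair A w₂) e := by
  induction he using Submonoid.closure_induction_left with
  | one => intro m A w₁ w₂; rw [sub_one, sub_one, sub_one, one_mul, one_mul, direction]
  | mul_left x hx y hy ih =>
    obtain ⟨u, rfl⟩ := hx
    intro m A w₁ w₂
    have h : sub (pair (A ∘ₗ fst m 1) (snd m 1)) y =
        ex (sub (skip m) (sub (pair (A ∘ₗ fst m 1) (snd m 1)) y) *
          gm (snd (m + 1) 1) (snd m 1 ∘ₗ fst (m + 1) 1)) := by
      have h₁ := ih (A ∘ₗ fst m 1) (snd m 1) (snd m 1)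
      rw [mul_self_of_mem_cone (gm_mem_cone _ _),
        mul_self_of_mem_cone (sub_mem_cone _ (upper_le_cone _ hy))] at h₁
      rw [sub_sub, pair_comp, LinearMap.comp_assoc, skip, fst_pair, snd_pair]
      exact h₁.symm
    have h₂ : sub (exch m 1 1) (gm (snd (m + 1) 1) (snd m 1 ∘ₗ fst (m + 1) 1)) *
        sub (skip m) (gm ((u ∘ₗ A) ∘ₗ fst m 1) (snd m 1) *
          (gm (snd m 1) (w₁ ∘ₗ fst m 1) * gm (snd m 1) (w₂ ∘ₗ fst m 1))) =
        gm (snd m 1 ∘ₗ fst (m + 1) 1) (snd (m + 1) 1) *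
          gm (((u ∘ₗ A) ∘ₗ fst m 1) ∘ₗ fst (m + 1) 1) (snd (m + 1) 1) *
            (gm (snd (m + 1) 1) ((w₁ ∘ₗ fst m 1) ∘ₗ fst (m + 1) 1) *
              gm (snd (m + 1) 1) ((w₂ ∘ₗ fst m 1) ∘ₗ fst (m + 1) 1)) := by
      simp [skip, exch, LinearMap.comp_assoc, mul_assoc]
    have h₃ : sub (pair (A ∘ₗ fst m 1) (snd m 1)) (gm (u ∘ₗ fst n 1) (snd n 1)) =
        gm ((u ∘ₗ A) ∘ₗ fst m 1) (snd m 1) := by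
      simp [LinearMap.comp_assoc]
    have h₄ : ∀ w, sub (pair A w) (gm (u ∘ₗ fst n 1) (snd n 1)) = gm (u ∘ₗ A) w := fun w => by
      simp [LinearMap.comp_assoc]
    rw [sub_mul, mul_comm (sub _ (gm _ _)), mul_assoc, h₃, ex_mul_of_eq_ex h, h₂, gm_spider,
      ← sub_gm, ← sub_gm (fst m 1) _ w₂, ← sub_mul, ← mul_assoc, ex_mul, ih, sub_mul, sub_mul, h₄,
      h₄, mul_comm, mul_mul_mul_comm]

theorem upper_eq_ex {n : ℕ} {e : Q k (n + 1) 0} (he : e ∈ Upper k n) :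
    e = ex (sub (skip n) e * gm (snd (n + 1) 1) (snd n 1 ∘ₗ fst (n + 1) 1)) := by
  have h := ex_upper_mul he (fst n 1) (snd n 1) (snd n 1)
  rw [mul_self_of_mem_cone (gm_mem_cone _ _),
    mul_self_of_mem_cone (sub_mem_cone _ (upper_le_cone _ he)), pair_fst_snd, sub_id] at h
  exact h.symm

/-- Finitely many upper bounds can be met together: being downward closed, the conditions already
treated absorb a common lower bound supplied by `ex_gm_gm`. -/
theorem ex_upper {n : ℕ} {e : Q k (n + 1) 0} (he : e ∈ Upper k n) : ex e = 1 := by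
  induction he using Submonoid.closure_induction_left with
  | one => exact ex_one n
  | mul_left x hx y hy ih =>
    obtain ⟨u, rfl⟩ := hx
    have h₂ : sub (exch n 1 1) (gm (snd (n + 1) 1) (snd n 1 ∘ₗ fst (n + 1) 1)) *
        sub (skip n) (gm (u ∘ₗ fst n 1) (snd n 1)) =
        gm (snd n 1 ∘ₗ fst (n + 1) 1) (snd (n + 1) 1) *
          gm ((u ∘ₗ fst n 1) ∘ₗ fst (n + 1) 1) (snd (n + 1) 1) := by
      simp [skip, exch, LinearMap.comp_assoc]
    rw [mul_comm, ex_mul_of_eq_ex (upper_eq_ex hy), h₂, ex_gm_gm, mul_one, ih]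

/-- Upward closure of a family of lower bounds. One upper bound `x` suffices, and idempotence now
permits the one-sided spider `gm_spider_right`. -/
theorem ex_mul_lower {n : ℕ} {e : Q k (n + 1) 0} (he : e ∈ Lower k n) :
    ∀ {m : ℕ} (A : Lin k m n) (x : Lin k m 1),
      ex (sub (pair (A ∘ₗ fst m 1) (snd m 1)) e * gm (x ∘ₗ fst m 1) (snd m 1)) =
        sub (pair A x) e := by
  induction he using Submonoid.closure_induction_left with
  | one => intro m A x; rw [sub_one, sub_one, one_mul, ex_gm_left]
  | mul_left e he y hy ih =>
    obtain ⟨w, rfl⟩ := he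
    intro m A x
    have h : sub (pair (A ∘ₗ fst m 1) (snd m 1)) y =
        ex (sub (skip m) (sub (pair (A ∘ₗ fst m 1) (snd m 1)) y) *
          gm (snd m 1 ∘ₗ fst (m + 1) 1) (snd (m + 1) 1)) := by
      have h₁ := ih (A ∘ₗ fst m 1) (snd m 1)
      rw [sub_sub, pair_comp, LinearMap.comp_assoc, skip, fst_pair, snd_pair]
      exact h₁.symm
    have h₂ : sub (exch m 1 1) (gm (snd m 1 ∘ₗ fst (m + 1) 1) (snd (m + 1) 1)) *
        sub (skip m) (gm (snd m 1) ((w ∘ₗ A) ∘ₗ fst m 1) * gm (x ∘ₗ fst m 1) (snd m 1)) =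
        gm ((x ∘ₗ fst m 1) ∘ₗ fst (m + 1) 1) (snd (m + 1) 1) *
          (gm (snd (m + 1) 1) (snd m 1 ∘ₗ fst (m + 1) 1) *
            gm (snd (m + 1) 1) (((w ∘ₗ A) ∘ₗ fst m 1) ∘ₗ fst (m + 1) 1)) := by
      rw [mul_comm (gm (snd m 1) _), sub_mul, mul_left_comm]
      simp [skip, exch, LinearMap.comp_assoc]
    have h₃ : sub (pair (A ∘ₗ fst m 1) (snd m 1)) (gm (snd n 1) (w ∘ₗ fst n 1)) =
        gm (snd m 1) ((w ∘ₗ A) ∘ₗ fst m 1) := by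
      simp [LinearMap.comp_assoc]
    have h₄ : sub (pair A x) (gm (snd n 1) (w ∘ₗ fst n 1)) = gm x (w ∘ₗ A) := by
      simp [LinearMap.comp_assoc]
    rw [sub_mul, mul_comm (sub _ (gm _ _)), mul_assoc, h₃, ex_mul_of_eq_ex h, h₂, gm_spider_right,
      ← sub_gm (fst m 1) x, ← mul_assoc, sub_gm, ← sub_gm (fst m 1) x, ex_mul, ih, sub_mul, h₄,
      mul_comm]

theorem ex_upper_mul_lower_mem {n : ℕ} {e f : Q k (n + 1) 0} (he : e ∈ Upper k n)
    (hf : f ∈ Lower k n) : ex (e * f) ∈ Cone k n := by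
  induction hf using Submonoid.closure_induction_left with
  | one => rw [mul_one, ex_upper he]; exact one_mem _
  | mul_left x hx y hy ih =>
    obtain ⟨w, rfl⟩ := hx
    -- The remaining lower bounds are moved to a smaller value `z`. Eliminating the old variable
    -- above `z` and `w` leaves `e` at `z` and `e` at `w`: the former goes to the induction, the
    -- latter is free of the bound variable.
    have h : y = ex (sub (skip n) y * gm (snd n 1 ∘ₗ fst (n + 1) 1) (snd (n + 1) 1)) := by
      have h := ex_mul_lower hy (fst n 1) (snd n 1)
      rw [pair_fst_snd, sub_id] at h
      exact h.symm
    have h₂ : sub (exch n 1 1) (gm (snd n 1 ∘ₗ fst (n + 1) 1) (snd (n + 1) 1)) *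
        sub (skip n) (e * gm (snd n 1) (w ∘ₗ fst n 1)) =
        sub (skip n) e * (gm (snd (n + 1) 1) (snd n 1 ∘ₗ fst (n + 1) 1) *
          gm (snd (n + 1) 1) ((w ∘ₗ fst n 1) ∘ₗ fst (n + 1) 1)) := by
      rw [sub_mul, mul_left_comm]
      simp [skip, exch, LinearMap.comp_assoc]
    have h₃ : sub (pair (fst n 1) (w ∘ₗ fst n 1)) e =
        sub (fst n 1) (sub (pair LinearMap.id w) e) := by
      rw [sub_sub, pair_comp, LinearMap.id_comp]
    rw [mul_left_comm, ← mul_assoc, mul_comm _ y, mul_comm _ e, ex_mul_of_eq_ex h, h₂, skip,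
      ex_upper_mul he, pair_fst_snd, sub_id, h₃, ← mul_assoc, ex_mul, mul_comm y]
    exact mul_mem ih (sub_mem_cone _ (upper_le_cone _ he))

theorem exists_decomposition {n : ℕ} {e : Q k (n + 1) 0} (he : e ∈ Cone k (n + 1)) :
    ∃ e₀ ∈ Cone k n, ∃ f ∈ Upper k n, ∃ g ∈ Lower k n, e = f * g * sub (fst n 1) e₀ := by
  induction he using Submonoid.closure_induction with
  | mem x hx =>
    obtain ⟨u, rfl⟩ := hx
    obtain ⟨c, u₀, rfl⟩ := exists_coeff u
    -- The sign of the coefficient `c` of the last variable decides between upper bound, no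
    -- condition and lower bound; division by `|c|` is harmless by `nonneg_smul`.
    rcases lt_trichotomy c 0 with hc | rfl | hc
    · refine ⟨1, one_mem _, _, Submonoid.subset_closure ⟨(-c)⁻¹ • u₀, rfl⟩, 1, one_mem _, ?_⟩
      change _ = gm _ _ * 1 * _
      rw [sub_one, mul_one, mul_one, gm_eq_nonneg,
        ← nonneg_smul (inv_pos.2 (neg_pos.2 hc))]
      refine congrArg nonneg (lin_one_ext fun v => ?_)
      have hc' := hc.ne
      change (-c)⁻¹ * (u₀ (fst n 1 v) 0 + c * snd n 1 v 0) =
        (-c)⁻¹ * u₀ (fst n 1 v) 0 - snd n 1 v 0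
      field_simp
      ring
    · refine ⟨nonneg u₀, nonneg_mem_cone _, 1, one_mem _, 1, one_mem _, ?_⟩
      rw [one_mul, one_mul, sub_nonneg_effect]
      refine congrArg nonneg (lin_one_ext fun v => ?_)
      change u₀ (fst n 1 v) 0 + 0 * snd n 1 v 0 = u₀ (fst n 1 v) 0
      ring
    · refine ⟨1, one_mem _, 1, one_mem _, _, Submonoid.subset_closure ⟨(-c⁻¹) • u₀, rfl⟩, ?_⟩
      change _ = 1 * gm _ _ * _
      rw [sub_one, mul_one, one_mul, gm_eq_nonneg, ← nonneg_smul (inv_pos.2 hc)]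
      refine congrArg nonneg (lin_one_ext fun v => ?_)
      have hc' := hc.ne'
      change c⁻¹ * (u₀ (fst n 1 v) 0 + c * snd n 1 v 0) =
        snd n 1 v 0 - (-c⁻¹) * u₀ (fst n 1 v) 0
      field_simp
      ring
  | one => exact ⟨1, one_mem _, 1, one_mem _, 1, one_mem _, by rw [sub_one, one_mul, one_mul]⟩
  | mul x y _ _ hx hy =>
    obtain ⟨e₁, he₁, f₁, hf₁, g₁, hg₁, rfl⟩ := hx
    obtain ⟨e₂, he₂, f₂, hf₂, g₂, hg₂, rfl⟩ := hy
    refine ⟨_, mul_mem he₁ he₂, _, mul_mem hf₁ hf₂, _, mul_mem hg₁ hg₂, ?_⟩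
    rw [sub_mul, mul_mul_mul_comm, mul_mul_mul_comm f₁]

/-- Fourier–Motzkin elimination of one variable. -/
theorem ex_mem_cone {n : ℕ} {e : Q k (n + 1) 0} (he : e ∈ Cone k (n + 1)) :
    ex e ∈ Cone k n := by
  obtain ⟨e₀, he₀, f, hf, g, hg, rfl⟩ := exists_decomposition he
  rw [ex_mul]
  exact mul_mem (ex_upper_mul_lower_mem hf hg) he₀

end IHP

namespace IHP

variable {k : Type u} [Field k] [LinearOrder k]

/-! ### Polyhedral preconditions -/

/-- Circuits that pull back conjunctions of linear inequalities to such conjunctions. -/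
def Preserves {n m : ℕ} (c : Q k n m) : Prop :=
  ∀ (l : ℕ) (f : Q k (l + m) 0), f ∈ Cone k (l + m) → wp c f ∈ Cone k (l + n)

theorem preserves_F {n m : ℕ} (A : Lin k n m) : Preserves (F A) := fun l f hf => by
  rw [wp_F]; exact sub_mem_cone _ hf

theorem Preserves.comp {n m o : ℕ} {c : Q k n m} {d : Q k m o} (hc : Preserves c)
    (hd : Preserves d) : Preserves (c ⨟ d) := fun l f hf => by
  rw [wp_comp]; exact hc l _ (hd l f hf)

theorem Preserves.tensor {n m n' m' : ℕ} {c : Q k n m} {d : Q k n' m'} (hc : Preserves c)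
    (hd : Preserves d) : Preserves (c ⊠ d) := fun l f hf => by
  rw [wp_tensor]
  exact sub_mem_cone _ (sub_mem_cone _ (hc _ _ (sub_mem_cone _ (hd _ _ (sub_mem_cone _ hf)))))

theorem preserves_fwd {n m : ℕ} (g : FwdGen k n m) : Preserves (tcls (.gen (.fwd g))) := by
  have h : tcls (.gen (.fwd g)) = inc (.gen g) := rfl
  rw [h, ← F_fn]
  exact preserves_F _

theorem Preserves.comp_mem {n m : ℕ} {c : Q k n m} (hc : Preserves c) {e : Q k m 0}
    (he : e ∈ Cone k m) : c ⨟ e ∈ Cone k n := by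
  have h₁ : ∀ {a b : ℕ} (h : a = b) {f : Q k b 0}, f ∈ Cone k b → cst h ⨟ f ∈ Cone k a := by
    rintro a _ rfl f hf
    rwa [cst_rfl, idq_comp]
  have h := h₁ (Nat.zero_add n).symm (hc 0 _ (h₁ (Nat.zero_add m) he))
  rw [wp, id_zero_tensor] at h
  simpa only [compq_assoc, cst_cancel_assoc] using h

theorem cozeroN_succ (m : ℕ) : cls (PolyCirc.cozeroN (k := k) (m + 1)) =
    sub (fst m 1) (cls (PolyCirc.cozeroN m)) * sub (snd m 1) cozero :=
  tensor_eq_mul (cls (PolyCirc.cozeroN m)) cozero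

/-- The forms of the inequalities are stacked as the rows of one matrix. -/
theorem exists_matrix {n : ℕ} {e : Q k n 0} (he : e ∈ Cone k n) :
    ∃ (p : ℕ) (M : Lin k n p), e = F M ⨟ cls (PolyCirc.geqN p) ⨟ cls (PolyCirc.cozeroN p) := by
  induction he using Submonoid.closure_induction_left with
  | one => exact ⟨0, 0, ((comp_idq _).trans (comp_idq _)).symm⟩
  | mul_left x hx y hy ih =>
    obtain ⟨u, rfl⟩ := hx
    obtain ⟨p, M, rfl⟩ := ih
    refine ⟨p + 1, pair M u, ?_⟩
    have h : cls (PolyCirc.geqN (p + 1)) ⨟ cls (PolyCirc.cozeroN (p + 1)) =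
        (cls (PolyCirc.geqN p) ⨟ cls (PolyCirc.cozeroN p)) ⊠ (geq ⨟ cozero : Q k 1 0) :=
      (interchange (cls (PolyCirc.geqN p)) (cls (PolyCirc.cozeroN p)) geq cozero).symm
    rw [compq_assoc (F (pair M u)), h, tensor_eq_mul, nonneg_eq_sub, mul_comm, compq_assoc (F M)]
    change _ = sub (pair M u) _
    rw [sub_mul, sub_sub, sub_sub, fst_pair, snd_pair]
    rfl

/-- Existential quantification of the last `m` variables. -/
def exN {n p : ℕ} (m : ℕ) (f : Q k (n + m) p) : Q k n p := wp (l := n) (cls (PolyCirc.codeleteN m)) f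

theorem exN_succ {n p : ℕ} (m : ℕ) (f : Q k (n + (m + 1)) p) : exN (m + 1) f = exN m (ex (n := n + m) f) := by
  have h := interchange (idq n ⊠ cls (PolyCirc.codeleteN m) : Q k (n + 0) (n + m)) (idq (n + m)) (idq 0) codel
  rw [comp_idq, idq_comp, tensor_id_zero, tensor_assoc] at h
  have h₂ : (idq n ⊠ (cls (PolyCirc.codeleteN m) ⊠ codel) : Q k (n + 0) (n + (m + 1))) =
      (idq n ⊠ cls (PolyCirc.codeleteN m) : Q k (n + 0) (n + m)) ⨟
        (idq (n + m) ⊠ codel : Q k (n + m + 0) (n + m + 1)) :=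
    ((comp_idq _).trans (idq_comp _)).symm.trans h
  have h₃ : exN (m + 1) f =
    (idq n ⊠ (cls (PolyCirc.codeleteN m) ⊠ codel) : Q k (n + 0) (n + (m + 1))) ⨟ f := rfl
  rw [h₃, h₂, compq_assoc]
  rfl

/-- The one-point rule for several variables, obtained by eliminating the last coordinate first. -/
theorem exN_guard {n p : ℕ} (m : ℕ) (u : Lin k n m) (f : Q k (n + m) p) :
    exN m (guard f (sub (snd n m - u ∘ₗ fst n m) (cls (PolyCirc.cozeroN m)))) =
      sub (pair LinearMap.id u) f := by
  induction m with
  | zero =>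
    have h : sub (snd n 0 - u ∘ₗ fst n 0) (cls (PolyCirc.cozeroN 0)) = 1 :=
      (comp_idq _).trans (F_eq_one _ _)
    have h₂ : (pair LinearMap.id u : Lin k n (n + 0)) = (LinearMap.id : Lin k n n) :=
      pair_ext (by rw [fst_pair]; rfl) (lin_zero_ext _ _)
    rw [h, guard_one, h₂, sub_id]
    exact (congrArg (fun x => x ⨟ f) (tensor_id_zero (idq n))).trans (idq_comp _)
  | succ m ih =>
    have h₁ : (snd n (m + 1) - u ∘ₗ fst n (m + 1)) = pair
        ((snd n m - (fst m 1 ∘ₗ u) ∘ₗ fst n m) ∘ₗ fst (n + m) 1)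
        (snd (n + m) 1 - ((snd m 1 ∘ₗ u) ∘ₗ fst n m) ∘ₗ fst (n + m) 1) :=
      pair_ext (by rw [fst_pair]; rfl) (by rw [snd_pair]; exact lin_one_ext fun _ => rfl)
    have h₂ : pair LinearMap.id ((snd m 1 ∘ₗ u) ∘ₗ fst n m) ∘ₗ pair LinearMap.id (fst m 1 ∘ₗ u) =
        pair LinearMap.id u := by
      refine pair_ext (pair_ext ?_ ?_) ?_
      · rw [pair_comp, fst_pair, LinearMap.id_comp, fst_pair]
        exact (fst_pair _ u).symm
      · rw [pair_comp, fst_pair, LinearMap.id_comp, snd_pair]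
        exact congrArg (fun A => fst m 1 ∘ₗ A) (snd_pair _ u).symm
      · rw [pair_comp, snd_pair, LinearMap.comp_assoc, fst_pair]
        exact (congrArg (fun A => snd m 1 ∘ₗ A) (snd_pair _ u).symm).trans
          (lin_one_ext fun _ => rfl)
    rw [cozeroN_succ, sub_mul, sub_sub, sub_sub, h₁, fst_pair, snd_pair, exN_succ, ← guard_guard,
      ← eqv, ex_guard_eqv, ← sub_sub, sub_guard, sub_sub, fst_pair, sub_id, ih, sub_sub, h₂]

theorem guard_eq_swap_comp {n p : ℕ} (f : Q k n p) (e : Q k n 0) :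
    guard f e = F (dup n) ⨟ (e ⊠ f) ⨟ cst (Nat.zero_add p) := by
  have h := congrArg (fun x => x ⨟ cst (Nat.zero_add p)) (swap_natural f e)
  simp only [compq_assoc, swap_zero, cst_cst] at h
  have h' : f ⊠ e = swapq n n ⨟ ((e ⊠ f) ⨟ cst (Nat.zero_add p)) := (comp_idq _).symm.trans h
  rw [guard, h', ← F_swapL, ← compq_assoc, F_comp, swapL_eq, dup, compq_assoc]
  simp

theorem guard_snd_eq_swap {n m : ℕ} (e : Q k (n + m) 0) :
    guard (F (snd n m)) e = (idq n ⊠ F (dup m)) ⨟ cst (Nat.add_assoc n m m).symm ⨟ (e ⊠ idq m) ⨟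
      cst (Nat.zero_add m) := by
  have h : F (dup (n + m)) ⨟ (idq (k := k) (n + m) ⊠ F (snd n m)) =
      (idq n ⊠ F (dup m) : Q k _ _) ⨟ cst (Nat.add_assoc n m m).symm := by
    rw [← F_id, ← F_id, F_tensor, F_tensor, ← F_castL, F_comp, F_comp, castL_assoc_symm, blk_eq,
      blk_eq]
    congr 1
    exact pair_ext (pair_ext (by simp [dup]) (by simp [LinearMap.comp_assoc, dup]))
      (by simp [LinearMap.comp_assoc, dup])
  have h₂ := interchange (idq (n + m)) e (F (snd n m)) (idq m)
  rw [idq_comp, comp_idq] at h₂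
  rw [guard_eq_swap_comp, h₂, ← compq_assoc (F _), h]

variable [IsStrictOrderedRing k]

theorem eqv_mem_cone {n : ℕ} (u v : Lin k n 1) : eqv u v ∈ Cone k n := by
  rw [eqv_eq_nonneg]; exact mul_mem (nonneg_mem_cone _) (nonneg_mem_cone _)

theorem preserves_codel : Preserves (codel : Q k 0 1) := fun _ _ hf => ex_mem_cone hf

theorem preserves_cozero : Preserves (cozero : Q k 1 0) := fun l f hf => by
  have h : wp (l := l) cozero f = f ⊠ cozero := (tensor_right_effect f cozero).symm
  rw [h, tensor_eq_mul, ← eqv_zero]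
  exact mul_mem (sub_mem_cone _ hf) (eqv_mem_cone _ _)

theorem preserves_cosc (r : k) : Preserves (cosc r) := by
  by_cases hr : r = 0
  · rw [hr, ax_coscalar_zero]
    exact preserves_cozero.comp preserves_codel
  · rw [cosc_eq hr, ← F_sc]
    exact preserves_F _

theorem preserves_cocopy : Preserves (cocopy : Q k 2 1) := fun l f hf => by
  rw [wp_cocopy]
  exact mul_mem (sub_mem_cone _ hf) (eqv_mem_cone _ _)

theorem preserves_coadd : Preserves (coadd : Q k 1 2) := fun l f hf => by
  rw [wp_coadd]
  exact ex_mem_cone (sub_mem_cone _ hf)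

theorem preserves_geq : Preserves (geq : Q k 1 1) := fun l f hf => by
  rw [wp_geq]
  exact ex_mem_cone (mul_mem (sub_mem_cone _ hf) (gm_mem_cone _ _))

theorem preserves_bwd {n m : ℕ} (g : FwdGen k n m) : Preserves (tcls (.gen (.bwd g))) := by
  cases g with
  | copy => exact preserves_cocopy
  | delete => exact preserves_codel
  | scalar r => exact preserves_cosc r
  | add => exact preserves_coadd
  | zero => exact preserves_cozero

theorem preserves_tcls {n m : ℕ} (t : PTerm (PolyGen k) n m) : Preserves (tcls t) := by
  induction t with
  | gen g =>
    cases g with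
    | fwd g => exact preserves_fwd g
    | bwd g => exact preserves_bwd g
    | geq => exact preserves_geq
  | id n =>
    have h := preserves_F (LinearMap.id : Lin k n n)
    rwa [F_id] at h
  | swap n m =>
    have h := preserves_F (swapL n m : Lin k _ _)
    rwa [F_swapL] at h
  | comp f g hf hg => exact hf.comp hg
  | tensor f g hf hg => exact hf.tensor hg

theorem cozeroN_mem_cone (m : ℕ) : cls (PolyCirc.cozeroN m) ∈ Cone k m := by
  induction m with
  | zero =>
    have h : cls (PolyCirc.cozeroN 0) = (1 : Q k 0 0) := (F_id 0).symm.trans (F_eq_one _ _)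
    rw [h]; exact one_mem _
  | succ m ih =>
    rw [cozeroN_succ, ← eqv_zero]
    exact mul_mem (sub_mem_cone _ ih) (eqv_mem_cone _ _)

end IHP

/-! ### Bending wires and the normal form -/

namespace IHP

variable {k : Type u} [Field k]

theorem castL_add_one {n m : ℕ} (h : n = m) (h' : n + 1 = m + 1) :
    (castL h' : Lin k _ _) = blk (castL h) LinearMap.id := by
  subst h
  rw [castL_rfl, castL_rfl, blk_eq, LinearMap.id_comp, LinearMap.id_comp, pair_fst_snd]

/-- The types `m + m + 2` and `m + (m + 1) + 1` agree by reduction but suggest different block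
divisions. The output is rebracketed here so that the exchange in `dup_succ` can be computed
blockwise. -/
theorem blk_dup_dup_one (m : ℕ) : (blk (dup m) (dup 1) : Lin k (m + 1) (m + m + 2)) =
    (pair (pair (fst m 1) (pair (fst m 1) (snd m 1))) (snd m 1) :
      Lin k (m + 1) (m + (m + 1) + 1)) := by
  let X : Lin k (m + 1) (m + (m + 1) + 1) :=
    pair (pair (fst m 1) (pair (fst m 1) (snd m 1))) (snd m 1)
  have h₁ : fst m m ∘ₗ fst (m + m) 2 ∘ₗ X = fst m 1 := by
    change fst m (m + 1) ∘ₗ fst (m + (m + 1)) 1 ∘ₗ X = _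
    rw [fst_pair, fst_pair]
  have h₂ : snd m m ∘ₗ fst (m + m) 2 ∘ₗ X = fst m 1 := by
    change fst m 1 ∘ₗ snd m (m + 1) ∘ₗ fst (m + (m + 1)) 1 ∘ₗ X = _
    rw [fst_pair, snd_pair, fst_pair]
  have h₃ : fst 1 1 ∘ₗ snd (m + m) 2 ∘ₗ X = snd m 1 := by
    have h : snd m 1 ∘ₗ snd m (m + 1) ∘ₗ fst (m + (m + 1)) 1 ∘ₗ X = snd m 1 := by
      rw [fst_pair, snd_pair, snd_pair]
    rw [← h]
    exact lin_one_ext fun _ => rfl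
  have h₄ : snd 1 1 ∘ₗ snd (m + m) 2 ∘ₗ X = snd m 1 := by
    have h : snd (m + (m + 1)) 1 ∘ₗ X = snd m 1 := snd_pair _ _
    rw [← h]
    exact lin_one_ext fun _ => rfl
  refine pair_ext (m := m + m) (m' := 2) (pair_ext ?_ ?_) (pair_ext (m := 1) (m' := 1) ?_ ?_)
  · refine Eq.trans ?_ h₁.symm
    simp [blk_eq, dup]
  · refine Eq.trans ?_ h₂.symm
    simp [blk_eq, dup]
  · refine Eq.trans ?_ h₃.symm
    rw [blk_eq, snd_pair, dup]
    exact fst_pair_comp _ _ _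
  · refine Eq.trans ?_ h₄.symm
    rw [blk_eq, snd_pair, dup]
    exact snd_pair_comp _ _ _

theorem dup_add_one (m : ℕ) : dup (m + 1) =
    (pair (pair (pair (fst m 1) (snd m 1)) (fst m 1)) (snd m 1) :
      Lin k (m + 1) (m + 1 + m + 1)) := by
  let X : Lin k (m + 1) (m + 1 + m + 1) :=
    pair (pair (pair (fst m 1) (snd m 1)) (fst m 1)) (snd m 1)
  have h₁ : fst (m + 1) (m + 1) ∘ₗ X = LinearMap.id := by
    change fst (m + 1) m ∘ₗ fst (m + 1 + m) 1 ∘ₗ X = _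
    rw [fst_pair, fst_pair, pair_fst_snd]
  have h₂ : fst m 1 ∘ₗ snd (m + 1) (m + 1) ∘ₗ X = fst m 1 := by
    change snd (m + 1) m ∘ₗ fst (m + 1 + m) 1 ∘ₗ X = _
    rw [fst_pair, snd_pair]
  have h₃ : snd m 1 ∘ₗ snd (m + 1) (m + 1) ∘ₗ X = snd m 1 := by
    have h : snd (m + 1 + m) 1 ∘ₗ X = snd m 1 := snd_pair _ _
    conv_rhs => rw [← h]
    exact lin_one_ext fun _ => rfl
  exact pair_ext ((fst_pair _ _).trans h₁.symm)
    ((snd_pair _ _).trans (pair_ext (h₂.symm) (h₃.symm)))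

theorem dup_succ (m : ℕ) : (castL (by omega) ∘ₗ blk (blk LinearMap.id (swapL m 1)) LinearMap.id :
    Lin k (m + (m + 1) + 1) (m + 1 + m + 1)) ∘ₗ (blk (dup m) (dup 1) : Lin k (m + 1) (m + m + 2)) =
        dup (m + 1) := by
  rw [castL_add_one (Nat.add_assoc m 1 m).symm, castL_assoc_symm, blk_dup_dup_one, dup_add_one,
    swapL_eq]
  simp only [blk_eq, LinearMap.comp_assoc, pair_comp, fst_pair, snd_pair, LinearMap.id_comp]

variable [LinearOrder k]

/-- The circuit obtained from an effect by bending its last wires. -/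
noncomputable def relN {n m : ℕ} (e : Q k (n + m) 0) : Q k n m :=
  (idq n ⊠ (cls (PolyCirc.codeleteN m) ⨟ F (dup m)) : Q k (n + 0) (n + (m + m))) ⨟
    cst (Nat.add_assoc n m m).symm ⨟ (e ⊠ idq m) ⨟ cst (Nat.zero_add m)

theorem relN_eq_exN {n m : ℕ} (e : Q k (n + m) 0) :
    relN e = exN m (guard (F (snd n m)) e) := by
  rw [relN, tensor_comp_right, exN, wp, guard_snd_eq_swap]
  simp only [compq_assoc]

/-- The snake identity on `m` wires, read as an instance of the one-point rule. -/
theorem relN_eq_id (m : ℕ) :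
    relN (sub (snd m m - LinearMap.id ∘ₗ fst m m) (cls (PolyCirc.cozeroN m))) =
      (idq m : Q k m m) := by
  rw [relN_eq_exN, exN_guard, sub_F, snd_pair, F_id]

theorem comp_relN {l n m : ℕ} (c : Q k l n) (e : Q k (n + m) 0) :
    c ⨟ relN e = relN ((c ⊠ idq m) ⨟ e) := by
  have h₁ : c ⨟ (idq n ⊠ (cls (PolyCirc.codeleteN m) ⨟ F (dup m)) : Q k (n + 0) (n + (m + m))) =
      (idq l ⊠ (cls (PolyCirc.codeleteN m) ⨟ F (dup m)) : Q k (l + 0) (l + (m + m))) ⨟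
        (c ⊠ idq (m + m)) := by
    have h := interchange c (idq n) (idq 0) (cls (PolyCirc.codeleteN m) ⨟ F (dup m))
    rw [tensor_id_zero] at h
    rw [← interchange, ← h]
    simp
  have h₂ : (c ⊠ idq (m + m)) ⨟ cst (Nat.add_assoc n m m).symm =
      cst (Nat.add_assoc l m m).symm ⨟ (c ⊠ idq m ⊠ idq m) := by
    rw [tensor_assoc, idq_tensor_idq]
    simp only [compq_assoc]
    rw [cst_cancel_assoc]
  rw [relN, relN, tensor_comp_left]
  simp only [← compq_assoc]
  rw [h₁, compq_assoc (idq l ⊠ _) (c ⊠ _), h₂]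
  simp only [← compq_assoc]

theorem cls_copyN (m : ℕ) : cls (PolyCirc.copyN m) = F (dup m : Lin k m (m + m)) := by
  induction m with
  | zero => exact (F_id 0).symm.trans (congrArg F (lin_zero_ext _ _))
  | succ m ih =>
    have h₂ : cls (PolyCirc.copyN (m + 1)) = (cls (PolyCirc.copyN m) ⊠ copy : Q k (m + 1) (m + m + 2)) ⨟
        cls (FreeProp.cast (n := m + (m + 1) + 1) (n' := m + (m + 1) + 1)
          (m := m + (1 + m) + 1) (m' := m + 1 + m + 1) (by omega) (by omega)
          (FreeProp.id m ⊗ₚ FreeProp.swap m 1 ⊗ₚ PolyCirc.wire)) := rfl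
    have h₃ : cls (FreeProp.id m ⊗ₚ FreeProp.swap m 1 ⊗ₚ PolyCirc.wire) =
        (idq m ⊠ swapq m 1 ⊠ idq 1 : Q k _ _) := rfl
    rw [h₂, cls_cast, h₃, cst_rfl, idq_comp, ih, ← F_dup_one, F_tensor, ← F_id, ← F_id, ← F_swapL,
      F_tensor, F_tensor, ← F_castL, F_comp]
    exact (F_comp _ _).trans (congrArg F (dup_succ m))

theorem cls_polyhedral {n m p : ℕ} (A : FwdCirc k (n + m) p) :
    cls (PolyCirc.polyhedral A) =
      relN (cls A.incl ⨟ cls (PolyCirc.geqN p) ⨟ cls (PolyCirc.cozeroN p)) := by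
  rw [PolyCirc.polyhedral, cls_cast, cls_comp, cls_cast, cls_tensor, cls_tensor, cls_comp, cls_comp,
    cls_comp, cls_copyN, cst_rfl, cst_rfl, comp_idq, relN]
  simp only [compq_assoc]
  exact idq_comp _

theorem exists_fwdCirc {n m : ℕ} (M : Lin k n m) :
    ∃ A : FwdCirc k n m, cls A.incl = F M := by
  obtain ⟨t, rfl⟩ := isTermFn M
  exact ⟨Quotient.mk _ t, (F_fn t).symm⟩

variable [IsStrictOrderedRing k]

theorem exists_polyhedral {n m : ℕ} (c : PolyCirc k n m) :
    ∃ d, PolyCirc.IsPolyhedralNF d ∧ PolyCirc.IHPEq c d := by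
  have hc : ∀ {n m : ℕ} (c : Q k n m), Preserves c := fun c => by
    obtain ⟨t, rfl⟩ := tcls_surj c
    exact preserves_tcls t
  -- The circuit is replaced by its graph: its output is compared with `m` extra wires, and the
  -- resulting effect lies in `Cone`.
  obtain ⟨p, M, h⟩ := exists_matrix
    ((hc (cls c ⊠ idq m)).comp_mem (sub_mem_cone (snd m m - LinearMap.id ∘ₗ fst m m)
      (cozeroN_mem_cone m)))
  obtain ⟨A, hA⟩ := exists_fwdCirc M
  refine ⟨_, ⟨p, A, rfl⟩, cls_eq_iff.1 ?_⟩
  rw [cls_polyhedral, hA, ← h, ← comp_relN, relN_eq_id, comp_idq]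

end IHP

namespace IHP

variable {k : Type u} [Field k]

/-! ### Semantics of normal forms -/

/-- The graph of a linear map. -/
def graph {n m : ℕ} (A : Lin k n m) : VRel k n m := {q | q.2 = A q.1}

theorem graph_comp {n m o : ℕ} (A : Lin k n m) (B : Lin k m o) :
    VRel.comp (graph A) (graph B) = graph (B ∘ₗ A) := by
  ext q
  exact ⟨fun ⟨w, h, h'⟩ => h'.trans (congrArg B h), fun h => ⟨A q.1, rfl, h⟩⟩

theorem graph_tensor {n m n' m' : ℕ} (A : Lin k n m) (B : Lin k n' m') :
    VRel.tensor (graph A) (graph B) = graph (blk A B) := by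
  ext q
  rw [VRel.mem_tensor]
  constructor
  · rintro ⟨h, h'⟩
    exact (append_fst_snd q.2).symm.trans (congrArg₂ Fin.append h h')
  · intro h
    have h : q.2 = blk A B q.1 := h
    constructor
    · exact (congrArg (fst m m') h).trans (fst_append _ _)
    · exact (congrArg (snd m m') h).trans (snd_append _ _)

theorem graph_cast {n m m' : ℕ} (hm : m = m') (A : Lin k n m) :
    VRel.cast rfl hm (graph A) = graph (castL hm ∘ₗ A) := by
  subst hm; rfl

theorem graph_swap (n m : ℕ) : VRel.swap n m = graph (swapL n m : Lin k _ _) := by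
  ext q
  constructor
  · rintro ⟨x, y, rfl⟩
    exact congrArg₂ Fin.append (snd_append x y).symm (fst_append x y).symm
  · intro h
    refine ⟨fst n m q.1, snd n m q.1, Prod.ext (append_fst_snd _).symm h⟩

variable [LinearOrder k]

theorem sem_comp {n m o : ℕ} (f : PolyCirc k n m) (g : PolyCirc k m o) :
    PolyCirc.sem (f ⨾ g) = VRel.comp f.sem g.sem :=
  Quotient.inductionOn₂ f g fun _ _ => rfl

theorem sem_tensor {n m n' m' : ℕ} (f : PolyCirc k n m) (g : PolyCirc k n' m') :
    PolyCirc.sem (f ⊗ₚ g) = VRel.tensor f.sem g.sem :=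
  Quotient.inductionOn₂ f g fun _ _ => rfl

theorem sem_cast {n n' m m' : ℕ} (hn : n = n') (hm : m = m') (f : PolyCirc k n m) :
    PolyCirc.sem (FreeProp.cast hn hm f) = VRel.cast hn hm f.sem := by
  subst hn hm; rfl

theorem sem_incl {n m : ℕ} (A : FwdCirc k n m) : PolyCirc.sem A.incl = A.sem := by
  obtain ⟨t, rfl⟩ := Quotient.exists_rep A
  change PTerm.sem PolyGen.sem (PTerm.map PolyGen.fwd t) = PTerm.sem FwdGen.sem t
  induction t with
  | gen g => rfl
  | id n => rfl
  | swap n m => rfl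
  | comp f g hf hg => exact congrArg₂ VRel.comp hf hg
  | tensor f g hf hg => exact congrArg₂ VRel.tensor hf hg

theorem sem_copyN (m : ℕ) : (PolyCirc.copyN m : PolyCirc k m (m + m)).sem = graph (dup m : Lin k m (m + m)) := by
  induction m with
  | zero => exact congrArg (graph (k := k)) (lin_zero_ext LinearMap.id (dup 0))
  | succ m ih =>
    have h : PolyCirc.copyN (k := k) (m + 1) = (PolyCirc.copyN m ⊗ₚ PolyCirc.copy) ⨾
        FreeProp.cast (n := m + (m + 1) + 1) (n' := m + (m + 1) + 1)
          (m := m + (1 + m) + 1) (m' := m + 1 + m + 1) (by omega) (by omega)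
          (FreeProp.id m ⊗ₚ FreeProp.swap m 1 ⊗ₚ PolyCirc.wire) := rfl
    have h₁ : (PolyCirc.copy : PolyCirc k 1 2).sem = graph (dup 1 : Lin k 1 2) := by
      ext q
      constructor
      · rintro ⟨x, rfl⟩
        refine funext fun i => ?_
        fin_cases i <;> rfl
      · intro h
        refine ⟨q.1 0, Prod.ext (funext fun i => ?_) (h.trans (funext fun i => ?_))⟩
        · rw [Subsingleton.elim i 0]; rfl
        · fin_cases i <;> rfl
    have h₂ : PolyCirc.sem (FreeProp.id m ⊗ₚ FreeProp.swap m 1 ⊗ₚ PolyCirc.wire : PolyCirc k _ _) =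
        graph (blk (blk LinearMap.id (swapL m 1)) LinearMap.id) := by
      rw [sem_tensor, sem_tensor, ← graph_tensor, ← graph_tensor, ← graph_swap]
      rfl
    rw [h, sem_comp, sem_cast, sem_tensor, ih, h₁, h₂, graph_tensor, graph_cast]
    exact (graph_comp _ _).trans (congrArg graph (dup_succ m))

theorem sem_geqN (p : ℕ) :
    (PolyCirc.geqN p : PolyCirc k p p).sem = {q | ∀ i, q.2 i ≤ q.1 i} := by
  induction p with
  | zero =>
    ext q
    exact ⟨fun _ i => i.elim0, fun _ => funext fun i => i.elim0⟩
  | succ p ih =>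
    ext q
    rw [PolyCirc.geqN, sem_tensor, VRel.mem_tensor, ih]
    constructor
    · rintro ⟨h, x, y, h', h''⟩ i
      induction i using Fin.addCases with
      | left i => exact h i
      | right i =>
        rw [Subsingleton.elim i 0]
        have h₁ := congrFun (congrArg Prod.fst h'') 0
        have h₂ := congrFun (congrArg Prod.snd h'') 0
        exact (le_of_eq h₂).trans (h'.trans (le_of_eq h₁.symm))
    · intro h
      refine ⟨fun i => h _, _, _, h (Fin.last p), Prod.ext ?_ ?_⟩ <;>
      · funext i
        rw [Subsingleton.elim i 0]
        rfl

theorem sem_cozeroN (p : ℕ) :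
    (PolyCirc.cozeroN p : PolyCirc k p 0).sem = {q | q.1 = 0} := by
  induction p with
  | zero =>
    ext q
    exact ⟨fun _ => funext fun i => i.elim0, fun _ => funext fun i => i.elim0⟩
  | succ p ih =>
    ext q
    rw [PolyCirc.cozeroN, sem_tensor, VRel.mem_tensor, ih]
    constructor
    · rintro ⟨h, h'⟩
      funext i
      induction i using Fin.addCases with
      | left i => exact congrFun h i
      | right i =>
        rw [Subsingleton.elim i 0]
        exact congrFun (congrArg Prod.snd h') 0
    · intro h
      have h : ∀ i, q.1 i = 0 := congrFun h
      refine ⟨funext fun i => h _, Prod.ext (funext fun i => i.elim0) (funext fun i => ?_)⟩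
      rw [Subsingleton.elim i 0]
      exact h _

theorem mem_sem_codeleteN (m : ℕ) (q : (Fin 0 → k) × (Fin m → k)) :
    q ∈ (PolyCirc.codeleteN m : PolyCirc k 0 m).sem := by
  induction m with
  | zero => exact funext fun i => i.elim0
  | succ m ih =>
    rw [PolyCirc.codeleteN, sem_tensor]
    exact (VRel.mem_tensor _ _ _).2 ⟨ih _, q.2 (Fin.last m), Prod.ext
      (funext fun i => by rw [Subsingleton.elim i 0]; rfl) (funext fun i => i.elim0)⟩

/-- The block `codelete ; copy` emits an arbitrary pair `(z, z)`; the second copy is the output,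
which forces `z = y`, while the first one enters the inequalities. -/
theorem sem_polyhedral {n m p : ℕ} (A : FwdCirc k (n + m) p) (M : Lin k (n + m) p)
    (h : A.sem = graph M) :
    (PolyCirc.polyhedral A).sem = {q | 0 ≤ M (Fin.append q.1 q.2)} := by
  have h₁ : PolyCirc.sem (A.incl ⨾ PolyCirc.geqN p ⨾ PolyCirc.cozeroN p) = {q | 0 ≤ M q.1} := by
    rw [sem_comp, sem_comp, sem_incl, h, sem_geqN, sem_cozeroN]
    ext q
    constructor
    · rintro ⟨z, ⟨w, h₁, h₂⟩, h₃⟩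
      have h₁ : w = M q.1 := h₁
      have h₃ : z = 0 := h₃
      subst h₁ h₃
      exact h₂
    · intro h₂
      exact ⟨0, ⟨M q.1, rfl, h₂⟩, rfl⟩
  have h₂ : PolyCirc.sem (PolyCirc.codeleteN m ⨾ PolyCirc.copyN m : PolyCirc k 0 (m + m)) =
      {q | ∃ y, q.2 = Fin.append y y} := by
    rw [sem_comp, sem_copyN]
    ext q
    exact ⟨fun ⟨y, _, h⟩ => ⟨y, h⟩, fun ⟨y, h⟩ => ⟨y, mem_sem_codeleteN m _, h⟩⟩
  have hy (y : Fin m → k) : (fun i => y (Fin.cast (Nat.zero_add m) (Fin.natAdd 0 i))) = y :=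
    funext fun i => congrArg y (Fin.ext (by simp))
  have ha (x : Fin n → k) (y z : Fin m → k) : (fun i => Fin.append x (Fin.append y z)
      (Fin.cast (Nat.add_assoc n m m) i)) = Fin.append (Fin.append x y) z :=
    (Fin.append_assoc x y z).symm
  ext ⟨x, y⟩
  rw [PolyCirc.polyhedral, sem_cast, sem_comp, sem_cast, sem_tensor, sem_tensor, h₁, h₂]
  have key (z : Fin m → k) : (Fin.append x (Fin.append z z), fun i => y (Fin.cast (Nat.zero_add m) i)) ∈
      VRel.cast (Nat.add_assoc n m m) rfl (VRel.tensor {q : _ × (Fin 0 → k) | 0 ≤ M q.1}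
        (PolyCirc.sem (FreeProp.id m))) ↔ 0 ≤ M (Fin.append x z) ∧ y = z := by
    change (fun i => Fin.append x (Fin.append z z) (Fin.cast (Nat.add_assoc n m m) i),
      fun i => y (Fin.cast (Nat.zero_add m) i)) ∈ VRel.tensor _ _ ↔ _
    rw [ha, VRel.mem_tensor]
    simp only [Fin.append_left, Fin.append_right, hy]
    rfl
  constructor
  · rintro ⟨w, h₃, h₄⟩
    obtain ⟨h₃, z, h₅⟩ := (VRel.mem_tensor _ _ _).1 h₃
    have hw : w = Fin.append x (Fin.append z z) :=
      (append_fst_snd w).symm.trans (congrArg₂ Fin.append h₃ h₅)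
    subst hw
    obtain ⟨h₄, rfl⟩ := (key z).1 h₄
    exact h₄
  · intro h₃
    refine ⟨Fin.append x (Fin.append y y), (VRel.mem_tensor _ _ _).2 ⟨?_, y, ?_⟩,
      (key y).2 ⟨h₃, rfl⟩⟩
    · exact fst_append x _
    · exact snd_append x _

end IHP

theorem mainTheorem6 {k : Type u} [Field k] [LinearOrder k] [IsStrictOrderedRing k] {n m : ℕ} :
    (∀ c : PolyCirc k n m,
      ∃ d : PolyCirc k n m, PolyCirc.IsPolyhedralNF d ∧ PolyCirc.IHPEq c d) ∧
    (∀ (p : ℕ) (A : FwdCirc k (n + m) p),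
      ∃ M : Matrix (Fin p) (Fin (n + m)) k,
        A.sem = {q | q.2 = M.mulVec q.1} ∧
        (PolyCirc.polyhedral A).sem = {q | 0 ≤ M.mulVec (Fin.append q.1 q.2)}) := by
  refine ⟨IHP.exists_polyhedral, fun p A => ?_⟩
  obtain ⟨t, rfl⟩ := Quotient.exists_rep A
  refine ⟨LinearMap.toMatrix' (IHP.fn t), ?_, ?_⟩
  · simp only [LinearMap.toMatrix'_mulVec]
    exact IHP.sem_eq_fn t
  · simp only [LinearMap.toMatrix'_mulVec]
    exact IHP.sem_polyhedral _ _ (IHP.sem_eq_fn t)
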